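/- **Setting.** Let $Y=m(D,X,\varepsilon)$, where $D$ is a real random variable, $X$ takes values in $\mathbb R^{k}$, $\varepsilon$ takes values in a measurable space, $m$ is measurable, and $m(\cdot,x,e)$ is $C^1$ for each $(x,e)$. $D$ has a Lebesgue density $f_D>0$ on $\operatorname{supp}D$, and the law of $(D,X)$ has a density with respect to Lebesgue measure times the law of $X$. Write $F_Z$ for the distribution function of $Z$. For a family of continuous distribution functions $H_t$, $t\in[0,1]$, let $\pi_t(d)=H_t^{-1}(F_D(d))$ with $H^{-1}(\tau)=\inf\{z: H(z)\ge\tau\}$, $D^t=\pi_t(D)$ and $Y^t=m(D^t,X,\varepsilon)$. **Assumptions.** 1. For every $d\in\operatorname{supp}D$ with $F_D(d)>0$: $\pi_0(d)=d$, and $\dot\pi(d)=\partial_t\pi_t(d)|_{t=0}$ exists (one-sided in $t$) and is bounded in $d$. 2. $F_Y$ is $C^1$ on $\operatorname{supp}Y$ with density $f_Y\in(0,\infty)$ there. With $\dot m(d,x,e)=\dot\pi(d)\,\partial_dm(d,x,e)$ (measurable), $P[|Y^t-Y-t\,\dot m(D,X,\varepsilon)|\ge\nu t]=o(t)$ as $t\downarrow0$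 for every $\nu>0$. $(Y,\dot m(D,X,\varepsilon))$ has a density $f(y,y')$ that is continuous in $y\in\operatorname{supp}Y$ and satisfies $f(y,y')\le C_0|g(y')|$ for a constant $C_0>0$ and a function $g$ with $\int(1+|y'|)|g(y')|\,dy'<\infty$. 3. For each $(d,x)\in\operatorname{supp}D\times\operatorname{supp}X$: the conditional law of $Y$ given $(D,X)=(d,x)$ has a density that is positive, bounded and continuous on its support; $F_{Y|D,X}(y|d,x)$ is $C^1$ in $d\in\operatorname{supp}D$ for each $y$; $\partial_dm(d,x,\cdot)$ is measurable and $P[|m(d+\delta,x,\varepsilon)-m(d,x,\varepsilon)-\delta\,\partial_dm(d,x,\varepsilon)|\ge\nu\delta\mid D=d,X=x]=o(\delta)$ as $\delta\downarrow0$ for every $\nu>0$; the conditional law of $(Y,\partial_dm(d,x,\varepsilon))$ has a density, continuous in $y$ on the support of the conditional law of $Y$, and bounded by $C_1|g_1(y')|$, where $\int(1+|y'|)|g_1(y')|\,dy'<\infty$ and $g_1,C_1$ do not depend on $(y,d,x)$. 4. $\varepsilon\perp D\mid X$: the conditional law of $\varepsilon$ given $(D,X)=(d,x)$ does not depend on $d\in\operatorname{supp}D$,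 for each $x\in\operatorname{supp}X$. 5. For each $t\in[0,1]$: $\operatorname{supp}D^t\subseteq\operatorname{supp}D$, and $C$ is a copula of $(D^t,X)$, i.e. $P[D^t\le d,X\le x]=C(F_{D^t}(d),F_X(x))$ with $F_X(x)=(F_{X_1}(x_1),\dots,F_{X_k}(x_k))$. $C$ is partially differentiable in its first argument on $(0,1)$. 6. $\Gamma$, with values in a Banach space and defined on a set of elements of $\ell^\infty(\mathbb R)$ (sup norm) that contains $F_Y$ and all $F_{Y^t}$, is Hadamard-differentiable at $F_Y$ tangentially to a linear subspace $\mathbb D_0\subseteq\ell^\infty(\mathbb R)$ that contains all continuous functions with finite limits at $\pm\infty$, with continuous linear derivative $\Gamma'_{F_Y}:\mathbb D_0\to\mathbb B$. Put $\theta_\Gamma=\lim_{t\downarrow0}\big(\Gamma(F_{Y^t})-\Gamma(F_Y)\big)/t$. **(i)** Let $H_t=F_D+t(G_D-F_D)$ with $G_D$ a distribution function. Then $\dot\pi(d)=-(G_D(d)-F_D(d))/f_D(d)$ for $P_D$-almost every $d$, and for every $d\in\operatorname{supp}D$ with $F_D(d)>0$ at which $f_D(d)$ is the derivative of $F_D$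 (relative to $\operatorname{supp}D$). The limit $\theta_\Gamma$ exists and equals $\Gamma'_{F_Y}\big(E[\dot\pi(D)\,\partial_dF_{Y|D,X}(\cdot|D,X)]\big)$. Moreover $$\theta_\Gamma=\int\Gamma'_{F_Y}\big(F_{Y|D,X}(\cdot|d,x)\big)\,d\big(F_{X|D}(x|d)(G_D(d)-F_D(d))\big)=\int\Gamma'_{F_Y}\big(F_{Y|D,X}(\cdot|d,x)\big)\,d\big(\partial_tC(H_t(d),F_X(x))|_{t=0}\big),$$ where the derivative $\partial_tC(H_t(d),F_X(x))|_{t=0}$ exists for all $(d,x)$ and, for each $x$, equals $F_{X|D}(x|d)(G_D(d)-F_D(d))$ for almost every $d$. Each integral is a Bochner integral with respect to the finite signed measure on $\mathbb R\times\mathbb R^k$ that has the displayed integrator as its distribution function, whenever this measure exists; the integrand is then integrable. **(ii)** Let $H_t(d)=F_D(d-t)$ (location shift). Then $\theta_\Gamma$ exists and $\theta_\Gamma=\Gamma'_{F_Y}\big(E[\partial_dF_{Y|D,X}(\cdot|D,X)]\big)$. -/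

import Mathlib

open MeasureTheory ProbabilityTheory Filter Topology Set Asymptotics

namespace MPE

noncomputable section

/-! ### Distribution functions, quantiles, copulas -/

/-- The distribution function `z ↦ P[Z ≤ z]` of a real random variable. -/
def cdfFun {Ω : Type*} [MeasurableSpace Ω] (P : Measure Ω) (Z : Ω → ℝ) (z : ℝ) : ℝ :=
  P.real {ω | Z ω ≤ z}

/-- The generalised inverse `H⁻¹(τ) = inf {z | H z ≥ τ}`. -/
def quantile (H : ℝ → ℝ) (τ : ℝ) : ℝ := sInf {z | τ ≤ H z}

/-- `C` is a copula on `[0,1]^{1+k}`: on the unit cube it is the joint distribution function of a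
probability measure all of whose one-dimensional margins are uniform on `[0,1]`. -/
def IsCopula {k : ℕ} (C : ℝ → (Fin k → ℝ) → ℝ) : Prop :=
  ∃ ν : Measure (ℝ × (Fin k → ℝ)), IsProbabilityMeasure ν ∧
    ν.map Prod.fst = volume.restrict (Icc (0 : ℝ) 1) ∧
    (∀ i, ν.map (fun p => p.2 i) = volume.restrict (Icc (0 : ℝ) 1)) ∧
    ∀ u ∈ Icc (0 : ℝ) 1, ∀ v : Fin k → ℝ, (∀ i, v i ∈ Icc (0 : ℝ) 1) →
      C u v = ν.real (Iic u ×ˢ Iic v)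

/-- `C` is a copula of the pair `(Z, X)`:
`P[Z ≤ z, X ≤ x] = C(F_Z(z), F_{X₁}(x₁), …, F_{X_k}(x_k))` for all `(z, x)`. -/
def IsCopulaOf {Ω : Type*} [MeasurableSpace Ω] {k : ℕ} (P : Measure Ω)
    (C : ℝ → (Fin k → ℝ) → ℝ) (Z : Ω → ℝ) (X : Ω → Fin k → ℝ) : Prop :=
  IsCopula C ∧ ∀ (z : ℝ) (x : Fin k → ℝ),
    P.real {ω | Z ω ≤ z ∧ X ω ≤ x} =
      C (cdfFun P Z z) (fun i => cdfFun P (fun ω => X ω i) (x i))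

/-- The finite signed measure `μ` on `ℝ × ℝᵏ` is the Lebesgue–Stieltjes measure `dK` generated by
`K(d, x)`: its distribution function is `K` (for almost every `d`; the distribution function of a
signed measure is right-continuous, so this determines `μ`). -/
def IsStieltjesMeasureOf {k : ℕ} (μ : SignedMeasure (ℝ × (Fin k → ℝ)))
    (K : ℝ → (Fin k → ℝ) → ℝ) : Prop :=
  ∀ x : Fin k → ℝ, ∀ᵐ d : ℝ, μ (Iic d ×ˢ Iic x) = K d x

/-! ### Bounded functions and Hadamard differentiability -/

/-- The space `ℓ^∞(ℝ)` of bounded functions on `ℝ` with the supremum norm. -/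
abbrev LInf : Type := lp (fun _ : ℝ => ℝ) ⊤

/-- The distribution function `e ↦ μ{f ≤ y}` of `f` under a probability measure, as an element of
`ℓ^∞(ℝ)`. -/
def cdfL {Ω : Type*} [MeasurableSpace Ω] (μ : Measure Ω) [IsProbabilityMeasure μ]
    (f : Ω → ℝ) : LInf :=
  ⟨cdfFun μ f, memℓp_infty ⟨1, by
    rintro _ ⟨y, rfl⟩
    simp only [cdfFun, Real.norm_eq_abs, abs_of_nonneg measureReal_nonneg]
    exact measureReal_le_one⟩⟩

/-- `Γ : DΓ ⊆ V → B` is Hadamard-differentiable at `F ∈ DΓ` tangentially to the linear subspace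
`D₀`, with the continuous linear map `Γ' : D₀ → B` as its Hadamard derivative. -/
def HasHadamardDerivAt {V B : Type*} [NormedAddCommGroup V] [NormedSpace ℝ V]
    [NormedAddCommGroup B] [NormedSpace ℝ B]
    (DΓ : Set V) (Γ : V → B) (F : V) (D₀ : Submodule ℝ V) (Γ' : D₀ →L[ℝ] B) : Prop :=
  F ∈ DΓ ∧ ∀ (h : D₀) (t : ℕ → ℝ) (hn : ℕ → V),
    (∀ n, 0 < t n) → Tendsto t atTop (𝓝 0) → Tendsto hn atTop (𝓝 (h : V)) →
    (∀ n, F + t n • hn n ∈ DΓ) →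
    Tendsto (fun n => (t n)⁻¹ • (Γ (F + t n • hn n) - Γ F)) atTop (𝓝 (Γ' h))

/-- `D₀` contains every bounded continuous function with limits at `±∞`, that is `C([-∞, ∞])`. -/
def ContainsContinuous (D₀ : Submodule ℝ LInf) : Prop :=
  ∀ h : LInf, Continuous (h : ℝ → ℝ) → (∃ l, Tendsto (h : ℝ → ℝ) atBot (𝓝 l)) →
    (∃ l, Tendsto (h : ℝ → ℝ) atTop (𝓝 l)) → h ∈ D₀

open Classical in
/-- The value `Γ'(h)` for `h` in the domain `D₀` of `Γ'` (and `0` for other `h`). -/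
def applyOn {V B : Type*} [NormedAddCommGroup V] [NormedSpace ℝ V]
    [NormedAddCommGroup B] [NormedSpace ℝ B]
    {D₀ : Submodule ℝ V} (Γ' : D₀ →L[ℝ] B) (h : V) : B :=
  if hh : h ∈ D₀ then Γ' ⟨h, hh⟩ else 0

/-! ### The nonseparable model -/

/-- The data of the nonseparable model `Y = m(D, X, ε)` with a scalar policy variable `D`, a vector
of `k` covariates `X`, an unobserved disturbance `ε` in an arbitrary measurable space, and a regular
conditional distribution `κ` of `ε` given `(D, X)`. -/
structure Model (Ω E : Type*) [MeasurableSpace Ω] [MeasurableSpace E] (k : ℕ) where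
  P : Measure Ω
  D : Ω → ℝ
  X : Ω → Fin k → ℝ
  ε : Ω → E
  m : ℝ → (Fin k → ℝ) → E → ℝ
  κ : Kernel (ℝ × (Fin k → ℝ)) E
  isProb : IsProbabilityMeasure P
  measurable_D : Measurable D
  measurable_X : Measurable X
  measurable_ε : Measurable ε
  measurable_m : Measurable (fun p : ℝ × (Fin k → ℝ) × E => m p.1 p.2.1 p.2.2)
  isMarkov : IsMarkovKernel κ
  disintegration : P.map (fun ω => ((D ω, X ω), ε ω)) = (P.map (fun ω => (D ω, X ω))) ⊗ₘ κ

attribute [instance] Model.isProb Model.isMarkov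

namespace Model

variable {Ω E : Type*} [MeasurableSpace Ω] [MeasurableSpace E] {k : ℕ} (M : Model Ω E k)

/-- The status quo outcome `Y = m(D, X, ε)`. -/
def Y (ω : Ω) : ℝ := M.m (M.D ω) (M.X ω) (M.ε ω)

/-- The outcome `m(π(D), X, ε)` under the policy function `π`. -/
def Yof (π : ℝ → ℝ) (ω : Ω) : ℝ := M.m (π (M.D ω)) (M.X ω) (M.ε ω)

/-- The structural derivative `∂_d m(d, x, e)`. -/
def dm (d : ℝ) (x : Fin k → ℝ) (e : E) : ℝ := deriv (fun d' => M.m d' x e) d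

/-- The distribution function `F_D`. -/
def FD (d : ℝ) : ℝ := cdfFun M.P M.D d

def suppD : Set ℝ := (M.P.map M.D).support

def suppX : Set (Fin k → ℝ) := (M.P.map M.X).support

def suppY : Set ℝ := (M.P.map M.Y).support

/-- The conditional distribution of `Y` given `(D, X) = (d, x)`, i.e. the law of `m(d, x, ε)` under
the conditional distribution of `ε`. -/
def lawY (d : ℝ) (x : Fin k → ℝ) : Measure ℝ := (M.κ (d, x)).map (M.m d x)

/-- The conditional distribution function `F_{Y|D,X}(y|d,x)`. -/
def condF (y d : ℝ) (x : Fin k → ℝ) : ℝ := cdfFun (M.κ (d, x)) (M.m d x) y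

/-- The function `F_{Y|D,X}(·|d,x)` as an element of `ℓ^∞(ℝ)`. -/
def condFL (d : ℝ) (x : Fin k → ℝ) : LInf := cdfL (M.κ (d, x)) (M.m d x)

/-- The partial derivative `∂_d F_{Y|D,X}(y|d,x)` (for `d` in the support of `D`). -/
def dcondF (y d : ℝ) (x : Fin k → ℝ) : ℝ := derivWithin (fun d' => M.condF y d' x) M.suppD d

/-- The conditional distribution function `F_{X|D}(x|d)`. -/
def FXgivenD (x : Fin k → ℝ) (d : ℝ) : ℝ := (condDistrib M.X M.D M.P d).real (Iic x)

/-- The vector `(F_{X₁}(x₁), …, F_{X_k}(x_k))` of marginal distribution functions. -/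
def FX (x : Fin k → ℝ) (i : Fin k) : ℝ := cdfFun M.P (fun ω => M.X ω i) (x i)

/-- The policy function `π_t(d) = H_t⁻¹(F_D(d))`. -/
def policy (H : ℝ → ℝ → ℝ) (t d : ℝ) : ℝ := quantile (H t) (M.FD d)

/-- `D` is continuously distributed, with (Lebesgue) density `fD`, also conditionally on `X`:
the law of `(D, X)` has a density with respect to Lebesgue measure times the law of `X`. -/
structure HasDensityD (fD : ℝ → ℝ) : Prop where
  measurable : Measurable fD
  nonneg : ∀ d, 0 ≤ fD d
  law : M.P.map M.D = volume.withDensity (fun d => ENNReal.ofReal (fD d))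
  joint : M.P.map (fun ω => (M.D ω, M.X ω)) ≪ (volume : Measure ℝ).prod (M.P.map M.X)

/-- The structural assumptions: `m` is continuously differentiable in `d`, `π_0` is the identity,
and `t ↦ π_t(d)` has at `t = 0` the (right) derivative `πdot d`, which is bounded in `d`.
The policy function is considered at the points of the support of `D` with `0 < F_D(d)`,
where the quantile that defines it is finite. -/
structure Structural (π : ℝ → ℝ → ℝ) (πdot : ℝ → ℝ) : Prop where
  contDiff_m : ∀ x e, ContDiff ℝ 1 (fun d => M.m d x e)
  policy_zero : ∀ d ∈ M.suppD, 0 < M.FD d → π 0 d = d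
  policy_deriv : ∀ d ∈ M.suppD, 0 < M.FD d →
    HasDerivWithinAt (fun t => π t d) (πdot d) (Icc 0 1) 0
  policy_bdd : ∃ R, ∀ d ∈ M.suppD, 0 < M.FD d → |πdot d| ≤ R

/-- Regularity of the outcome and of the structural response `ṁ = πdot(d) ∂_d m(d, x, e)`. -/
structure RegularResponse (π : ℝ → ℝ → ℝ) (πdot : ℝ → ℝ) : Prop where
  /-- `F_Y` is continuously differentiable on its support, with positive density. -/
  outcome : ∃ fY : ℝ → ℝ, Measurable fY ∧
    M.P.map M.Y = volume.withDensity (fun y => ENNReal.ofReal (fY y)) ∧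
    ContinuousOn fY M.suppY ∧
    ∀ y ∈ M.suppY, 0 < fY y ∧ HasDerivWithinAt (cdfFun M.P M.Y) (fY y) M.suppY y
  measurable_response :
    Measurable (fun p : ℝ × (Fin k → ℝ) × E => πdot p.1 * M.dm p.1 p.2.1 p.2.2)
  linearization : ∀ ν > 0,
    (fun t => M.P.real {ω | ν * t ≤
      |M.Yof (π t) ω - M.Y ω - t * (πdot (M.D ω) * M.dm (M.D ω) (M.X ω) (M.ε ω))|})
      =o[𝓝[>] 0] (fun t => t)
  /-- The law of `(Y, ṁ(D, X, ε))` has a density, continuous in its first argument on the support of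
  `Y`, and dominated by an integrable function of its second argument with a first moment. -/
  joint_density : ∃ (f : ℝ → ℝ → ℝ) (g : ℝ → ℝ) (C : ℝ),
    Measurable (Function.uncurry f) ∧ (∀ y y', 0 ≤ f y y') ∧
    M.P.map (fun ω => (M.Y ω, πdot (M.D ω) * M.dm (M.D ω) (M.X ω) (M.ε ω))) =
      (volume : Measure (ℝ × ℝ)).withDensity (fun p => ENNReal.ofReal (f p.1 p.2)) ∧
    (∀ y', ContinuousOn (fun y => f y y') M.suppY) ∧
    Integrable g ∧ Integrable (fun y' => y' * g y') ∧ 0 < C ∧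
    ∀ y y', f y y' ≤ C * |g y'|

/-- Regularity of the conditional distributions given `(D, X) = (d, x)`, for every `d` in the support
of `D` and every `x` in the support of `X`. -/
structure RegularConditional : Prop where
  /-- The conditional law of `Y` has a density that is positive, bounded and continuous on its
  support. -/
  cond_density : ∀ d ∈ M.suppD, ∀ x ∈ M.suppX, ∃ q : ℝ → ℝ, Measurable q ∧
    M.lawY d x = volume.withDensity (fun y => ENNReal.ofReal (q y)) ∧
    ContinuousOn q (M.lawY d x).support ∧
    (∀ y ∈ (M.lawY d x).support, 0 < q y) ∧ ∃ R, ∀ y ∈ (M.lawY d x).support, q y ≤ R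
  contDiff_condF : ∀ (y : ℝ), ∀ x ∈ M.suppX, ContDiffOn ℝ 1 (fun d => M.condF y d x) M.suppD
  measurable_dm : ∀ d ∈ M.suppD, ∀ x ∈ M.suppX, Measurable (M.dm d x)
  linearization : ∀ d ∈ M.suppD, ∀ x ∈ M.suppX, ∀ ν > 0,
    (fun δ => (M.κ (d, x)).real {e | ν * δ ≤
      |M.m (d + δ) x e - M.m d x e - δ * M.dm d x e|}) =o[𝓝[>] 0] (fun δ => δ)
  /-- The conditional law of `(Y, ∂_d m(d, x, ε))` has a density, continuous in its first argument on
  the support of the conditional law of `Y`, and dominated, uniformly in `(y, d, x)`, by an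
  integrable function of its second argument with a first moment. -/
  cond_joint_density : ∃ (f : ℝ → (Fin k → ℝ) → ℝ → ℝ → ℝ) (g : ℝ → ℝ) (C : ℝ),
    Integrable g ∧ Integrable (fun y' => y' * g y') ∧ 0 < C ∧
    ∀ d ∈ M.suppD, ∀ x ∈ M.suppX,
      Measurable (Function.uncurry (f d x)) ∧ (∀ y y', 0 ≤ f d x y y') ∧
      (M.κ (d, x)).map (fun e => (M.m d x e, M.dm d x e)) =
        (volume : Measure (ℝ × ℝ)).withDensity (fun p => ENNReal.ofReal (f d x p.1 p.2)) ∧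
      (∀ y', ContinuousOn (fun y => f d x y y') (M.lawY d x).support) ∧
      ∀ y y', f d x y y' ≤ C * |g y'|

/-- Conditional independence `ε ⊥ D | X`: the conditional distribution of `ε` given
`(D, X) = (d, x)` does not depend on `d`. -/
def CondIndep : Prop :=
  ∀ x ∈ M.suppX, ∀ d ∈ M.suppD, ∀ d' ∈ M.suppD, M.κ (d, x) = M.κ (d', x)

/-- The conditions on the rank-preserving intervention `D^t = H_t⁻¹(F_D(D))`, `t ∈ [0,1]`. -/
structure RankPreserving (fD : ℝ → ℝ) (H : ℝ → ℝ → ℝ) (C : ℝ → (Fin k → ℝ) → ℝ) : Prop where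
  supp_subset : ∀ t ∈ Icc (0 : ℝ) 1,
    (M.P.map (fun ω => M.policy H t (M.D ω))).support ⊆ M.suppD
  continuous_H : ∀ t ∈ Icc (0 : ℝ) 1, Continuous (H t)
  fD_pos : ∀ d ∈ M.suppD, 0 < fD d
  copula : ∀ t ∈ Icc (0 : ℝ) 1, IsCopulaOf M.P C (fun ω => M.policy H t (M.D ω)) M.X
  copula_diff : ∀ u ∈ Ioo (0 : ℝ) 1, ∀ v : Fin k → ℝ, (∀ i, v i ∈ Icc (0 : ℝ) 1) →
    DifferentiableAt ℝ (fun u' => C u' v) u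

/-- All assumptions together, for the intervention `D^t = H_t⁻¹(F_D(D))`. -/
structure Assumptions (fD : ℝ → ℝ) (H : ℝ → ℝ → ℝ) (πdot : ℝ → ℝ)
    (C : ℝ → (Fin k → ℝ) → ℝ) : Prop where
  density : M.HasDensityD fD
  structural : M.Structural (M.policy H) πdot
  response : M.RegularResponse (M.policy H) πdot
  conditional : M.RegularConditional
  condIndep : M.CondIndep
  rank : M.RankPreserving fD H C

/-- The marginal perturbation `H_t = F_D + t (G - F_D)` in the direction of a distribution
function `G`. -/
def mixture (G : ℝ → ℝ) (t d : ℝ) : ℝ := M.FD d + t * (G d - M.FD d)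

/-- The location shift `H_t(d) = F_D(d - t)`. -/
def shift (t d : ℝ) : ℝ := M.FD (d - t)

/-- For all `t ∈ [0,1]` the functional is defined at the distribution function of the counterfactual
outcome `Y^t = m(D^t, X, ε)`. -/
def InDomain (DΓ : Set LInf) (π : ℝ → ℝ → ℝ) : Prop :=
  ∀ t ∈ Icc (0 : ℝ) 1, cdfL M.P (M.Yof (π t)) ∈ DΓ

/-- `θ` is the marginal policy effect `lim_{t ↓ 0} (Γ(F_{Y^t}) - Γ(F_Y)) / t`. -/
def IsMPE {B : Type*} [NormedAddCommGroup B] [NormedSpace ℝ B] (Γ : LInf → B) (π : ℝ → ℝ → ℝ)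
    (θ : B) : Prop :=
  Tendsto (fun t : ℝ => t⁻¹ • (Γ (cdfL M.P (M.Yof (π t))) - Γ (cdfL M.P M.Y))) (𝓝[>] 0) (𝓝 θ)

/-- `θ = ∫ Γ'(F_{Y|D,X}(·|d,x)) dK(d,x)`: for the finite signed measure `μ` with distribution
function `K` the integrand is integrable and `θ` is its integral. -/
def EqStieltjesIntegral {B : Type*} [NormedAddCommGroup B] [NormedSpace ℝ B]
    {D₀ : Submodule ℝ LInf} (Γ' : D₀ →L[ℝ] B) (K : ℝ → (Fin k → ℝ) → ℝ) (θ : B) : Prop :=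
  ∀ μ : SignedMeasure (ℝ × (Fin k → ℝ)), IsStieltjesMeasureOf μ K →
    μ.Integrable (fun p => applyOn Γ' (M.condFL p.1 p.2)) ∧
    θ = μ.integral (fun p => applyOn Γ' (M.condFL p.1 p.2)) (ContinuousLinearMap.lsmul ℝ ℝ).flip

end Model

end

end MPE

open MPE

/-! Let U = F_D(D), which is uniform on (0, 1), and let k(x, v) be the density of U given X = x. By
conditional independence F_{Y^t}(y) = E[F_{Y|D,X}(y|π_t(D), X)], so F_{Y^t}(y) - F_Y(y) is the mean
of the integral of ∂_d F_{Y|D,X}(y|s, X) over s from D to π_t(D). The policy preserves ranks: D ≤ s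
means U ≤ H_0(s), and π_t(D) ≤ s means U ≤ H_t(s). Fubini's theorem therefore turns the increment
into the integral of ∂_d F_{Y|D,X}(y|s, x) against the weight w_t(x, s) = ∫ k(x, v) dv, with v
running from H_t(s) to H_0(s) (`cdfFun_Yof_sub`).

This separates y from t. Since ∂_d F_{Y|D,X} is bounded uniformly in (y, d, x)
(`exists_abs_dcondF_le`), uniform convergence in y of the difference quotients follows from L¹
convergence of w_t / t (`tendsto_integral_weight_sub`). Pointwise convergence to ℓ(s) k(x, H_0(s)),
where ℓ is minus the derivative of H_t at t = 0, is Lebesgue's differentiation theorem. The norms of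
w_t / t do not exceed that of the limit, because k(·, v) integrates to 1 and ∫ |H_0 - H_t| = t ∫
|ℓ|, an exact identity for mixtures and for shifts alike; the Riesz–Scheffé lemma concludes. The
limit lies in C([-∞, ∞]), and the functional delta method gives the marginal effect
(`isMPE_of_tendsto`).

For the integral representations let Δ = G_D - F_D. The Jordan parts of a signed measure with
distribution function F_{X|D}(x|d) Δ(d) live on supp D × supp X, by mutual singularity. Integration
by parts in d cancels the boundary terms, since Δ → 0 at +∞, and leaves -∫ Δ(s) E[∂_d F_{Y|D,X}(y|s,
X) | D = s] ds, which is the mean response because the policy derivative times f_D is -Δ. This holds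
for each y and lifts to Bochner integrals in C([-∞, ∞]), which commute with the derivative of the
functional (`eqStieltjesIntegral`). The formula for the policy derivative comes from H_t(π_t(d)) =
F_D(d), the one for the copula from C(F_D(d), F_X(x)) = ∫_{r ≤ d} F_{X|D}(x|r) f_D(r) dr. -/

namespace MPE

/-! ### Continuous distribution functions and their quantiles -/

/-- A continuous distribution function on the real line. -/
structure IsContinuousCDF (H : ℝ → ℝ) : Prop where
  mono : Monotone H
  cont : Continuous H
  bot : Tendsto H atBot (𝓝 0)
  top : Tendsto H atTop (𝓝 1)

namespace IsContinuousCDF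

variable {H : ℝ → ℝ}

lemma nonneg (hH : IsContinuousCDF H) (z : ℝ) : 0 ≤ H z :=
  le_of_tendsto hH.bot (by filter_upwards [eventually_le_atBot z] with x hx using hH.mono hx)

lemma le_one (hH : IsContinuousCDF H) (z : ℝ) : H z ≤ 1 :=
  ge_of_tendsto hH.top (by filter_upwards [eventually_ge_atTop z] with x hx using hH.mono hx)

lemma exists_eq (hH : IsContinuousCDF H) {u : ℝ} (hu : u ∈ Ioo (0 : ℝ) 1) : ∃ z, H z = u := by
  have h1 : ∃ a, H a ≤ u := (hH.bot.eventually (eventually_le_nhds hu.1)).exists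
  have h2 : ∃ b, u ≤ H b := (hH.top.eventually (eventually_ge_nhds hu.2)).exists
  exact mem_range_of_exists_le_of_exists_ge hH.cont h1 h2

lemma bddBelow (hH : IsContinuousCDF H) {u : ℝ} (hu : 0 < u) : BddBelow {z | u ≤ H z} := by
  obtain ⟨a, ha⟩ := (hH.bot.eventually (eventually_lt_nhds hu)).exists
  refine ⟨a, fun z hz => ?_⟩
  by_contra! h
  exact absurd (hH.mono h.le) (not_le.2 (ha.trans_le hz))

lemma quantile_le (hH : IsContinuousCDF H) {u z : ℝ} (hu : 0 < u) (hz : u ≤ H z) :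
    quantile H u ≤ z :=
  csInf_le (hH.bddBelow hu) hz

/-- This form covers u = 1, a value that a continuous distribution function may or may not attain;
it is needed at points with F_D(d) = 1. -/
lemma apply_quantile_of_exists (hH : IsContinuousCDF H) {u : ℝ} (hu : 0 < u) (h : ∃ z, H z = u) :
    H (quantile H u) = u := by
  obtain ⟨z, hz⟩ := h
  have hcl : IsClosed {z | u ≤ H z} := isClosed_le continuous_const hH.cont
  refine le_antisymm ?_ (hcl.csInf_mem ⟨z, hz.ge⟩ (hH.bddBelow hu))
  exact (hH.mono (hH.quantile_le hu hz.ge)).trans hz.le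

lemma apply_quantile (hH : IsContinuousCDF H) {u : ℝ} (hu : u ∈ Ioo (0 : ℝ) 1) :
    H (quantile H u) = u :=
  hH.apply_quantile_of_exists hu.1 (hH.exists_eq hu)

lemma quantile_le_iff (hH : IsContinuousCDF H) {u z : ℝ} (hu : u ∈ Ioo (0 : ℝ) 1) :
    quantile H u ≤ z ↔ u ≤ H z :=
  ⟨fun h => (hH.apply_quantile hu).ge.trans (hH.mono h), hH.quantile_le hu.1⟩

end IsContinuousCDF

open Classical in
/-- The quantile function on `(0, 1)`, extended by `0`. -/
noncomputable def quantileIoo (H : ℝ → ℝ) (u : ℝ) : ℝ :=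
  if u ∈ Ioo (0 : ℝ) 1 then quantile H u else 0

lemma quantileIoo_of_mem {H : ℝ → ℝ} {u : ℝ} (hu : u ∈ Ioo (0 : ℝ) 1) :
    quantileIoo H u = quantile H u := if_pos hu

lemma IsContinuousCDF.measurable_quantileIoo {H : ℝ → ℝ} (hH : IsContinuousCDF H) :
    Measurable (quantileIoo H) := by
  refine measurable_of_Iic fun z => ?_
  have : quantileIoo H ⁻¹' Iic z =
      (Ioo 0 1 ∩ Iic (H z)) ∪ ((Ioo 0 1)ᶜ ∩ {_u | (0 : ℝ) ≤ z}) := by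
    ext u
    by_cases hu : u ∈ Ioo (0 : ℝ) 1
    · simp [quantileIoo_of_mem hu, hH.quantile_le_iff hu, hu, -mem_Ioo]
    · simp [quantileIoo, hu, -mem_Ioo]
  rw [this]
  exact (measurableSet_Ioo.inter measurableSet_Iic).union
    (measurableSet_Ioo.compl.inter (MeasurableSet.const _))

instance isProbabilityMeasure_restrict_Ioo :
    IsProbabilityMeasure ((volume : Measure ℝ).restrict (Ioo 0 1)) :=
  ⟨by simp⟩

lemma volume_restrict_Ioo_Iic {u : ℝ} (hu : u ∈ Icc (0 : ℝ) 1) :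
    ((volume : Measure ℝ).restrict (Ioo 0 1)).real (Iic u) = u := by
  rw [Measure.restrict_congr_set Ioo_ae_eq_Ioc, measureReal_restrict_apply measurableSet_Iic]
  have : Iic u ∩ Ioc 0 1 = Ioc 0 u := by
    ext x; simp only [mem_inter_iff, mem_Iic, mem_Ioc]
    constructor
    · rintro ⟨h1, h2, -⟩; exact ⟨h2, h1⟩
    · rintro ⟨h1, h2⟩; exact ⟨h2, h1, h2.trans hu.2⟩
  rw [this]; simp [hu.1]

lemma IsContinuousCDF.map_quantileIoo_Iic {H : ℝ → ℝ} (hH : IsContinuousCDF H) (z : ℝ) :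
    ((volume.restrict (Ioo 0 1)).map (quantileIoo H)).real (Iic z) = H z := by
  rw [map_measureReal_apply hH.measurable_quantileIoo measurableSet_Iic,
    ← volume_restrict_Ioo_Iic ⟨hH.nonneg z, hH.le_one z⟩]
  refine measureReal_congr ?_
  filter_upwards [ae_restrict_mem measurableSet_Ioo] with u hu
  refine propext ?_
  change quantileIoo H u ≤ z ↔ u ≤ H z
  rw [quantileIoo_of_mem hu, hH.quantile_le_iff hu]

lemma measure_eq_of_real_Iic {μ ν : Measure ℝ} [IsProbabilityMeasure μ] [IsProbabilityMeasure ν]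
    (h : ∀ z, μ.real (Iic z) = ν.real (Iic z)) : μ = ν :=
  Measure.ext_of_Iic _ _ fun z => by
    rw [← ENNReal.toReal_eq_toReal_iff' (measure_ne_top _ _) (measure_ne_top _ _)]
    exact h z

lemma IsContinuousCDF.map_quantileIoo {H : ℝ → ℝ} (hH : IsContinuousCDF H) {lam : Measure ℝ}
    [IsProbabilityMeasure lam] (h : ∀ z, lam.real (Iic z) = H z) :
    (volume.restrict (Ioo 0 1)).map (quantileIoo H) = lam := by
  have : IsProbabilityMeasure (((volume : Measure ℝ).restrict (Ioo 0 1)).map (quantileIoo H)) :=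
    Measure.isProbabilityMeasure_map hH.measurable_quantileIoo.aemeasurable
  exact measure_eq_of_real_Iic fun z => by rw [hH.map_quantileIoo_Iic, h]

/-- The probability integral transform. -/
lemma IsContinuousCDF.map_self {F : ℝ → ℝ} (hF : IsContinuousCDF F) {lam : Measure ℝ}
    [IsProbabilityMeasure lam] (h : ∀ z, lam.real (Iic z) = F z) :
    lam.map F = volume.restrict (Ioo 0 1) := by
  conv_lhs => rw [← hF.map_quantileIoo h]
  rw [Measure.map_map hF.cont.measurable hF.measurable_quantileIoo]
  conv_rhs => rw [← Measure.map_id (μ := (volume : Measure ℝ).restrict (Ioo 0 1))]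
  refine Measure.map_congr ?_
  filter_upwards [ae_restrict_mem measurableSet_Ioo] with u hu
  simp [quantileIoo_of_mem hu, hF.apply_quantile hu]

/-- The mass of {z} is the jump of the distribution function at z, so absence of atoms is
continuity. -/
lemma isContinuousCDF_of_measure {lam : Measure ℝ} [IsProbabilityMeasure lam] [NullSingletonClass lam]
    {F : ℝ → ℝ} (h : ∀ z, F z = lam.real (Iic z)) : IsContinuousCDF F := by
  have hF : F = cdf lam := by ext z; rw [h, cdf_eq_real]
  refine ⟨hF ▸ monotone_cdf lam, ?_, hF ▸ tendsto_cdf_atBot lam, hF ▸ tendsto_cdf_atTop lam⟩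
  rw [continuous_iff_continuousAt]
  intro z
  rw [hF, (monotone_cdf lam).continuousAt_iff_leftLim_eq_rightLim]
  have h1 := (cdf lam).measure_singleton z
  rw [measure_cdf, measure_singleton, StieltjesFunction.rightLim_eq] at *
  have h2 : cdf lam z - Function.leftLim (cdf lam) z ≤ 0 := by
    simpa using h1.symm
  exact le_antisymm ((monotone_cdf lam).leftLim_le le_rfl) (by linarith)

/-! ### Convergence in `L¹` -/

/-- Almost everywhere convergence together with convergence of the norms implies convergence in
`L¹` (Riesz, Scheffé). -/
lemma tendsto_integral_norm_sub_of_le {α : Type*} [MeasurableSpace α] {μ : Measure α} {ι : Type*}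
    {l : Filter ι} [l.IsCountablyGenerated] {f : ι → α → ℝ} {g : α → ℝ}
    (hf : ∀ᶠ i in l, Integrable (f i) μ) (hg : Integrable g μ)
    (hle : ∀ᶠ i in l, ∫ a, |f i a| ∂μ ≤ ∫ a, |g a| ∂μ)
    (hlim : ∀ᵐ a ∂μ, Tendsto (fun i => f i a) l (𝓝 (g a))) :
    Tendsto (fun i => ∫ a, |f i a - g a| ∂μ) l (𝓝 0) := by
  -- The function |f| + |g| - |f - g| lies between 0 and 2|g|, so dominated convergence applies to
  -- it although the f i have no common dominating function. The bound on the norms then converts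
  -- its limit into one for ∫ |f - g|.
  have key : Tendsto (fun i => ∫ a, (|f i a| + |g a| - |f i a - g a|) ∂μ) l
      (𝓝 (∫ a, (2 * |g a|) ∂μ)) := by
    refine tendsto_integral_filter_of_dominated_convergence (fun a => 2 * |g a|) ?_ ?_
      (hg.abs.const_mul 2) ?_
    · filter_upwards [hf] with i hi
      exact ((hi.abs.add hg.abs).sub (hi.sub hg).abs).aestronglyMeasurable
    · refine Eventually.of_forall fun i => Eventually.of_forall fun a => ?_
      have h1 := abs_sub_abs_le_abs_sub (f i a) (g a)
      have h2 := abs_sub (f i a) (g a)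
      rw [Real.norm_eq_abs, abs_le]
      constructor <;> nlinarith [abs_nonneg (g a)]
    · filter_upwards [hlim] with a ha
      have := (ha.abs.add_const |g a|).sub (ha.sub_const (g a)).abs
      simpa [two_mul] using this
  have hub : Tendsto (fun i => ∫ a, (2 * |g a|) ∂μ - ∫ a, (|f i a| + |g a| - |f i a - g a|) ∂μ) l
      (𝓝 0) := by
    simpa using key.const_sub (∫ a, (2 * |g a|) ∂μ)
  refine tendsto_of_tendsto_of_tendsto_of_le_of_le' tendsto_const_nhds hub
    (Eventually.of_forall fun i => integral_nonneg fun a => abs_nonneg _) ?_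
  filter_upwards [hf, hle] with i hi hi'
  have h1 : ∫ a, (|f i a| + |g a| - |f i a - g a|) ∂μ =
      ∫ a, |f i a| ∂μ + ∫ a, |g a| ∂μ - ∫ a, |f i a - g a| ∂μ := by
    rw [← integral_add hi.abs hg.abs]
    exact integral_sub (hi.abs.add hg.abs) (hi.sub hg).abs
  rw [h1, integral_const_mul]
  linarith

end MPE

namespace MPE

/-! ### Continuous functions with limits at `±∞` inside `ℓ^∞(ℝ)` -/

lemma LInf.abs_apply_le (h : LInf) (y : ℝ) : |h y| ≤ ‖h‖ :=
  lp.norm_apply_le_norm ENNReal.top_ne_zero h y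

lemma LInf.abs_sub_apply_le (g h : LInf) (y : ℝ) : |g y - h y| ≤ ‖g - h‖ :=
  LInf.abs_apply_le (g - h) y

lemma LInf.norm_sub_le (g h : LInf) {C : ℝ} (hC : ∀ y, |g y - h y| ≤ C) : ‖g - h‖ ≤ C :=
  lp.norm_le_of_forall_le' (f := g - h) C hC

/-- The subspace `C([-∞, ∞])` of `ℓ^∞(ℝ)`. -/
noncomputable def contLimits : Submodule ℝ LInf where
  carrier := {h | Continuous (h : ℝ → ℝ) ∧ (∃ l, Tendsto (h : ℝ → ℝ) atBot (𝓝 l)) ∧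
    ∃ l, Tendsto (h : ℝ → ℝ) atTop (𝓝 l)}
  add_mem' := by
    rintro f g ⟨hf, ⟨a, ha⟩, ⟨b, hb⟩⟩ ⟨hg, ⟨c, hc⟩, ⟨d, hd⟩⟩
    exact ⟨hf.add hg, ⟨a + c, ha.add hc⟩, ⟨b + d, hb.add hd⟩⟩
  zero_mem' := ⟨continuous_const, ⟨0, tendsto_const_nhds⟩, ⟨0, tendsto_const_nhds⟩⟩
  smul_mem' := by
    rintro r f ⟨hf, ⟨a, ha⟩, ⟨b, hb⟩⟩
    exact ⟨hf.const_smul r, ⟨r • a, ha.const_smul r⟩, ⟨r • b, hb.const_smul r⟩⟩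

lemma exists_tendsto_of_forall_norm_sub_lt {h : LInf} {l : Filter ℝ} [l.NeBot]
    (H : ∀ δ > 0, ∃ g : LInf, ‖g - h‖ < δ ∧ ∃ a, Tendsto (g : ℝ → ℝ) l (𝓝 a)) :
    ∃ a, Tendsto (h : ℝ → ℝ) l (𝓝 a) := by
  refine cauchy_map_iff_exists_tendsto.1 (Metric.cauchy_iff.2 ⟨inferInstance, fun δ hδ => ?_⟩)
  obtain ⟨g, hg, a, ha⟩ := H (δ / 4) (by positivity)
  refine ⟨h '' {y | |g y - a| < δ / 4}, image_mem_map ?_, ?_⟩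
  · have := Metric.tendsto_nhds.1 ha (δ / 4) (by positivity)
    simp only [Real.dist_eq] at this
    exact this
  · rintro _ ⟨y, hy, rfl⟩ _ ⟨z, hz, rfl⟩
    have h1 := LInf.abs_sub_apply_le g h y
    have h2 := LInf.abs_sub_apply_le g h z
    simp only [mem_ofPred_eq] at hy hz
    rw [Real.dist_eq]
    rw [abs_lt] at *
    rw [abs_le] at h1 h2
    constructor <;> linarith [h1.1, h1.2, h2.1, h2.2, hy.1, hy.2, hz.1, hz.2]

/-- Closedness serves twice: uniform limits of difference quotients stay in the domain of the
derivative of the functional, and the subspace is complete, so Bochner integrals can be formed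
inside it. -/
lemma isClosed_contLimits : IsClosed (contLimits : Set LInf) := by
  refine isClosed_of_closure_subset fun h hh => ?_
  have H : ∀ δ > 0, ∃ g ∈ contLimits, ‖g - h‖ < δ := fun δ hδ => by
    obtain ⟨g, hg, hd⟩ := Metric.mem_closure_iff.1 hh δ hδ
    exact ⟨g, hg, by rwa [dist_comm, dist_eq_norm] at hd⟩
  refine ⟨?_, exists_tendsto_of_forall_norm_sub_lt fun δ hδ => ?_,
    exists_tendsto_of_forall_norm_sub_lt fun δ hδ => ?_⟩
  · choose g hg hd using fun n : ℕ => H (1 / (n + 1)) (by positivity)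
    refine TendstoUniformly.continuous (F := fun n => (g n : ℝ → ℝ)) (p := atTop) ?_
      (Frequently.of_forall fun n => (hg n).1)
    refine Metric.tendstoUniformly_iff.2 fun δ hδ => ?_
    have := tendsto_one_div_add_atTop_nhds_zero_nat (𝕜 := ℝ)
    filter_upwards [this.eventually (gt_mem_nhds hδ)] with n hn y
    rw [dist_comm, Real.dist_eq]
    exact (LInf.abs_sub_apply_le _ _ y).trans_lt ((hd n).trans hn)
  · obtain ⟨g, hg, hd⟩ := H δ hδ
    exact ⟨g, hd, hg.2.1⟩
  · obtain ⟨g, hg, hd⟩ := H δ hδ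
    exact ⟨g, hd, hg.2.2⟩

instance : CompleteSpace contLimits := isClosed_contLimits.completeSpace_coe

lemma ContainsContinuous.contLimits_le {D₀ : Submodule ℝ LInf} (h : ContainsContinuous D₀) :
    contLimits ≤ D₀ := fun f hf => h f hf.1 hf.2.1 hf.2.2

lemma IsContinuousCDF.mem_contLimits {F : LInf} (hF : IsContinuousCDF F) : F ∈ contLimits :=
  ⟨hF.cont, ⟨0, hF.bot⟩, ⟨1, hF.top⟩⟩

/-- The index of the cell of the grid of mesh `1 / (n + 1)` on `[-(n + 1), n + 1]`. -/
noncomputable def gridIndex (n : ℕ) (y : ℝ) : ℤ :=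
  max (-((n : ℤ) + 1) ^ 2) (min (((n : ℤ) + 1) ^ 2) ⌊((n : ℝ) + 1) * y⌋)

open Classical in
/-- The indicator of a cell of the grid. -/
noncomputable def gridCell (n : ℕ) (j : ℤ) : LInf :=
  ⟨fun y => if gridIndex n y = j then 1 else 0, memℓp_infty ⟨1, by
    rintro _ ⟨y, rfl⟩
    dsimp only
    split_ifs <;> simp⟩⟩

/-- The approximation of a bounded function by its values on the grid. -/
noncomputable def gridApprox (n : ℕ) (F : ℝ → ℝ) : LInf :=
  ∑ j ∈ Finset.Icc (-((n : ℤ) + 1) ^ 2) (((n : ℤ) + 1) ^ 2), F ((j : ℤ) / ((n : ℝ) + 1)) • gridCell n j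

lemma gridApprox_apply (n : ℕ) (F : ℝ → ℝ) (y : ℝ) :
    gridApprox n F y = F (gridIndex n y / ((n : ℝ) + 1)) := by
  classical
  have hmem : gridIndex n y ∈ Finset.Icc (-((n : ℤ) + 1) ^ 2) (((n : ℤ) + 1) ^ 2) := by
    rw [Finset.mem_Icc]
    have : 0 ≤ ((n : ℤ) + 1) ^ 2 := by positivity
    exact ⟨le_max_left _ _, max_le (by linarith) (min_le_left _ _)⟩
  rw [gridApprox, lp.coeFn_sum, Finset.sum_apply, Finset.sum_eq_single (gridIndex n y)]
  · simp [gridCell]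
  · intro j _ hj
    simp [gridCell, hj.symm]
  · exact fun h => absurd hmem h

lemma gridIndex_div_mem (n : ℕ) {y A : ℝ} (hA : A ≤ n + 1) (hy : |y| ≤ A) :
    (gridIndex n y / ((n : ℝ) + 1) : ℝ) ≤ y ∧ y - 1 / ((n : ℝ) + 1) ≤ gridIndex n y / ((n : ℝ) + 1) := by
  have hn : (0 : ℝ) < (n : ℝ) + 1 := by positivity
  rw [abs_le] at hy
  have h1 : ⌊((n : ℝ) + 1) * y⌋ ≤ ((n : ℤ) + 1) ^ 2 := by
    have h := Int.floor_le (((n : ℝ) + 1) * y)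
    have : (⌊((n : ℝ) + 1) * y⌋ : ℝ) ≤ ((n : ℝ) + 1) ^ 2 := by nlinarith
    exact_mod_cast this
  have h2 : -((n : ℤ) + 1) ^ 2 ≤ ⌊((n : ℝ) + 1) * y⌋ := by
    rw [Int.le_floor]
    push_cast
    nlinarith
  rw [gridIndex, min_eq_right h1, max_eq_right h2]
  constructor
  · rw [div_le_iff₀ hn, mul_comm]; exact Int.floor_le _
  · rw [le_div_iff₀ hn, sub_mul, div_mul_cancel₀ _ hn.ne']
    linarith [Int.lt_floor_add_one (((n : ℝ) + 1) * y)]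

lemma gridIndex_mono (n : ℕ) : Monotone (gridIndex n) := by
  intro y z h
  unfold gridIndex
  gcongr

/-- As ℓ^∞(ℝ) is not separable, strong measurability of a family of distribution functions needs
explicit approximations that depend on finitely many values. The error is controlled by uniform
continuity on a compact window, and outside it by F being within δ/2 of 0 or 1. -/
lemma IsContinuousCDF.tendsto_gridApprox {F : LInf} (hF : IsContinuousCDF F) :
    Tendsto (fun n => gridApprox n F) atTop (𝓝 F) := by
  rw [Metric.tendsto_atTop]
  intro δ hδ
  have hδ2 : 0 < δ / 2 := by positivity
  obtain ⟨a, ha⟩ := (hF.bot.eventually (gt_mem_nhds hδ2)).exists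
  obtain ⟨b, hb⟩ := (hF.top.eventually (lt_mem_nhds (show 1 - δ / 2 < 1 by linarith))).exists
  set A := max |a| |b| + 1 with hA
  have haA : -A + 1 ≤ a := by
    have := neg_abs_le a; have := le_max_left |a| |b|; linarith
  have hbA : b ≤ A - 1 := by
    have := le_abs_self b; have := le_max_right |a| |b|; linarith
  have hA0 : 0 < A := by positivity
  -- The window reaches one unit further to the left because the grid point may lie one mesh below
  -- y.
  have huc := (isCompact_Icc (a := -A - 1) (b := A)).uniformContinuousOn_of_continuous
    hF.cont.continuousOn
  obtain ⟨η, hη, hη'⟩ := Metric.uniformContinuousOn_iff.1 huc (δ / 2) hδ2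
  obtain ⟨N, hN⟩ := exists_nat_gt (max A (1 / η))
  refine ⟨N, fun n hn => ?_⟩
  have hnN : (N : ℝ) ≤ n := by exact_mod_cast hn
  have hnA : A ≤ n + 1 := by linarith [le_max_left A (1 / η)]
  have hn0 : (0 : ℝ) < (n : ℝ) + 1 := by positivity
  have hinv : 1 / ((n : ℝ) + 1) < η := by
    rw [div_lt_comm₀ hn0 hη]; linarith [le_max_right A (1 / η)]
  have hinv1 : 1 / ((n : ℝ) + 1) ≤ 1 := by
    rw [div_le_one hn0]; linarith [(Nat.cast_nonneg n : (0 : ℝ) ≤ n)]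
  rw [dist_eq_norm]
  refine (LInf.norm_sub_le _ _ (C := δ / 2) fun y => ?_).trans_lt (by linarith)
  rw [gridApprox_apply]
  set g := (gridIndex n y / ((n : ℝ) + 1) : ℝ) with hg
  rcases le_or_gt |y| A with hy | hy
  · obtain ⟨h1, h2⟩ := gridIndex_div_mem n hnA hy
    rw [abs_le] at hy
    have := hη' g ⟨by linarith, by linarith⟩ y ⟨by linarith, by linarith⟩
      (by rw [Real.dist_eq, abs_lt]; constructor <;> linarith)
    exact this.le
  · have hmono : ∀ {u v : ℝ}, u ≤ v →
        (gridIndex n u / ((n : ℝ) + 1) : ℝ) ≤ gridIndex n v / ((n : ℝ) + 1) := fun h => by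
      gcongr
      exact_mod_cast gridIndex_mono n h
    rcases lt_abs.1 hy with hy | hy
    · have h1 := (gridIndex_div_mem n hnA (abs_of_pos hA0).le).2
      have h2 := hF.mono (show b ≤ g by linarith [hmono hy.le])
      have h3 := hF.mono (show b ≤ y by linarith)
      have h4 := hF.le_one g
      have h5 := hF.le_one y
      rw [abs_le]; constructor <;> linarith
    · have h1 := (gridIndex_div_mem n hnA (y := -A) (by rw [abs_neg, abs_of_pos hA0])).1
      have h2 := hF.mono (show g ≤ a by linarith [hmono (show y ≤ -A by linarith)])
      have h3 := hF.mono (show y ≤ a by linarith)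
      have h4 := hF.nonneg g
      have h5 := hF.nonneg y
      rw [abs_le]; constructor <;> linarith

/-- A family of continuous distribution functions that is measurable pointwise is strongly
measurable as a map into `ℓ^∞(ℝ)`. -/
lemma stronglyMeasurable_of_isContinuousCDF {α : Type*} [MeasurableSpace α] {Φ : α → LInf}
    (hΦ : ∀ a, IsContinuousCDF (Φ a)) (hm : ∀ y, Measurable fun a => Φ a y) :
    StronglyMeasurable Φ := by
  refine stronglyMeasurable_of_tendsto atTop (f := fun n a => gridApprox n (Φ a)) (fun n => ?_)
    (tendsto_pi_nhds.2 fun a => (hΦ a).tendsto_gridApprox)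
  unfold gridApprox
  refine Finset.stronglyMeasurable_fun_sum (f := fun (j : ℤ) a => Φ a (j / ((n : ℝ) + 1)) • gridCell n j)
    _ fun j _ => ?_
  exact (hm _).stronglyMeasurable.smul_const _

end MPE

namespace MPE

/-! ### The weights of a rank-preserving perturbation -/

open Classical in
/-- `between a b v = 1{v ≤ b} - 1{v ≤ a}`. -/
noncomputable def between (a b v : ℝ) : ℝ := (if v ≤ b then 1 else 0) - (if v ≤ a then 1 else 0)

lemma measurable_between {α : Type*} [MeasurableSpace α] {a b v : α → ℝ} (ha : Measurable a)
    (hb : Measurable b) (hv : Measurable v) :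
    Measurable fun x => between (a x) (b x) (v x) :=
  (Measurable.ite (measurableSet_le hv hb) measurable_const measurable_const).sub
    (Measurable.ite (measurableSet_le hv ha) measurable_const measurable_const)

lemma enorm_between (a b v : ℝ) : ‖between a b v‖ₑ = (uIoc a b).indicator 1 v := by
  unfold between
  by_cases h1 : v ≤ a <;> by_cases h2 : v ≤ b <;> simp [indicator, mem_uIoc, h1, h2, not_lt.2]

lemma lintegral_enorm_between (a b : ℝ) : ∫⁻ v, ‖between a b v‖ₑ = ‖b - a‖ₑ := by
  simp_rw [enorm_between]
  rw [lintegral_indicator_one measurableSet_uIoc, Real.volume_uIoc, Real.enorm_eq_ofReal_abs]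

lemma integral_between_mul {f : ℝ → ℝ} (hf : Integrable f) (a b : ℝ) :
    ∫ v, between a b v * f v = ∫ v in a..b, f v := by
  rw [← intervalIntegral.integral_Iic_sub_Iic hf.integrableOn hf.integrableOn,
    ← integral_indicator measurableSet_Iic, ← integral_indicator measurableSet_Iic,
    ← integral_sub (hf.indicator measurableSet_Iic) (hf.indicator measurableSet_Iic)]
  refine integral_congr_ae (Eventually.of_forall fun v => ?_)
  simp only [between, indicator, mem_Iic]
  split_ifs <;> simp

section Weights

variable {𝒳 : Type*} [MeasurableSpace 𝒳] {ξ : Measure 𝒳} [IsProbabilityMeasure ξ]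

/-- `weight k a b x = ∫_a^b k(x, v) dv`, where `k(x, ·)` is a density on `(0, 1)`. -/
noncomputable def weight (k : 𝒳 × ℝ → ℝ) (a b : ℝ) (x : 𝒳) : ℝ :=
  ∫ v in Ioo 0 1, between a b v * k (x, v)

omit [MeasurableSpace 𝒳] in
lemma weight_self (k : 𝒳 × ℝ → ℝ) (a : ℝ) (x : 𝒳) : weight k a a x = 0 := by
  simp [weight, between]

/-- `k(x, v)` is the density of a coupling of `ξ` and the uniform distribution on `(0, 1)`. -/
structure IsCouplingDensity (ξ : Measure 𝒳) (k : 𝒳 × ℝ → ℝ) : Prop where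
  measurable : Measurable k
  nonneg : ∀ p, 0 ≤ k p
  margin : ∀ᵐ v ∂(volume : Measure ℝ).restrict (Ioo 0 1), ∫⁻ x, ‖k (x, v)‖ₑ ∂ξ = 1

/-- A family of perturbations `H t` of `H 0` with derivative `-ℓ` at `t = 0`. -/
structure IsPerturbation (H : ℝ → ℝ → ℝ) (ℓ : ℝ → ℝ) (I : Set ℝ) : Prop where
  measurable : ∀ t ∈ Icc (0 : ℝ) 1, Measurable (H t)
  integrable : Integrable ℓ
  measurable_deriv : Measurable ℓ
  -- An exact identity rather than an estimate up to o(t): it bounds the L¹ norms of the difference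
  -- quotients by the norm of their limit.
  lintegral_eq : ∀ t ∈ Ioc (0 : ℝ) 1,
    ∫⁻ s, ‖H 0 s - H t s‖ₑ = ENNReal.ofReal t * ∫⁻ s, ‖ℓ s‖ₑ
  off : ∀ s ∉ I, ℓ s = 0 ∧ ∀ t ∈ Icc (0 : ℝ) 1, H t s = H 0 s
  -- Exceptional null sets of ranks v pull back to null sets of points s, which allows
  -- almost-everywhere facts about k(x, ·) to be used at v = H_0(s).
  null : ∀ N : Set ℝ, volume N = 0 → ∀ᵐ s : ℝ, s ∈ I → H 0 s ∈ Ioo (0 : ℝ) 1 ∧ H 0 s ∉ N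
  deriv : ∀ᵐ s : ℝ, HasDerivWithinAt (fun t => H t s) (-ℓ s) (Ioi 0) 0

variable {k : 𝒳 × ℝ → ℝ} {H : ℝ → ℝ → ℝ} {ℓ : ℝ → ℝ} {I : Set ℝ}

lemma IsPerturbation.lintegral_lt_top (hH : IsPerturbation H ℓ I) {t : ℝ}
    (ht : t ∈ Ioc (0 : ℝ) 1) : ∫⁻ s, ‖H 0 s - H t s‖ₑ < ⊤ := by
  rw [hH.lintegral_eq t ht]
  exact ENNReal.mul_lt_top ENNReal.ofReal_lt_top hH.integrable.2

omit [IsProbabilityMeasure ξ] in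
lemma stronglyMeasurable_weight (hk : IsCouplingDensity ξ k) {a b : ℝ → ℝ} (ha : Measurable a)
    (hb : Measurable b) : StronglyMeasurable fun p : 𝒳 × ℝ => weight k (a p.2) (b p.2) p.1 := by
  unfold weight
  refine StronglyMeasurable.integral_prod_right
    (f := fun (p : 𝒳 × ℝ) (v : ℝ) => between (a p.2) (b p.2) v * k (p.1, v)) ?_
  refine Measurable.stronglyMeasurable ?_
  refine Measurable.mul ?_ (hk.measurable.comp (by fun_prop))
  exact measurable_between (ha.comp (by fun_prop)) (hb.comp (by fun_prop)) (by fun_prop)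

/-- Tonelli's theorem for the kernel that defines the weights. -/
lemma lintegral_between_mul_le (hk : IsCouplingDensity ξ k) (a b : ℝ → ℝ) :
    ∫⁻ s, (∫⁻ x, (∫⁻ v in Ioo 0 1, ‖between (a s) (b s) v * k (x, v)‖ₑ) ∂ξ) ≤
      ∫⁻ s, ‖b s - a s‖ₑ := by
  refine lintegral_mono fun s => ?_
  -- After the swap, k(·, v) integrates to 1 over x, so only the length of the interval between a(s)
  -- and b(s) is left; the inequality comes from letting v leave (0, 1).
  rw [lintegral_lintegral_swap]
  · calc ∫⁻ v in Ioo 0 1, (∫⁻ x, ‖between (a s) (b s) v * k (x, v)‖ₑ ∂ξ)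
        = ∫⁻ v in Ioo 0 1, ‖between (a s) (b s) v‖ₑ := by
          refine lintegral_congr_ae ?_
          filter_upwards [hk.margin] with v hv
          simp_rw [enorm_mul]
          rw [lintegral_const_mul _ (Measurable.enorm (f := fun x => k (x, v))
            (hk.measurable.comp (by fun_prop))), hv, mul_one]
      _ ≤ ∫⁻ v, ‖between (a s) (b s) v‖ₑ := setLIntegral_le_lintegral _ _
      _ = ‖b s - a s‖ₑ := lintegral_enorm_between _ _
  · refine Measurable.aemeasurable (Measurable.enorm ?_)
    exact (measurable_between measurable_const measurable_const measurable_snd).mul hk.measurable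

lemma lintegral_weight_le (hk : IsCouplingDensity ξ k) {a b : ℝ → ℝ} (ha : Measurable a)
    (hb : Measurable b) :
    ∫⁻ p, ‖weight k (a p.2) (b p.2) p.1‖ₑ ∂(ξ.prod volume) ≤ ∫⁻ s, ‖b s - a s‖ₑ := by
  refine le_trans ?_ (lintegral_between_mul_le hk a b)
  rw [lintegral_prod_symm _ (stronglyMeasurable_weight hk ha hb).measurable.enorm.aemeasurable]
  refine lintegral_mono fun s => lintegral_mono fun x => ?_
  exact enorm_integral_le_lintegral_enorm _

lemma integrable_weight (hk : IsCouplingDensity ξ k) {a b : ℝ → ℝ} (ha : Measurable a)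
    (hb : Measurable b) (hab : ∫⁻ s, ‖b s - a s‖ₑ < ⊤) :
    Integrable (fun p : 𝒳 × ℝ => weight k (a p.2) (b p.2) p.1) (ξ.prod volume) :=
  ⟨(stronglyMeasurable_weight hk ha hb).aestronglyMeasurable,
    (lintegral_weight_le hk ha hb).trans_lt hab⟩

/-- The margin condition holds for almost every v; `IsPerturbation.null` carries it to v = H_0(s)
for almost every s in I, and ℓ vanishes off I. -/
lemma lintegral_limit_weight (hk : IsCouplingDensity ξ k) (hH : IsPerturbation H ℓ I) :
    ∫⁻ p, ‖ℓ p.2 * k (p.1, H 0 p.2)‖ₑ ∂(ξ.prod volume) = ∫⁻ s, ‖ℓ s‖ₑ := by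
  have h0 := hH.measurable 0 (by simp)
  have hm : Measurable fun p : 𝒳 × ℝ => ℓ p.2 * k (p.1, H 0 p.2) :=
    (hH.measurable_deriv.comp measurable_snd).mul (hk.measurable.comp (by fun_prop))
  rw [lintegral_prod_symm _ hm.enorm.aemeasurable]
  refine lintegral_congr_ae ?_
  have hN := hk.margin
  rw [ae_restrict_iff' measurableSet_Ioo, ae_iff] at hN
  filter_upwards [hH.null _ hN] with s hs
  simp_rw [enorm_mul]
  rw [lintegral_const_mul _ (Measurable.enorm (f := fun x => k (x, H 0 s))
    (hk.measurable.comp (by fun_prop)))]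
  by_cases hsI : s ∈ I
  · obtain ⟨h1, h2⟩ := hs hsI
    simp only [not_not] at h2
    rw [h2 h1, mul_one]
  · simp [(hH.off s hsI).1]

lemma integrable_limit_weight (hk : IsCouplingDensity ξ k) (hH : IsPerturbation H ℓ I) :
    Integrable (fun p : 𝒳 × ℝ => ℓ p.2 * k (p.1, H 0 p.2)) (ξ.prod volume) := by
  have h0 := hH.measurable 0 (by simp)
  refine ⟨Measurable.aestronglyMeasurable ((hH.measurable_deriv.comp measurable_snd).mul
    (hk.measurable.comp (by fun_prop))), ?_⟩
  rw [hasFiniteIntegral_iff_enorm, lintegral_limit_weight hk hH]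
  exact hH.integrable.2

lemma ae_integrable_couplingDensity (hk : IsCouplingDensity ξ k) :
    ∀ᵐ x ∂ξ, Integrable (fun v => k (x, v)) (volume.restrict (Ioo 0 1)) := by
  have h : Integrable k (ξ.prod (volume.restrict (Ioo 0 1))) := by
    refine ⟨hk.measurable.aestronglyMeasurable, ?_⟩
    rw [hasFiniteIntegral_iff_enorm, lintegral_prod_symm _ hk.measurable.enorm.aemeasurable,
      lintegral_congr_ae hk.margin]
    simp
  exact h.prod_right_ae

/-- Lebesgue's differentiation theorem for k(x, ·), composed with t ↦ H_t(s): for almost every s in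
I the point H_0(s) avoids the exceptional null set. Off I both the weights and ℓ are zero. -/
lemma ae_tendsto_weight (hk : IsCouplingDensity ξ k) (hH : IsPerturbation H ℓ I) :
    ∀ᵐ x ∂ξ, ∀ᵐ s : ℝ, Tendsto (fun t => t⁻¹ * weight k (H t s) (H 0 s) x) (𝓝[>] 0)
      (𝓝 (ℓ s * k (x, H 0 s))) := by
  filter_upwards [ae_integrable_couplingDensity hk] with x hx
  set f : ℝ → ℝ := (Ioo 0 1).indicator fun v => k (x, v) with hf
  have hfi : Integrable f := (integrable_indicator_iff measurableSet_Ioo).2 hx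
  have hw : ∀ a b, weight k a b x = ∫ v in a..b, f v := fun a b => by
    rw [← integral_between_mul hfi, weight, ← integral_indicator measurableSet_Ioo]
    refine integral_congr_ae (Eventually.of_forall fun v => ?_)
    simp only [hf, indicator]
    split_ifs <;> simp
  have hL := LocallyIntegrable.ae_hasDerivAt_integral hfi.locallyIntegrable
  rw [ae_iff] at hL
  filter_upwards [hH.null _ hL, hH.deriv] with s hs hd
  by_cases hsI : s ∈ I
  · obtain ⟨h1, h2⟩ := hs hsI
    simp only [not_not] at h2
    have h3 : HasDerivWithinAt (fun t => ∫ v in 0..H t s, f v) (f (H 0 s) * -ℓ s) (Ioi 0) 0 :=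
      HasDerivAt.comp_hasDerivWithinAt (h₂ := fun u => ∫ v in 0..u, f v) (h := fun t => H t s)
        (0 : ℝ) (h2 0) hd
    rw [hasDerivWithinAt_iff_tendsto_slope' self_notMem_Ioi] at h3
    have h4 := h3.neg
    have h5 : f (H 0 s) = k (x, H 0 s) := by rw [hf, indicator_of_mem h1]
    rw [h5, mul_neg, neg_neg, mul_comm] at h4
    refine h4.congr fun t => ?_
    rw [slope_def_field, hw, ← intervalIntegral.integral_interval_sub_left
      (hfi.intervalIntegrable (a := 0) (b := H 0 s)) (hfi.intervalIntegrable (a := 0) (b := H t s))]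
    ring
  · rw [(hH.off s hsI).1, zero_mul]
    refine tendsto_const_nhds.congr' ?_
    filter_upwards [Ioc_mem_nhdsGT zero_lt_one] with t ht
    rw [(hH.off s hsI).2 t (Ioc_subset_Icc_self ht), weight_self, mul_zero]

/-- The difference quotients of the weights converge in `L¹`. -/
theorem tendsto_integral_weight_sub (hk : IsCouplingDensity ξ k) (hH : IsPerturbation H ℓ I) :
    Tendsto (fun t => ∫ p : 𝒳 × ℝ, |t⁻¹ * weight k (H t p.2) (H 0 p.2) p.1 -
      ℓ p.2 * k (p.1, H 0 p.2)| ∂(ξ.prod volume)) (𝓝[>] 0) (𝓝 0) := by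
  have h0 := hH.measurable 0 (by simp)
  have hm : ∀ t ∈ Icc (0 : ℝ) 1,
      Measurable fun p : 𝒳 × ℝ => t⁻¹ * weight k (H t p.2) (H 0 p.2) p.1 := fun t ht =>
    ((stronglyMeasurable_weight hk (hH.measurable t ht) h0).measurable).const_mul _
  have hg : Measurable fun p : 𝒳 × ℝ => ℓ p.2 * k (p.1, H 0 p.2) :=
    (hH.measurable_deriv.comp measurable_snd).mul (hk.measurable.comp (by fun_prop))
  -- Along a sequence the set of convergence is measurable, so almost-everywhere convergence on the
  -- product can be checked fibre by fibre.
  refine tendsto_of_seq_tendsto fun u hu => ?_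
  have hu' : ∀ᶠ n in atTop, u n ∈ Ioc (0 : ℝ) 1 := hu.eventually (Ioc_mem_nhdsGT zero_lt_one)
  obtain ⟨N, hN⟩ := eventually_atTop.1 hu'
  rw [← tendsto_add_atTop_iff_nat N]
  have hv : ∀ n, u (n + N) ∈ Ioc (0 : ℝ) 1 := fun n => hN _ (by omega)
  refine tendsto_integral_norm_sub_of_le (Eventually.of_forall fun n => ?_)
    (integrable_limit_weight hk hH) (Eventually.of_forall fun n => ?_) ?_
  · exact (integrable_weight hk (hH.measurable _ (Ioc_subset_Icc_self (hv n))) h0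
      (hH.lintegral_lt_top (hv n))).const_mul _
  · simp_rw [← Real.norm_eq_abs]
    rw [integral_norm_eq_lintegral_enorm (hm _ (Ioc_subset_Icc_self (hv n))).aestronglyMeasurable,
      integral_norm_eq_lintegral_enorm hg.aestronglyMeasurable, lintegral_limit_weight hk hH]
    refine ENNReal.toReal_mono hH.integrable.2.ne ?_
    simp_rw [enorm_mul]
    rw [lintegral_const_mul _ (stronglyMeasurable_weight hk
      (hH.measurable _ (Ioc_subset_Icc_self (hv n))) h0).measurable.enorm]
    calc _ ≤ ‖(u (n + N))⁻¹‖ₑ * (ENNReal.ofReal (u (n + N)) * ∫⁻ s, ‖ℓ s‖ₑ) := by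
          gcongr
          rw [← hH.lintegral_eq _ (hv n)]
          exact lintegral_weight_le hk (hH.measurable _ (Ioc_subset_Icc_self (hv n))) h0
      _ = _ := by
          rw [← mul_assoc, Real.enorm_eq_ofReal (inv_nonneg.2 (hv n).1.le),
            ← ENNReal.ofReal_mul (inv_nonneg.2 (hv n).1.le), inv_mul_cancel₀ (hv n).1.ne']
          simp
  · rw [Measure.ae_prod_iff_ae_ae]
    · filter_upwards [ae_tendsto_weight hk hH] with x hx
      filter_upwards [hx] with s hs
      exact (hs.comp hu).comp (tendsto_add_atTop_nat N)
    · exact measurableSet_tendsto_fun (fun n => hm _ (Ioc_subset_Icc_self (hv n))) hg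

/-- Integrals along the perturbation, in terms of the weights. -/
theorem integral_between_eq_integral_weight (hk : IsCouplingDensity ξ k) {a b : ℝ → ℝ}
    (ha : Measurable a) (hb : Measurable b) (hab : ∫⁻ s, ‖b s - a s‖ₑ < ⊤)
    {φ : 𝒳 × ℝ → ℝ} (hφ : Measurable φ) {L : ℝ} (hL : ∀ p, |φ p| ≤ L) :
    ∫ p, (∫ s, φ (p.1, s) * between (a s) (b s) p.2)
        ∂((ξ.prod (volume.restrict (Ioo 0 1))).withDensity fun p => ENNReal.ofReal (k p)) =
      ∫ p, φ p * weight k (a p.2) (b p.2) p.1 ∂(ξ.prod volume) := by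
  set ν : Measure ℝ := volume.restrict (Ioo 0 1) with hν
  set Ψ : (𝒳 × ℝ) × ℝ → ℝ := fun q => φ (q.1.1, q.2) * (between (a q.2) (b q.2) q.1.2 * k q.1)
    with hΨ
  have hΨm : Measurable Ψ := by
    refine (hφ.comp (by fun_prop)).mul (Measurable.mul ?_ (hk.measurable.comp (by fun_prop)))
    exact measurable_between (ha.comp (by fun_prop)) (hb.comp (by fun_prop)) (by fun_prop)
  have hΨi : Integrable Ψ ((ξ.prod ν).prod volume) := by
    refine ⟨hΨm.aestronglyMeasurable, ?_⟩
    rw [hasFiniteIntegral_iff_enorm, lintegral_prod_symm _ hΨm.enorm.aemeasurable]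
    have h1 : ∀ s, ∫⁻ q : 𝒳 × ℝ, ‖Ψ (q, s)‖ₑ ∂(ξ.prod ν) ≤
        ENNReal.ofReal L * ∫⁻ x, ∫⁻ v, ‖between (a s) (b s) v * k (x, v)‖ₑ ∂ν ∂ξ := fun s => by
      have hms : Measurable fun q : 𝒳 × ℝ => between (a s) (b s) q.2 * k q :=
        (measurable_between measurable_const measurable_const measurable_snd).mul hk.measurable
      rw [← lintegral_prod _ hms.enorm.aemeasurable, ← lintegral_const_mul _ hms.enorm]
      refine lintegral_mono fun q => ?_
      simp only [hΨ]
      rw [enorm_mul]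
      gcongr
      rw [Real.enorm_eq_ofReal_abs]
      exact ENNReal.ofReal_le_ofReal (hL _)
    refine (lintegral_mono h1).trans_lt ?_
    rw [lintegral_const_mul' _ _ ENNReal.ofReal_ne_top]
    exact ENNReal.mul_lt_top ENNReal.ofReal_lt_top ((lintegral_between_mul_le hk a b).trans_lt hab)
  -- Regrouping the triple product makes the integrand integrable in (v, s) for almost every fixed
  -- x, which permits exchanging v and s.
  have hassoc : ∀ᵐ x ∂ξ, Integrable (fun q : ℝ × ℝ => Ψ ((x, q.1), q.2)) (ν.prod volume) := by
    have h2 : Integrable (fun q : 𝒳 × (ℝ × ℝ) => Ψ ((q.1, q.2.1), q.2.2))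
        (ξ.prod (ν.prod volume)) := by
      have := (measurePreserving_prodAssoc ξ ν (volume : Measure ℝ)).symm
      exact (this.integrable_comp hΨi.1).2 hΨi
    exact h2.prod_right_ae
  calc _ = ∫ p, k p * (∫ s, φ (p.1, s) * between (a s) (b s) p.2) ∂(ξ.prod ν) := by
        rw [integral_withDensity_eq_integral_toReal_smul hk.measurable.ennreal_ofReal
          (Eventually.of_forall fun _ => ENNReal.ofReal_lt_top)]
        simp [ENNReal.toReal_ofReal (hk.nonneg _)]
    _ = ∫ p, (∫ s, Ψ (p, s)) ∂(ξ.prod ν) := by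
        refine integral_congr_ae (Eventually.of_forall fun p => ?_)
        simp only [hΨ]
        rw [← integral_const_mul]
        congr with s
        ring
    _ = ∫ x, (∫ v, (∫ s, Ψ ((x, v), s)) ∂ν) ∂ξ := integral_prod _ hΨi.integral_prod_left
    _ = ∫ x, (∫ s, φ (x, s) * weight k (a s) (b s) x) ∂ξ := by
        refine integral_congr_ae ?_
        filter_upwards [hassoc] with x hx
        rw [integral_integral_swap hx]
        congr with s
        rw [weight, ← integral_const_mul]
    _ = _ := by
        refine (integral_prod (fun p : 𝒳 × ℝ => φ p * weight k (a p.2) (b p.2) p.1) ?_).symm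
        exact (integrable_weight hk ha hb hab).bdd_mul (c := L) hφ.aestronglyMeasurable
          (Eventually.of_forall hL)

end Weights

end MPE

namespace MPE

namespace Model

variable {Ω E : Type*} [MeasurableSpace Ω] [MeasurableSpace E] {k : ℕ} {M : Model Ω E k}
  {fD πdot : ℝ → ℝ} {H : ℝ → ℝ → ℝ} {C : ℝ → (Fin k → ℝ) → ℝ}

/-! ### The distribution of the policy variable -/

instance : IsProbabilityMeasure (M.P.map M.D) :=
  Measure.isProbabilityMeasure_map M.measurable_D.aemeasurable

instance : IsProbabilityMeasure (M.P.map M.X) :=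
  Measure.isProbabilityMeasure_map M.measurable_X.aemeasurable

lemma FD_eq (d : ℝ) : M.FD d = (M.P.map M.D).real (Iic d) := by
  rw [map_measureReal_apply M.measurable_D measurableSet_Iic]; rfl

lemma HasDensityD.law_absolutelyContinuous (h : M.HasDensityD fD) : M.P.map M.D ≪ volume := by
  rw [h.law]; exact withDensity_absolutelyContinuous _ _

lemma HasDensityD.nullSingleton (h : M.HasDensityD fD) : NullSingletonClass (M.P.map M.D) :=
  ⟨fun x => h.law_absolutelyContinuous (by simp)⟩

lemma HasDensityD.isContinuousCDF (h : M.HasDensityD fD) : IsContinuousCDF M.FD :=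
  have := h.nullSingleton
  isContinuousCDF_of_measure (lam := M.P.map M.D) FD_eq

lemma HasDensityD.integrable (h : M.HasDensityD fD) : Integrable fD := by
  refine ⟨h.measurable.aestronglyMeasurable, ?_⟩
  rw [hasFiniteIntegral_iff_ofReal (Eventually.of_forall h.nonneg)]
  have h1 : (M.P.map M.D) univ = 1 := measure_univ
  rw [h.law, withDensity_apply _ MeasurableSet.univ, setLIntegral_univ] at h1
  rw [h1]; exact ENNReal.one_lt_top

lemma ae_mem_suppD : ∀ᵐ d ∂(M.P.map M.D), d ∈ M.suppD := Measure.support_mem_ae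

lemma ae_mem_suppX : ∀ᵐ x ∂(M.P.map M.X), x ∈ M.suppX := Measure.support_mem_ae

lemma isClosed_suppD : IsClosed M.suppD := Measure.isClosed_support

lemma isClosed_suppX : IsClosed M.suppX := Measure.isClosed_support

lemma ae_D_mem_suppD : ∀ᵐ ω ∂M.P, M.D ω ∈ M.suppD :=
  ae_of_ae_map M.measurable_D.aemeasurable ae_mem_suppD

lemma ae_X_mem_suppX : ∀ᵐ ω ∂M.P, M.X ω ∈ M.suppX :=
  ae_of_ae_map M.measurable_X.aemeasurable ae_mem_suppX

lemma HasDensityD.map_FD (h : M.HasDensityD fD) :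
    (M.P.map M.D).map M.FD = volume.restrict (Ioo 0 1) :=
  h.isContinuousCDF.map_self fun z => (FD_eq z).symm

lemma HasDensityD.ae_FD_mem (h : M.HasDensityD fD) :
    ∀ᵐ d ∂(M.P.map M.D), M.FD d ∈ Ioo (0 : ℝ) 1 := by
  refine ae_of_ae_map h.isContinuousCDF.cont.measurable.aemeasurable ?_
  rw [h.map_FD]
  exact ae_restrict_mem measurableSet_Ioo

lemma HasDensityD.ae_FD_D_mem (h : M.HasDensityD fD) :
    ∀ᵐ ω ∂M.P, M.FD (M.D ω) ∈ Ioo (0 : ℝ) 1 :=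
  ae_of_ae_map M.measurable_D.aemeasurable h.ae_FD_mem

/-- The assumptions for an intervention that perturbs `F_D` along continuous distribution
functions. -/
structure Intervention (M : Model Ω E k) (fD : ℝ → ℝ) (H : ℝ → ℝ → ℝ) (πdot : ℝ → ℝ)
    (C : ℝ → (Fin k → ℝ) → ℝ) : Prop extends M.Assumptions fD H πdot C where
  zero : H 0 = M.FD
  cdf : ∀ t ∈ Icc (0 : ℝ) 1, IsContinuousCDF (H t)

/-! ### The support of D: an interval on which Lebesgue measure and the law of D share their null
sets -/

namespace Intervention

lemma quantile_FD (hM : M.Intervention fD H πdot C) {d : ℝ} (hd : d ∈ M.suppD)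
    (h0 : 0 < M.FD d) : quantile M.FD (M.FD d) = d := by
  have := hM.structural.policy_zero d hd h0
  rwa [policy, hM.zero] at this

/-- The identity π_0(d) = d excludes gaps. If c lies in a gap with right end z, then F_D(z) ≤
F_D(c), so the quantile at F_D(z) is at most c, whereas it should be z. -/
lemma ordConnected_suppD (hM : M.Intervention fD H πdot C) : M.suppD.OrdConnected := by
  refine ordConnected_iff.2 fun a ha b hb hab c hc => ?_
  by_contra hcI
  have hne : (M.suppD ∩ Ici c).Nonempty := ⟨b, hb, hc.2⟩
  have hcl : IsClosed (M.suppD ∩ Ici c) := isClosed_suppD.inter isClosed_Ici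
  have hbdd : BddBelow (M.suppD ∩ Ici c) := ⟨c, fun x hx => hx.2⟩
  obtain ⟨hzI, hzc⟩ := hcl.csInf_mem hne hbdd
  set z := sInf (M.suppD ∩ Ici c) with hz
  have hzc' : c < z := lt_of_le_of_ne hzc fun h => hcI (h ▸ hzI)
  have hac : a < c := lt_of_le_of_ne hc.1 fun h => hcI (h ▸ ha)
  have hcdf := hM.density.isContinuousCDF
  have hpos : 0 < M.FD c := by
    rw [FD_eq, measureReal_def]
    exact ENNReal.toReal_pos ((Measure.mem_support_iff_forall a).1 ha _ (Iic_mem_nhds hac)).ne'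
      (measure_ne_top _ _)
  have heq : M.FD z ≤ M.FD c := by
    have := hM.density.nullSingleton
    rw [FD_eq, FD_eq]
    refine ENNReal.toReal_mono (measure_ne_top _ _) (measure_mono_ae ?_)
    have hz0 : ∀ᵐ d ∂(M.P.map M.D), d ≠ z := by simp [ae_iff]
    filter_upwards [ae_mem_suppD, hz0] with d hd hdz hdz'
    by_contra! hcd
    exact hdz (le_antisymm hdz' (csInf_le hbdd ⟨hd, le_of_lt (not_le.1 hcd)⟩))
  have h1 := hM.quantile_FD hzI (hpos.trans_le (hcdf.mono hzc))
  have h2 := hcdf.quantile_le (hpos.trans_le (hcdf.mono hzc)) heq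
  exact absurd (h1 ▸ h2) (not_le.2 hzc')

lemma nonempty_suppD (_hM : M.Intervention fD H πdot C) : M.suppD.Nonempty :=
  Measure.nonempty_support (IsProbabilityMeasure.ne_zero _)

lemma ae_mem_interior (hM : M.Intervention fD H πdot C) :
    ∀ᵐ s : ℝ, s ∈ M.suppD → s ∈ interior M.suppD := by
  have hf := hM.ordConnected_suppD.convex.addHaar_frontier (μ := (volume : Measure ℝ))
  rw [frontier, isClosed_suppD.closure_eq] at hf
  filter_upwards [measure_eq_zero_iff_ae_notMem.1 hf] with s hs h
  by_contra h'
  exact hs ⟨h, h'⟩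

lemma ae_D_mem_interior (hM : M.Intervention fD H πdot C) :
    ∀ᵐ ω ∂M.P, M.D ω ∈ interior M.suppD := by
  refine ae_of_ae_map M.measurable_D.aemeasurable ?_
  filter_upwards [ae_mem_suppD, hM.density.law_absolutelyContinuous.ae_le hM.ae_mem_interior]
    with d hd hd' using hd' hd

/-- Positivity of f_D on the support; this is what turns statements holding P_D-almost everywhere
into Lebesgue-almost everywhere ones. -/
lemma restrict_suppD_absolutelyContinuous (hM : M.Intervention fD H πdot C) :
    (volume : Measure ℝ).restrict M.suppD ≪ M.P.map M.D := by
  have h1 : (volume : Measure ℝ).restrict M.suppD ≪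
      (volume.restrict M.suppD).withDensity fun d => ENNReal.ofReal (fD d) := by
    refine withDensity_absolutelyContinuous' hM.density.measurable.ennreal_ofReal.aemeasurable ?_
    filter_upwards [ae_restrict_mem isClosed_suppD.measurableSet] with d hd
    exact (ENNReal.ofReal_pos.2 (hM.rank.fD_pos d hd)).ne'
  refine h1.trans ?_
  rw [← restrict_withDensity isClosed_suppD.measurableSet, ← hM.density.law]
  exact Measure.absolutelyContinuous_of_le Measure.restrict_le_self

lemma ae_of_ae_law (hM : M.Intervention fD H πdot C) {p : ℝ → Prop}
    (h : ∀ᵐ d ∂(M.P.map M.D), p d) : ∀ᵐ d : ℝ, d ∈ M.suppD → p d := by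
  rw [← ae_restrict_iff' isClosed_suppD.measurableSet]
  exact hM.restrict_suppD_absolutelyContinuous.ae_le h

/-- The rank F_D(D) is uniform, hence almost surely outside N; `ae_of_ae_law` passes to Lebesgue
measure on the support. -/
lemma ae_FD_notMem (hM : M.Intervention fD H πdot C) {N : Set ℝ} (hN : volume N = 0) :
    ∀ᵐ s : ℝ, s ∈ M.suppD → M.FD s ∈ Ioo (0 : ℝ) 1 ∧ M.FD s ∉ N := by
  refine hM.ae_of_ae_law ?_
  have h1 : ∀ᵐ d ∂(M.P.map M.D), M.FD d ∉ N := by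
    refine ae_of_ae_map (p := fun u => u ∉ N)
      hM.density.isContinuousCDF.cont.measurable.aemeasurable ?_
    rw [hM.density.map_FD]
    exact ae_restrict_of_ae (measure_eq_zero_iff_ae_notMem.1 hN)
  filter_upwards [h1, hM.density.ae_FD_mem] with d h1 h2 using ⟨h2, h1⟩

lemma ae_fD_eq_zero (hM : M.Intervention fD H πdot C) : ∀ᵐ d : ℝ, d ∉ M.suppD → fD d = 0 := by
  have h : (M.P.map M.D) M.suppDᶜ = 0 := Measure.measure_compl_support
  rw [hM.density.law, withDensity_apply _ isClosed_suppD.measurableSet.compl,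
    lintegral_eq_zero_iff hM.density.measurable.ennreal_ofReal, EventuallyEq,
    ae_restrict_iff' isClosed_suppD.measurableSet.compl] at h
  filter_upwards [h] with d hd hd'
  exact le_antisymm (ENNReal.ofReal_eq_zero.1 (hd hd')) (hM.density.nonneg d)

/-! ### The policy function -/

lemma policy_eq (M : Model Ω E k) (H : ℝ → ℝ → ℝ) (t : ℝ) {d : ℝ}
    (h : M.FD d ∈ Ioo (0 : ℝ) 1) : M.policy H t d = quantileIoo (H t) (M.FD d) :=
  (quantileIoo_of_mem h).symm

/-- Ranks 0 and 1 have probability zero, so the measurable `quantileIoo` can stand in for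
`quantile`. -/
lemma policy_ae_eq (hM : M.Intervention fD H πdot C) (t : ℝ) :
    (fun ω => M.policy H t (M.D ω)) =ᵐ[M.P] fun ω => quantileIoo (H t) (M.FD (M.D ω)) := by
  filter_upwards [hM.density.ae_FD_D_mem] with ω hω using policy_eq M H t hω

lemma measurable_quantileIoo_FD (hM : M.Intervention fD H πdot C) {t : ℝ} (ht : t ∈ Icc (0 : ℝ) 1) :
    Measurable fun d => quantileIoo (H t) (M.FD d) :=
  (hM.cdf t ht).measurable_quantileIoo.comp hM.density.isContinuousCDF.cont.measurable

lemma aemeasurable_policy (hM : M.Intervention fD H πdot C) {t : ℝ} (ht : t ∈ Icc (0 : ℝ) 1) :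
    AEMeasurable (fun ω => M.policy H t (M.D ω)) M.P :=
  ⟨_, (hM.measurable_quantileIoo_FD ht).comp M.measurable_D, hM.policy_ae_eq t⟩

lemma map_policy_Iic (hM : M.Intervention fD H πdot C) {t : ℝ} (ht : t ∈ Icc (0 : ℝ) 1) (z : ℝ) :
    (M.P.map fun ω => M.policy H t (M.D ω)).real (Iic z) = H t z := by
  have h1 : M.P.map (fun ω => M.policy H t (M.D ω)) =
      (volume.restrict (Ioo 0 1)).map (quantileIoo (H t)) := by
    rw [Measure.map_congr (hM.policy_ae_eq t), ← hM.density.map_FD,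
      Measure.map_map (hM.cdf t ht).measurable_quantileIoo
        hM.density.isContinuousCDF.cont.measurable,
      Measure.map_map ((hM.cdf t ht).measurable_quantileIoo.comp
        hM.density.isContinuousCDF.cont.measurable) M.measurable_D]
    rfl
  rw [h1, (hM.cdf t ht).map_quantileIoo_Iic]

lemma ae_policy_mem (hM : M.Intervention fD H πdot C) {t : ℝ} (ht : t ∈ Icc (0 : ℝ) 1) :
    ∀ᵐ ω ∂M.P, M.policy H t (M.D ω) ∈ M.suppD := by
  refine ae_of_ae_map (p := fun d => d ∈ M.suppD) (hM.aemeasurable_policy ht) ?_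
  filter_upwards [Measure.support_mem_ae (μ := M.P.map fun ω => M.policy H t (M.D ω))] with d hd
  exact hM.rank.supp_subset t ht hd

lemma map_policy_compl (hM : M.Intervention fD H πdot C) {t : ℝ} (ht : t ∈ Icc (0 : ℝ) 1) :
    (M.P.map fun ω => M.policy H t (M.D ω)) M.suppDᶜ = 0 :=
  measure_mono_null (compl_subset_compl.2 (hM.rank.supp_subset t ht))
    Measure.measure_compl_support

/-- H_t is the distribution function of D^t, whose support lies in supp D. -/
lemma apply_eq_zero_of_lt (hM : M.Intervention fD H πdot C) {s t : ℝ} (ht : t ∈ Icc (0 : ℝ) 1)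
    (hs : ∀ d ∈ M.suppD, s < d) : H t s = 0 := by
  rw [← hM.map_policy_Iic ht, measureReal_def, measure_mono_null _ (hM.map_policy_compl ht)]
  · simp
  · exact fun z hz hzI => absurd (hs z hzI) (not_lt.2 hz)

lemma apply_eq_one_of_lt (hM : M.Intervention fD H πdot C) {s t : ℝ} (ht : t ∈ Icc (0 : ℝ) 1)
    (hs : ∀ d ∈ M.suppD, d < s) : H t s = 1 := by
  have := Measure.isProbabilityMeasure_map (hM.aemeasurable_policy ht)
  rw [← hM.map_policy_Iic ht, measureReal_def, (prob_compl_eq_zero_iff measurableSet_Iic).1,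
    ENNReal.toReal_one]
  refine measure_mono_null ?_ (hM.map_policy_compl ht)
  exact fun z hz hzI => hz (hs z hzI).le

lemma lt_or_lt_of_notMem (hM : M.Intervention fD H πdot C) {s : ℝ} (hs : s ∉ M.suppD) :
    (∀ d ∈ M.suppD, s < d) ∨ ∀ d ∈ M.suppD, d < s := by
  by_contra! h
  obtain ⟨⟨a, ha, has⟩, b, hb, hbs⟩ := h
  exact hs (hM.ordConnected_suppD.out ha hb ⟨has, hbs⟩)

/-- A point off the interval supp D has all of it on one side, so there every H_t equals 0 or every
H_t equals 1. -/
lemma apply_eq_of_notMem (hM : M.Intervention fD H πdot C) {s t : ℝ} (ht : t ∈ Icc (0 : ℝ) 1)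
    (hs : s ∉ M.suppD) : H t s = M.FD s := by
  rw [← hM.zero]
  rcases hM.lt_or_lt_of_notMem hs with h | h
  · rw [hM.apply_eq_zero_of_lt ht h, hM.apply_eq_zero_of_lt (by simp) h]
  · rw [hM.apply_eq_one_of_lt ht h, hM.apply_eq_one_of_lt (by simp) h]

/-- Here d may be the left end of the support: strictly to its left H_t vanishes, and continuity
carries this to d. -/
lemma apply_eq_zero (hM : M.Intervention fD H πdot C) {d t : ℝ} (ht : t ∈ Icc (0 : ℝ) 1)
    (hd : M.FD d = 0) : H t d = 0 := by
  have h1 : ∀ s < d, H t s = 0 := fun s hs => hM.apply_eq_zero_of_lt ht fun z hz => by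
    by_contra! hzs
    have h2 : 0 < M.FD d := by
      rw [FD_eq, measureReal_def]
      exact ENNReal.toReal_pos ((Measure.mem_support_iff_forall z).1 hz _
        (Iic_mem_nhds (hzs.trans_lt hs))).ne' (measure_ne_top _ _)
    exact h2.ne' hd
  have h3 : Tendsto (H t) (𝓝[<] d) (𝓝 (H t d)) := (hM.cdf t ht).cont.continuousWithinAt
  refine tendsto_nhds_unique (h3.congr' ?_) tendsto_const_nhds
  filter_upwards [self_mem_nhdsWithin] with s hs using h1 s hs

lemma apply_eq_one (hM : M.Intervention fD H πdot C) {d t : ℝ} (ht : t ∈ Icc (0 : ℝ) 1)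
    (hd : M.FD d = 1) : H t d = 1 := by
  have h1 : ∀ s > d, H t s = 1 := fun s hs => hM.apply_eq_one_of_lt ht fun z hz => by
    by_contra! hzs
    have h2 : 0 < (M.P.map M.D) (Ioi d) :=
      (Measure.mem_support_iff_forall z).1 hz _ (Ioi_mem_nhds (lt_of_lt_of_le hs hzs))
    rw [FD_eq, measureReal_def, ENNReal.toReal_eq_one_iff] at hd
    rw [← compl_Iic, (prob_compl_eq_zero_iff measurableSet_Iic).2 hd] at h2
    exact lt_irrefl _ h2
  have h3 : Tendsto (H t) (𝓝[>] d) (𝓝 (H t d)) := (hM.cdf t ht).cont.continuousWithinAt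
  refine tendsto_nhds_unique (h3.congr' ?_) tendsto_const_nhds
  filter_upwards [self_mem_nhdsWithin] with s hs using h1 s hs

/-- The rank-preserving policy moves `D` below `s` if and only if its rank is below `H_t(s)`. -/
lemma policy_le_iff (hM : M.Intervention fD H πdot C) {t d : ℝ} (ht : t ∈ Icc (0 : ℝ) 1)
    (hd : M.FD d ∈ Ioo (0 : ℝ) 1) (s : ℝ) : M.policy H t d ≤ s ↔ M.FD d ≤ H t s :=
  (hM.cdf t ht).quantile_le_iff hd

lemma le_iff (hM : M.Intervention fD H πdot C) {d : ℝ} (hI : d ∈ M.suppD)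
    (hd : M.FD d ∈ Ioo (0 : ℝ) 1) (s : ℝ) : d ≤ s ↔ M.FD d ≤ M.FD s := by
  rw [← hM.density.isContinuousCDF.quantile_le_iff hd, hM.quantile_FD hI hd.1]

/-! ### The joint distribution of the covariates and the rank of `D` -/

/-- The covariates and the rank `F_D(D)` have a joint density with respect to the law of `X` times
Lebesgue measure on `(0, 1)`. -/
lemma exists_couplingDensity (hM : M.Intervention fD H πdot C) :
    ∃ κ : (Fin k → ℝ) × ℝ → ℝ, IsCouplingDensity (M.P.map M.X) κ ∧
      M.P.map (fun ω => (M.X ω, M.FD (M.D ω))) =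
        ((M.P.map M.X).prod (volume.restrict (Ioo 0 1))).withDensity
          fun p => ENNReal.ofReal (κ p) := by
  set ξ := M.P.map M.X with hξ
  set ν : Measure ℝ := volume.restrict (Ioo 0 1) with hν
  have hFm := hM.density.isContinuousCDF.cont.measurable
  have hDX : Measurable fun ω => (M.D ω, M.X ω) := M.measurable_D.prodMk M.measurable_X
  have hXU : Measurable fun ω => (M.X ω, M.FD (M.D ω)) :=
    M.measurable_X.prodMk (hFm.comp M.measurable_D)
  set ζ := M.P.map fun ω => (M.X ω, M.FD (M.D ω)) with hζ
  have hζp : IsProbabilityMeasure ζ := Measure.isProbabilityMeasure_map hXU.aemeasurable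
  -- The given joint density is relative to Lebesgue measure, which on supp D is dominated by the
  -- law of D; F_D then carries the law of D to the uniform law.
  have hac1 : M.P.map (fun ω => (M.D ω, M.X ω)) ≪ (M.P.map M.D).prod ξ := by
    have h1 : (M.P.map fun ω => (M.D ω, M.X ω)).restrict (M.suppD ×ˢ univ) =
        M.P.map fun ω => (M.D ω, M.X ω) := by
      refine Measure.restrict_eq_self_of_ae_mem ?_
      rw [ae_map_iff (p := fun q => q ∈ M.suppD ×ˢ univ) hDX.aemeasurable
        (isClosed_suppD.measurableSet.prod .univ)]
      filter_upwards [ae_D_mem_suppD] with ω hω using ⟨hω, mem_univ _⟩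
    rw [← h1]
    refine (hM.density.joint.restrict _).trans ?_
    rw [← Measure.prod_restrict, Measure.restrict_univ]
    exact hM.restrict_suppD_absolutelyContinuous.prod Measure.AbsolutelyContinuous.rfl
  have hac : ζ ≪ ξ.prod ν := by
    have h2 : Measurable fun p : ℝ × (Fin k → ℝ) => (p.2, M.FD p.1) :=
      measurable_snd.prodMk (hFm.comp measurable_fst)
    have h3 := hac1.map h2
    have h4 : ((M.P.map M.D).prod ξ).map (fun p : ℝ × (Fin k → ℝ) => (p.2, M.FD p.1)) =
        ξ.prod ν := by
      have : (fun p : ℝ × (Fin k → ℝ) => (p.2, M.FD p.1)) = Prod.swap ∘ Prod.map M.FD id := by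
        ext p <;> rfl
      rw [this, ← Measure.map_map measurable_swap (hFm.prodMap measurable_id),
        ← Measure.map_prod_map _ _ hFm measurable_id, Measure.map_id, hM.density.map_FD,
        Measure.prod_swap]
    rwa [h4, Measure.map_map h2 hDX] at h3
  obtain ⟨κ, hκm, hκ0, hζd⟩ : ∃ κ : (Fin k → ℝ) × ℝ → ℝ, Measurable κ ∧ (∀ p, 0 ≤ κ p) ∧
      ζ = (ξ.prod ν).withDensity fun p => ENNReal.ofReal (κ p) := by
    refine ⟨fun p => (ζ.rnDeriv (ξ.prod ν) p).toReal,
      (Measure.measurable_rnDeriv _ _).ennreal_toReal, fun p => ENNReal.toReal_nonneg, ?_⟩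
    conv_lhs => rw [← Measure.withDensity_rnDeriv_eq ζ (ξ.prod ν) hac]
    refine withDensity_congr_ae ?_
    filter_upwards [Measure.rnDeriv_lt_top ζ (ξ.prod ν)] with p hp
    rw [ENNReal.ofReal_toReal hp.ne]
  refine ⟨κ, ⟨hκm, hκ0, ?_⟩, hζd⟩
  have hmm : Measurable fun v => ∫⁻ x, ‖κ (x, v)‖ₑ ∂ξ := hκm.enorm.lintegral_prod_left'
  -- The margin is identified by integrating over sets A of ranks, since the rank is uniform.
  refine ae_eq_of_forall_setLIntegral_eq_of_sigmaFinite hmm measurable_const fun A hA _ => ?_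
  have h5 : ζ (univ ×ˢ A) = ν A := by
    rw [hζ, Measure.map_apply hXU (MeasurableSet.univ.prod hA), hν, ← hM.density.map_FD,
      Measure.map_apply hFm hA, Measure.map_apply M.measurable_D (hFm hA)]
    congr 1
    ext ω; simp
  rw [setLIntegral_one, ← h5, hζd, withDensity_apply _ (MeasurableSet.univ.prod hA),
    ← Measure.prod_restrict, Measure.restrict_univ,
    lintegral_prod_symm _ hκm.ennreal_ofReal.aemeasurable]
  refine lintegral_congr fun v => lintegral_congr fun x => ?_
  rw [Real.enorm_of_nonneg (hκ0 _)]

end Intervention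

end Model

end MPE

namespace MPE

namespace Model

variable {Ω E : Type*} [MeasurableSpace Ω] [MeasurableSpace E] {k : ℕ} {M : Model Ω E k}
  {fD πdot : ℝ → ℝ} {H : ℝ → ℝ → ℝ} {C : ℝ → (Fin k → ℝ) → ℝ}

/-! ### The conditional distribution of the outcome -/

lemma measurable_m_right (d : ℝ) (x : Fin k → ℝ) : Measurable (M.m d x) :=
  M.measurable_m.comp (by fun_prop : Measurable fun e : E => (d, x, e))

lemma measurableSet_m_le (y : ℝ) :
    MeasurableSet {p : (ℝ × (Fin k → ℝ)) × E | M.m p.1.1 p.1.2 p.2 ≤ y} :=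
  measurableSet_le (M.measurable_m.comp
    (by fun_prop : Measurable fun p : (ℝ × (Fin k → ℝ)) × E => (p.1.1, p.1.2, p.2)))
    measurable_const

lemma measurable_condF (y : ℝ) : Measurable fun p : ℝ × (Fin k → ℝ) => M.condF y p.1 p.2 :=
  (Kernel.measurable_kernel_prodMk_left (κ := M.κ) (measurableSet_m_le y)).ennreal_toReal

lemma condF_nonneg (y d : ℝ) (x : Fin k → ℝ) : 0 ≤ M.condF y d x := measureReal_nonneg

lemma condF_le_one (y d : ℝ) (x : Fin k → ℝ) : M.condF y d x ≤ 1 := measureReal_le_one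

lemma condF_eq_lawY (y d : ℝ) (x : Fin k → ℝ) : M.condF y d x = (M.lawY d x).real (Iic y) := by
  rw [lawY, map_measureReal_apply (measurable_m_right d x) measurableSet_Iic]; rfl

lemma RegularConditional.isContinuousCDF (hM : M.RegularConditional) {d : ℝ} (hd : d ∈ M.suppD)
    {x : Fin k → ℝ} (hx : x ∈ M.suppX) : IsContinuousCDF (M.condFL d x) := by
  obtain ⟨q, -, hq, -⟩ := hM.cond_density d hd x hx
  have : IsProbabilityMeasure (M.lawY d x) :=
    Measure.isProbabilityMeasure_map (measurable_m_right d x).aemeasurable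
  have : NullSingletonClass (M.lawY d x) :=
    ⟨fun z => by rw [hq]; exact withDensity_absolutelyContinuous _ _ (by simp)⟩
  exact isContinuousCDF_of_measure (lam := M.lawY d x) fun y => condF_eq_lawY y d x

lemma abs_measureReal_sub_le {α : Type*} [MeasurableSpace α] {μ : Measure α} [IsFiniteMeasure μ]
    {s t r : Set α} (h1 : s ⊆ t ∪ r) (h2 : t ⊆ s ∪ r) : |μ.real s - μ.real t| ≤ μ.real r := by
  have h3 := (measureReal_mono (μ := μ) h1).trans (measureReal_union_le t r)
  have h4 := (measureReal_mono (μ := μ) h2).trans (measureReal_union_le s r)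
  rw [abs_le]; constructor <;> linarith

/-- A strip around the level `y`, of width proportional to the slope, has small mass. -/
lemma withDensity_strip_le {f : ℝ → ℝ → ℝ} {g : ℝ → ℝ} {c : ℝ} (hc : 0 < c) (hg : Integrable g)
    (hg' : Integrable fun y' => y' * g y') (hf : ∀ y y', f y y' ≤ c * |g y'|) (y : ℝ) {δ : ℝ}
    (hδ : 0 ≤ δ) :
    ((volume : Measure (ℝ × ℝ)).withDensity fun p => ENNReal.ofReal (f p.1 p.2))
      {p | |p.1 - y| ≤ δ * (|p.2| + 1)} ≤
        ENNReal.ofReal (δ * (2 * c * ∫ y', (|y'| + 1) * |g y'|)) := by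
  have hS : MeasurableSet {p : ℝ × ℝ | |p.1 - y| ≤ δ * (|p.2| + 1)} :=
    measurableSet_le (by fun_prop) (by fun_prop)
  have hgi : Integrable fun y' => (|y'| + 1) * |g y'| := by
    refine (hg'.abs.add hg.abs).congr (Eventually.of_forall fun y' => ?_)
    simp only [Pi.add_apply, abs_mul]; ring
  have hgm : AEMeasurable (fun p : ℝ × ℝ => {p : ℝ × ℝ | |p.1 - y| ≤ δ * (|p.2| + 1)}.indicator
      (fun p => ENNReal.ofReal (c * |g p.2|)) p) := by
    refine AEMeasurable.indicator ?_ hS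
    exact ((hg.1.aemeasurable.comp_snd).norm.const_mul c).ennreal_ofReal
  rw [withDensity_apply _ hS]
  calc ∫⁻ p in {p : ℝ × ℝ | |p.1 - y| ≤ δ * (|p.2| + 1)}, ENNReal.ofReal (f p.1 p.2)
      ≤ ∫⁻ p in {p : ℝ × ℝ | |p.1 - y| ≤ δ * (|p.2| + 1)}, ENNReal.ofReal (c * |g p.2|) :=
        lintegral_mono fun p => ENNReal.ofReal_le_ofReal (hf _ _)
    _ = ∫⁻ y', (∫⁻ u, {p : ℝ × ℝ | |p.1 - y| ≤ δ * (|p.2| + 1)}.indicator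
          (fun p => ENNReal.ofReal (c * |g p.2|)) (u, y')) := by
        rw [← lintegral_indicator hS, Measure.volume_eq_prod, lintegral_prod_symm _ hgm]
    -- The bound c|g| does not involve the first coordinate, and the section of the strip at slope
    -- y' is an interval of length 2δ(|y'| + 1).
    _ = ∫⁻ y', ENNReal.ofReal (δ * (2 * c)) * ENNReal.ofReal ((|y'| + 1) * |g y'|) := by
        refine lintegral_congr fun y' => ?_
        have h1 : (fun u => {p : ℝ × ℝ | |p.1 - y| ≤ δ * (|p.2| + 1)}.indicator
            (fun p => ENNReal.ofReal (c * |g p.2|)) (u, y')) =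
            (Icc (y - δ * (|y'| + 1)) (y + δ * (|y'| + 1))).indicator
              fun _ => ENNReal.ofReal (c * |g y'|) := by
          ext u
          have : |u - y| ≤ δ * (|y'| + 1) ↔
              u ∈ Icc (y - δ * (|y'| + 1)) (y + δ * (|y'| + 1)) := by
            rw [abs_le, mem_Icc]; constructor <;> rintro ⟨h, h'⟩ <;> constructor <;> linarith
          simp only [indicator, mem_ofPred_eq, this]
        rw [h1, lintegral_indicator_const measurableSet_Icc, Real.volume_Icc,
          ← ENNReal.ofReal_mul (by positivity), ← ENNReal.ofReal_mul (by positivity)]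
        congr 1; ring
    _ = ENNReal.ofReal (δ * (2 * c * ∫ y', (|y'| + 1) * |g y'|)) := by
        rw [lintegral_const_mul' _ _ ENNReal.ofReal_ne_top,
          ← ofReal_integral_eq_lintegral_ofReal hgi (Eventually.of_forall fun y' => by positivity),
          ← ENNReal.ofReal_mul (by positivity)]
        congr 1; ring

namespace Intervention

lemma hasDerivAt_condF (hM : M.Intervention fD H πdot C) (y : ℝ) {d : ℝ}
    (hd : d ∈ interior M.suppD) {x : Fin k → ℝ} (hx : x ∈ M.suppX) :
    HasDerivAt (fun s => M.condF y s x) (M.dcondF y d x) d := by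
  have h := (hM.conditional.contDiff_condF y x hx).differentiableOn one_ne_zero d
    (interior_subset hd)
  exact h.hasDerivWithinAt.hasDerivAt (mem_interior_iff_mem_nhds.1 hd)

/-- `∂_d F_{Y|D,X}` is bounded, uniformly in all its arguments. -/
lemma exists_abs_dcondF_le (hM : M.Intervention fD H πdot C) :
    ∃ L, 0 ≤ L ∧ ∀ y, ∀ d ∈ interior M.suppD, ∀ x ∈ M.suppX, |M.dcondF y d x| ≤ L := by
  obtain ⟨f, g, c, hg, hg', hc, hf⟩ := hM.conditional.cond_joint_density
  refine ⟨2 * c * ∫ y', (|y'| + 1) * |g y'|, ?_, fun y d hd x hx => ?_⟩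
  · have : 0 ≤ ∫ y', (|y'| + 1) * |g y'| := integral_nonneg fun y' => by positivity
    positivity
  have hdI := interior_subset hd
  obtain ⟨-, -, hlaw, -, hle⟩ := hf d hdI x hx
  set L := 2 * c * ∫ y', (|y'| + 1) * |g y'| with hL
  have hL0 : 0 ≤ L := by
    have : 0 ≤ ∫ y', (|y'| + 1) * |g y'| := integral_nonneg fun y' => by positivity
    positivity
  have hdm : Measurable fun e => (M.m d x e, M.dm d x e) :=
    (measurable_m_right d x).prodMk (hM.conditional.measurable_dm d hdI x hx)
  -- R δ is the probability that the linear approximation fails by at least δ; the choice ν = 1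
  -- suffices, and R δ = o(δ).
  set R : ℝ → ℝ := fun δ => (M.κ (d, x)).real {e | 1 * δ ≤
      |M.m (d + δ) x e - M.m d x e - δ * M.dm d x e|} with hR
  have hR0 : Tendsto (fun δ => R δ / δ) (𝓝[>] 0) (𝓝 0) :=
    (hM.conditional.linearization d hdI x hx 1 one_pos).tendsto_div_nhds_zero
  have hsub : Tendsto (fun s => s - d) (𝓝[>] d) (𝓝[>] 0) := by
    refine tendsto_nhdsWithin_iff.2 ⟨?_, ?_⟩
    · have : Tendsto (fun s => s - d) (𝓝 d) (𝓝 (d - d)) := tendsto_id.sub_const d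
      rw [sub_self] at this
      exact this.mono_left nhdsWithin_le_nhds
    · filter_upwards [self_mem_nhdsWithin] with s hs using sub_pos.2 (mem_Ioi.1 hs)
  have hslope := (hasDerivWithinAt_iff_tendsto_slope' self_notMem_Ioi).1
    ((hM.hasDerivAt_condF y hd hx).hasDerivWithinAt (s := Ioi d))
  have hlim : Tendsto (fun s => R (s - d) / (s - d) + L) (𝓝[>] d) (𝓝 L) := by
    simpa using (hR0.comp hsub).add_const L
  refine le_of_tendsto_of_tendsto hslope.abs hlim ?_
  filter_upwards [self_mem_nhdsWithin,
    mem_nhdsWithin_of_mem_nhds (mem_interior_iff_mem_nhds.1 hd)] with s hs hsI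
  have hs' : 0 < s - d := sub_pos.2 (mem_Ioi.1 hs)
  have hκ : M.κ (s, x) = M.κ (d, x) := hM.condIndep x hx s hsI d hdI
  have hstrip : (M.κ (d, x)).real {e | |M.m d x e - y| ≤ (s - d) * (|M.dm d x e| + 1)} ≤
      (s - d) * L := by
    refine ENNReal.toReal_le_of_le_ofReal (by positivity) ?_
    have := withDensity_strip_le hc hg hg' hle y hs'.le
    rw [← hlaw, Measure.map_apply hdm (measurableSet_le (by fun_prop) (by fun_prop))] at this
    exact this
  -- Conditional independence puts both distribution functions under one law of ε. Off the
  -- linearization failure the outcome moves by less than (s - d)(|∂_d m| + 1), so it can cross the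
  -- level y only from within the strip.
  have key : |M.condF y s x - M.condF y d x| ≤ R (s - d) + (s - d) * L := by
    refine le_trans ?_ (add_le_add_right hstrip (R (s - d)))
    refine le_trans ?_ (measureReal_union_le _ _)
    unfold condF cdfFun
    rw [hκ]
    refine abs_measureReal_sub_le (fun e he => ?_) fun e he => ?_
    all_goals
      by_contra hcon
      simp only [mem_union, mem_ofPred_eq, not_or, not_le, add_sub_cancel, one_mul] at hcon he
      obtain ⟨h1, h2, h3⟩ := hcon
      have h4 : (s - d) * M.dm d x e ≤ (s - d) * |M.dm d x e| :=
        mul_le_mul_of_nonneg_left (le_abs_self _) hs'.le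
      have h5 : (s - d) * -M.dm d x e ≤ (s - d) * |M.dm d x e| :=
        mul_le_mul_of_nonneg_left (neg_le_abs _) hs'.le
      rw [abs_lt] at h2
      rcases lt_abs.1 h3 with h | h <;> nlinarith [h2.1, h2.2]
  rw [slope_def_field, abs_div, abs_of_pos hs', div_le_iff₀ hs', add_mul,
    div_mul_cancel₀ _ hs'.ne']
  linarith

end Intervention

/-- The derivative `∂_d F_{Y|D,X}(y|d, x)` in the interior of the support, as a function of
`(x, d)`, extended by `0`. -/
noncomputable def dcondFInt (M : Model Ω E k) (y : ℝ) : (Fin k → ℝ) × ℝ → ℝ :=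
  (M.suppX ×ˢ interior M.suppD).indicator fun p => M.dcondF y p.2 p.1

namespace Intervention

lemma dcondFInt_of_mem (y : ℝ) {d : ℝ} (hd : d ∈ interior M.suppD) {x : Fin k → ℝ}
    (hx : x ∈ M.suppX) : M.dcondFInt y (x, d) = M.dcondF y d x :=
  indicator_of_mem (show (x, d) ∈ M.suppX ×ˢ interior M.suppD from ⟨hx, hd⟩) _

lemma abs_dcondFInt_le {L : ℝ} (hL : 0 ≤ L)
    (h : ∀ y, ∀ d ∈ interior M.suppD, ∀ x ∈ M.suppX, |M.dcondF y d x| ≤ L) (y : ℝ)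
    (p : (Fin k → ℝ) × ℝ) : |M.dcondFInt y p| ≤ L := by
  by_cases hp : p ∈ M.suppX ×ˢ interior M.suppD
  · rw [dcondFInt, indicator_of_mem hp]
    exact h y _ hp.2 _ hp.1
  · rw [dcondFInt, indicator_of_notMem hp, abs_zero]
    exact hL

/-- A pointwise limit of difference quotients with steps 1/(n + 1); cutting down to the interior
makes these converge everywhere. -/
lemma measurable_dcondFInt (hM : M.Intervention fD H πdot C) (y : ℝ) :
    Measurable (M.dcondFInt y) := by
  have hS : MeasurableSet (M.suppX ×ˢ interior M.suppD) :=
    isClosed_suppX.measurableSet.prod isOpen_interior.measurableSet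
  refine measurable_of_tendsto_metrizable (f := fun (n : ℕ) =>
    (M.suppX ×ˢ interior M.suppD).indicator fun p : (Fin k → ℝ) × ℝ =>
      ((1 / ((n : ℝ) + 1))⁻¹ * (M.condF y (p.2 + 1 / ((n : ℝ) + 1)) p.1 - M.condF y p.2 p.1)))
    (fun n => ?_) (tendsto_pi_nhds.2 fun p => ?_)
  · refine Measurable.indicator (Measurable.const_mul (Measurable.sub ?_ ?_) _) hS
    · exact (measurable_condF y).comp
        (by fun_prop : Measurable fun p : (Fin k → ℝ) × ℝ => (p.2 + 1 / ((n : ℝ) + 1), p.1))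
    · exact (measurable_condF y).comp
        (by fun_prop : Measurable fun p : (Fin k → ℝ) × ℝ => (p.2, p.1))
  · by_cases hp : p ∈ M.suppX ×ˢ interior M.suppD
    · simp only [dcondFInt, indicator_of_mem hp]
      have h1 := (hM.hasDerivAt_condF y hp.2 hp.1).tendsto_slope_zero_right
      have h2 : Tendsto (fun n : ℕ => 1 / ((n : ℝ) + 1)) atTop (𝓝[>] 0) :=
        tendsto_nhdsWithin_iff.2 ⟨tendsto_one_div_add_atTop_nhds_zero_nat,
          Eventually.of_forall fun n => mem_Ioi.2 (by positivity)⟩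
      exact h1.comp h2
    · simp only [dcondFInt, indicator_of_notMem hp]
      exact tendsto_const_nhds

/-- The fundamental theorem of calculus for `F_{Y|D,X}(y|·, x)` on the support of `D`. -/
lemma condF_sub_condF (hM : M.Intervention fD H πdot C) (y : ℝ) {a b : ℝ} (ha : a ∈ M.suppD)
    (hb : b ∈ M.suppD) {x : Fin k → ℝ} (hx : x ∈ M.suppX) :
    M.condF y b x - M.condF y a x = ∫ s in a..b, M.dcondFInt y (x, s) := by
  obtain ⟨L, hL, hL'⟩ := hM.exists_abs_dcondF_le
  have hsub : uIcc a b ⊆ M.suppD := hM.ordConnected_suppD.uIcc_subset ha hb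
  have hint : Ioo (min a b) (max a b) ⊆ interior M.suppD :=
    interior_maximal (Ioo_subset_Icc_self.trans hsub) isOpen_Ioo
  refine (intervalIntegral.integral_eq_sub_of_hasDeriv_right
    ((hM.conditional.contDiff_condF y x hx).continuousOn.mono hsub) (fun s hs => ?_) ?_).symm
  · rw [dcondFInt_of_mem y (hint hs) hx]
    exact (hM.hasDerivAt_condF y (hint hs) hx).hasDerivWithinAt
  · refine (intervalIntegrable_const (c := L)).mono_fun' ?_ (Eventually.of_forall fun s => ?_)
    · exact ((hM.measurable_dcondFInt y).comp (by fun_prop)).aestronglyMeasurable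
    · exact abs_dcondFInt_le hL hL' y _

/-! ### The distribution of the counterfactual outcome -/

/-- `F_{Y^t}(y) = E[F_{Y|D,X}(y|π_t(D), X)]`, by conditional independence. -/
lemma cdfFun_Yof (hM : M.Intervention fD H πdot C) {π : ℝ → ℝ} (hπ : Measurable π)
    (hπI : ∀ᵐ ω ∂M.P, π (M.D ω) ∈ M.suppD) (y : ℝ) :
    cdfFun M.P (M.Yof π) y = ∫ ω, M.condF y (π (M.D ω)) (M.X ω) ∂M.P := by
  have hDX : Measurable fun ω => (M.D ω, M.X ω) := M.measurable_D.prodMk M.measurable_X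
  have hS : MeasurableSet {p : (ℝ × (Fin k → ℝ)) × E | M.m (π p.1.1) p.1.2 p.2 ≤ y} :=
    measurableSet_le (M.measurable_m.comp
      (by fun_prop : Measurable fun p : (ℝ × (Fin k → ℝ)) × E => (π p.1.1, p.1.2, p.2)))
      measurable_const
  have h1 : M.P {ω | M.Yof π ω ≤ y} =
      ∫⁻ ω, (M.κ (M.D ω, M.X ω)) {e | M.m (π (M.D ω)) (M.X ω) e ≤ y} ∂M.P := by
    have h2 : M.P {ω | M.Yof π ω ≤ y} = (M.P.map fun ω => ((M.D ω, M.X ω), M.ε ω))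
        {p : (ℝ × (Fin k → ℝ)) × E | M.m (π p.1.1) p.1.2 p.2 ≤ y} := by
      rw [Measure.map_apply (hDX.prodMk M.measurable_ε) hS]; rfl
    rw [h2, M.disintegration, Measure.compProd_apply hS,
      lintegral_map (Kernel.measurable_kernel_prodMk_left hS) hDX]
    rfl
  have hm : Measurable fun ω => M.condF y (π (M.D ω)) (M.X ω) :=
    (measurable_condF y).comp ((hπ.comp M.measurable_D).prodMk M.measurable_X)
  rw [cdfFun, measureReal_def, h1, integral_eq_lintegral_of_nonneg_ae
    (Eventually.of_forall fun ω => condF_nonneg _ _ _) hm.aestronglyMeasurable]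
  congr 1
  refine lintegral_congr_ae ?_
  filter_upwards [hπI, ae_D_mem_suppD, ae_X_mem_suppX] with ω h1 h2 h3
  -- Conditional independence exchanges the law of ε at (D, X) for the one at (π(D), X), both first
  -- arguments being in supp D.
  rw [condF, cdfFun, ofReal_measureReal, hM.condIndep _ h3 _ h1 _ h2]

lemma ae_quantileIoo_mem (hM : M.Intervention fD H πdot C) {t : ℝ} (ht : t ∈ Icc (0 : ℝ) 1) :
    ∀ᵐ ω ∂M.P, quantileIoo (H t) (M.FD (M.D ω)) ∈ M.suppD := by
  filter_upwards [hM.ae_policy_mem ht, hM.policy_ae_eq t] with ω h1 h2 using h2 ▸ h1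

lemma cdfFun_Yof_policy (hM : M.Intervention fD H πdot C) {t : ℝ} (ht : t ∈ Icc (0 : ℝ) 1)
    (y : ℝ) : cdfFun M.P (M.Yof (M.policy H t)) y =
      ∫ ω, M.condF y (quantileIoo (H t) (M.FD (M.D ω))) (M.X ω) ∂M.P := by
  rw [← hM.cdfFun_Yof (hM.measurable_quantileIoo_FD ht) (hM.ae_quantileIoo_mem ht)]
  refine measureReal_congr ?_
  filter_upwards [hM.policy_ae_eq t] with ω hω
  refine propext ?_
  change M.Yof _ ω ≤ y ↔ M.Yof _ ω ≤ y
  simp only [Yof, hω]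

lemma cdfFun_Y (hM : M.Intervention fD H πdot C) (y : ℝ) :
    cdfFun M.P M.Y y = ∫ ω, M.condF y (M.D ω) (M.X ω) ∂M.P :=
  hM.cdfFun_Yof (π := id) measurable_id ae_D_mem_suppD y

end Intervention

end Model

end MPE

/-! ### From increments of the policy variable to uniform convergence of distribution functions -/

namespace MPE

open Classical in
-- The interval [a, b) is used instead of (a, b] so that the indicators are those of a ≤ s and b ≤
-- s, the events that translate into ranks.
lemma intervalIntegral_eq_integral_sub_mul {g : ℝ → ℝ} (a b : ℝ) :
    ∫ s in a..b, g s = ∫ s, g s * ((if a ≤ s then 1 else 0) - (if b ≤ s then 1 else 0)) := by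
  rcases le_total a b with hab | hab
  · rw [intervalIntegral.integral_of_le hab, ← integral_Ico_eq_integral_Ioc,
      ← integral_indicator measurableSet_Ico]
    congr with s
    simp only [indicator, mem_Ico]
    by_cases h1 : a ≤ s <;> by_cases h2 : b ≤ s <;> simp [h1, h2]
    exact absurd (hab.trans h2) h1
  · rw [intervalIntegral.integral_of_ge hab, ← integral_Ico_eq_integral_Ioc,
      ← integral_indicator measurableSet_Ico, ← integral_neg]
    congr with s
    simp only [indicator, mem_Ico]
    by_cases h1 : a ≤ s <;> by_cases h2 : b ≤ s <;> simp [h1, h2]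
    exact absurd (hab.trans h1) h2

/-- A mixture of continuous distribution functions is a continuous distribution function. -/
lemma isContinuousCDF_integral {Ω : Type*} [MeasurableSpace Ω] {P : Measure Ω}
    [IsProbabilityMeasure P] {G : ℝ → Ω → ℝ} (hm : ∀ y, AEStronglyMeasurable (G y) P)
    (hG : ∀ᵐ ω ∂P, IsContinuousCDF fun y => G y ω) : IsContinuousCDF fun y => ∫ ω, G y ω ∂P := by
  have hb : ∀ y, ∀ᵐ ω ∂P, ‖G y ω‖ ≤ (fun _ => 1 : Ω → ℝ) ω := fun y => by
    filter_upwards [hG] with ω hω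
    rw [Real.norm_of_nonneg (hω.nonneg y)]
    exact hω.le_one y
  have hi : ∀ y, Integrable (G y) P := fun y => Integrable.mono' (integrable_const 1) (hm y) (hb y)
  refine ⟨fun y z hyz => integral_mono_ae (hi y) (hi z) ?_, ?_, ?_, ?_⟩
  · filter_upwards [hG] with ω hω using hω.mono hyz
  · refine continuous_of_dominated hm hb (integrable_const 1) ?_
    filter_upwards [hG] with ω hω using hω.cont
  · have := tendsto_integral_filter_of_dominated_convergence (l := atBot) (F := G)
      (f := fun _ => (0 : ℝ)) (fun _ => 1) (Eventually.of_forall hm) (Eventually.of_forall hb)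
      (integrable_const 1) (hG.mono fun ω hω => hω.bot)
    simpa using this
  · have := tendsto_integral_filter_of_dominated_convergence (l := atTop) (F := G)
      (f := fun _ => (1 : ℝ)) (fun _ => 1) (Eventually.of_forall hm) (Eventually.of_forall hb)
      (integrable_const 1) (hG.mono fun ω hω => hω.top)
    simpa using this

namespace Model

variable {Ω E : Type*} [MeasurableSpace Ω] [MeasurableSpace E] {k : ℕ} {M : Model Ω E k}
  {fD πdot : ℝ → ℝ} {H : ℝ → ℝ → ℝ} {C : ℝ → (Fin k → ℝ) → ℝ}

/-! ### The marginal effect on the distribution function -/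

namespace Intervention

lemma isPerturbation (hM : M.Intervention fD H πdot C) {ℓ : ℝ → ℝ} (hℓm : Measurable ℓ)
    (hℓi : Integrable ℓ) (hℓ0 : ∀ s ∉ M.suppD, ℓ s = 0)
    (hnorm : ∀ t ∈ Ioc (0 : ℝ) 1,
      ∫⁻ s, ‖H 0 s - H t s‖ₑ = ENNReal.ofReal t * ∫⁻ s, ‖ℓ s‖ₑ)
    (hder : ∀ᵐ s : ℝ, HasDerivWithinAt (fun t => H t s) (-ℓ s) (Ioi 0) 0) :
    IsPerturbation H ℓ M.suppD where
  measurable t ht := (hM.cdf t ht).cont.measurable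
  integrable := hℓi
  measurable_deriv := hℓm
  lintegral_eq := hnorm
  off s hs := ⟨hℓ0 s hs, fun t ht => by rw [hM.apply_eq_of_notMem ht hs, hM.zero]⟩
  null N hN := by rw [hM.zero]; exact hM.ae_FD_notMem hN
  deriv := hder

lemma measurable_rank (hM : M.Intervention fD H πdot C) :
    Measurable fun ω => (M.X ω, M.FD (M.D ω)) :=
  M.measurable_X.prodMk (hM.density.isContinuousCDF.cont.measurable.comp M.measurable_D)

variable {ℓ ρ : ℝ → ℝ} {κ : (Fin k → ℝ) × ℝ → ℝ}

/-- The level y enters only through a bounded factor, and t only through the weights. Rank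
preservation replaces the position of s relative to D and π_t(D) by that of the rank relative to
H_0(s) and H_t(s). -/
lemma cdfFun_Yof_sub (hM : M.Intervention fD H πdot C) (hP : IsPerturbation H ℓ M.suppD)
    (hκ : IsCouplingDensity (M.P.map M.X) κ)
    (hlaw : M.P.map (fun ω => (M.X ω, M.FD (M.D ω))) =
      ((M.P.map M.X).prod (volume.restrict (Ioo 0 1))).withDensity fun p => ENNReal.ofReal (κ p))
    {t : ℝ} (ht : t ∈ Ioc (0 : ℝ) 1) (y : ℝ) :
    cdfFun M.P (M.Yof (M.policy H t)) y - cdfFun M.P M.Y y =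
      ∫ p, M.dcondFInt y p * weight κ (H t p.2) (H 0 p.2) p.1 ∂((M.P.map M.X).prod volume) := by
  have ht' := Ioc_subset_Icc_self ht
  obtain ⟨L, hL, hL'⟩ := hM.exists_abs_dcondF_le
  have hg := hM.measurable_dcondFInt y
  have h0 := hP.measurable 0 (by simp)
  have h1 := hP.measurable t ht'
  have hm1 : Measurable fun ω => M.condF y (quantileIoo (H t) (M.FD (M.D ω))) (M.X ω) :=
    (measurable_condF y).comp (((hM.measurable_quantileIoo_FD ht').comp M.measurable_D).prodMk
      M.measurable_X)
  have hm2 : Measurable fun ω => M.condF y (M.D ω) (M.X ω) :=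
    (measurable_condF y).comp (M.measurable_D.prodMk M.measurable_X)
  have hb : ∀ d x, ‖M.condF y d x‖ ≤ 1 := fun d x => by
    rw [Real.norm_of_nonneg (condF_nonneg _ _ _)]; exact condF_le_one _ _ _
  have hJ : StronglyMeasurable fun p : (Fin k → ℝ) × ℝ =>
      ∫ s, M.dcondFInt y (p.1, s) * between (H t s) (H 0 s) p.2 := by
    refine StronglyMeasurable.integral_prod_right (f := fun (p : (Fin k → ℝ) × ℝ) (s : ℝ) =>
      M.dcondFInt y (p.1, s) * between (H t s) (H 0 s) p.2) (Measurable.stronglyMeasurable ?_)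
    refine (hg.comp (by fun_prop)).mul ?_
    exact measurable_between (h1.comp (by fun_prop)) (h0.comp (by fun_prop)) (by fun_prop)
  rw [hM.cdfFun_Yof_policy ht', hM.cdfFun_Y, ← integral_sub
    (Integrable.mono' (integrable_const 1) hm1.aestronglyMeasurable
      (Eventually.of_forall fun ω => hb _ _))
    (Integrable.mono' (integrable_const 1) hm2.aestronglyMeasurable
      (Eventually.of_forall fun ω => hb _ _)),
    ← integral_between_eq_integral_weight hκ h1 h0 (hP.lintegral_lt_top ht) hg
      (abs_dcondFInt_le hL hL' y), ← hlaw,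
    integral_map hM.measurable_rank.aemeasurable hJ.aestronglyMeasurable]
  refine integral_congr_ae ?_
  filter_upwards [ae_D_mem_suppD, ae_X_mem_suppX, hM.ae_quantileIoo_mem ht',
    hM.density.ae_FD_D_mem] with ω hD hX hQ hU
  classical
  rw [hM.condF_sub_condF y hD hQ hX, intervalIntegral_eq_integral_sub_mul]
  congr with s
  simp only [between, hM.zero, hM.le_iff hD hU s, ← policy_eq M H t hU, hM.policy_le_iff ht' hU s]

/-- The function ρ plays the role of ℓ / f_D: almost everywhere the policy derivative for a mixture,
and 1 for a shift. -/
lemma integrable_rho (hM : M.Intervention fD H πdot C) (hP : IsPerturbation H ℓ M.suppD)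
    (hℓ : ∀ᵐ s : ℝ, ℓ s = ρ s * fD s) :
    Integrable (fun ω => ρ (M.D ω)) M.P := by
  have h : Integrable ρ (M.P.map M.D) := by
    rw [hM.density.law, integrable_withDensity_iff hM.density.measurable.ennreal_ofReal
      (Eventually.of_forall fun _ => ENNReal.ofReal_lt_top)]
    refine hP.integrable.congr ?_
    filter_upwards [hℓ] with s hs
    rw [hs, ENNReal.toReal_ofReal (hM.density.nonneg s)]
  exact h.comp_measurable M.measurable_D

lemma ae_dcondFInt_eq (hM : M.Intervention fD H πdot C) (y : ℝ) :
    ∀ᵐ ω ∂M.P, M.dcondFInt y (M.X ω, M.D ω) = M.dcondF y (M.D ω) (M.X ω) := by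
  filter_upwards [hM.ae_D_mem_interior, ae_X_mem_suppX] with ω h1 h2 using dcondFInt_of_mem y h1 h2

lemma integrable_rho_mul_dcondFInt (hM : M.Intervention fD H πdot C)
    (hP : IsPerturbation H ℓ M.suppD) (hℓ : ∀ᵐ s : ℝ, ℓ s = ρ s * fD s) (y : ℝ) :
    Integrable (fun ω => ρ (M.D ω) * M.dcondFInt y (M.X ω, M.D ω)) M.P := by
  obtain ⟨L, hL, hL'⟩ := hM.exists_abs_dcondF_le
  refine (hM.integrable_rho hP hℓ).mul_bdd (c := L) ?_
    (Eventually.of_forall fun ω => abs_dcondFInt_le hL hL' y _)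
  exact ((hM.measurable_dcondFInt y).comp
    (M.measurable_X.prodMk M.measurable_D)).aestronglyMeasurable

/-- Identifies the limit by the change of variables v = F_D(r): the pair of covariates and rank has
density κ, the uniform law in v pulls back to f_D(r) dr, and ρ f_D = ℓ. -/
lemma integral_rho_mul_dcondFInt (hM : M.Intervention fD H πdot C)
    (hP : IsPerturbation H ℓ M.suppD) (hκ : IsCouplingDensity (M.P.map M.X) κ)
    (hlaw : M.P.map (fun ω => (M.X ω, M.FD (M.D ω))) =
      ((M.P.map M.X).prod (volume.restrict (Ioo 0 1))).withDensity fun p => ENNReal.ofReal (κ p))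
    (hρ : Measurable ρ) (hℓ : ∀ᵐ s : ℝ, ℓ s = ρ s * fD s) (y : ℝ) :
    ∫ ω, ρ (M.D ω) * M.dcondFInt y (M.X ω, M.D ω) ∂M.P =
      ∫ p, M.dcondFInt y p * (ℓ p.2 * κ (p.1, H 0 p.2)) ∂((M.P.map M.X).prod volume) := by
  obtain ⟨L, hL, hL'⟩ := hM.exists_abs_dcondF_le
  have hF := hM.density.isContinuousCDF
  have hg := hM.measurable_dcondFInt y
  have hQ := hF.measurable_quantileIoo
  set ψ : (Fin k → ℝ) × ℝ → ℝ := fun p =>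
    ρ (quantileIoo M.FD p.2) * M.dcondFInt y (p.1, quantileIoo M.FD p.2) with hψ
  have hψm : Measurable ψ := (hρ.comp (by fun_prop)).mul (hg.comp (by fun_prop))
  have hQF : ∀ᵐ d ∂(M.P.map M.D), quantileIoo M.FD (M.FD d) = d := by
    filter_upwards [ae_mem_suppD, hM.density.ae_FD_mem] with d h1 h2
    rw [quantileIoo_of_mem h2, hM.quantile_FD h1 h2.1]
  have hω : (fun ω => ρ (M.D ω) * M.dcondFInt y (M.X ω, M.D ω)) =ᵐ[M.P]
      fun ω => ψ (M.X ω, M.FD (M.D ω)) := by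
    filter_upwards [ae_of_ae_map M.measurable_D.aemeasurable hQF] with ω h
    simp only [hψ, h]
  have hψi : Integrable ψ (M.P.map fun ω => (M.X ω, M.FD (M.D ω))) :=
    (integrable_map_measure hψm.aestronglyMeasurable hM.measurable_rank.aemeasurable).2
      ((hM.integrable_rho_mul_dcondFInt hP hℓ y).congr hω)
  have hκψ : Integrable (fun p => ψ p * κ p)
      ((M.P.map M.X).prod (volume.restrict (Ioo 0 1))) := by
    rw [hlaw, integrable_withDensity_iff hκ.measurable.ennreal_ofReal
      (Eventually.of_forall fun _ => ENNReal.ofReal_lt_top)] at hψi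
    simpa only [ENNReal.toReal_ofReal (hκ.nonneg _)] using hψi
  rw [integral_congr_ae hω, ← integral_map (f := ψ) hM.measurable_rank.aemeasurable
    hψm.aestronglyMeasurable, hlaw,
    integral_withDensity_eq_integral_toReal_smul hκ.measurable.ennreal_ofReal
      (Eventually.of_forall fun _ => ENNReal.ofReal_lt_top)]
  simp only [ENNReal.toReal_ofReal (hκ.nonneg _), smul_eq_mul, mul_comm (κ _)]
  rw [integral_prod _ hκψ, integral_prod _ ((integrable_limit_weight hκ hP).bdd_mul (c := L)
    hg.aestronglyMeasurable (Eventually.of_forall (abs_dcondFInt_le hL hL' y)))]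
  refine integral_congr_ae (Eventually.of_forall fun x => ?_)
  have hx : Measurable fun v => ψ (x, v) * κ (x, v) :=
    (hψm.comp (by fun_prop)).mul (hκ.measurable.comp (by fun_prop))
  calc ∫ v in Ioo 0 1, ψ (x, v) * κ (x, v)
      = ∫ r, ψ (x, M.FD r) * κ (x, M.FD r) ∂(M.P.map M.D) := by
        rw [← hM.density.map_FD, integral_map hF.cont.measurable.aemeasurable
          hx.aestronglyMeasurable]
    _ = ∫ r, ρ r * M.dcondFInt y (x, r) * κ (x, M.FD r) ∂(M.P.map M.D) := by
        refine integral_congr_ae ?_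
        filter_upwards [hQF] with r hr
        simp only [hψ, hr]
    _ = ∫ r, M.dcondFInt y (x, r) * (ℓ r * κ (x, H 0 r)) := by
        rw [hM.density.law, integral_withDensity_eq_integral_toReal_smul
          hM.density.measurable.ennreal_ofReal (Eventually.of_forall fun _ => ENNReal.ofReal_lt_top)]
        refine integral_congr_ae ?_
        filter_upwards [hℓ] with r hr
        rw [hr, ENNReal.toReal_ofReal (hM.density.nonneg r), hM.zero, smul_eq_mul]
        ring

lemma isContinuousCDF_Yof (hM : M.Intervention fD H πdot C) {π : ℝ → ℝ} (hπ : Measurable π)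
    (hπI : ∀ᵐ ω ∂M.P, π (M.D ω) ∈ M.suppD) :
    IsContinuousCDF fun y => ∫ ω, M.condF y (π (M.D ω)) (M.X ω) ∂M.P := by
  refine isContinuousCDF_integral (fun y => ?_) ?_
  · exact ((measurable_condF y).comp ((hπ.comp M.measurable_D).prodMk
      M.measurable_X)).aestronglyMeasurable
  · filter_upwards [hπI, ae_X_mem_suppX] with ω h1 h2 using hM.conditional.isContinuousCDF h1 h2

/-- The difference quotients of the counterfactual distribution functions converge uniformly to
`E[ρ(D) ∂_d F_{Y|D,X}(·|D, X)]`, which belongs to `C([-∞, ∞])`. -/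
theorem exists_tendsto_cdfL (hM : M.Intervention fD H πdot C) (hP : IsPerturbation H ℓ M.suppD)
    (hρ : Measurable ρ) (hℓ : ∀ᵐ s : ℝ, ℓ s = ρ s * fD s) :
    ∃ h ∈ contLimits, (∀ y, Integrable (fun ω => ρ (M.D ω) * M.dcondF y (M.D ω) (M.X ω)) M.P ∧
        h y = ∫ ω, ρ (M.D ω) * M.dcondF y (M.D ω) (M.X ω) ∂M.P) ∧
      Tendsto (fun t : ℝ => t⁻¹ • (cdfL M.P (M.Yof (M.policy H t)) - cdfL M.P M.Y)) (𝓝[>] 0)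
        (𝓝 h) := by
  obtain ⟨κ, hκ, hlaw⟩ := hM.exists_couplingDensity
  obtain ⟨L, hL, hL'⟩ := hM.exists_abs_dcondF_le
  have hci : ∀ y, (fun ω => ρ (M.D ω) * M.dcondFInt y (M.X ω, M.D ω)) =ᵐ[M.P]
      fun ω => ρ (M.D ω) * M.dcondF y (M.D ω) (M.X ω) := fun y => by
    filter_upwards [hM.ae_dcondFInt_eq y] with ω hω
    rw [hω]
  set w : (Fin k → ℝ) × ℝ → ℝ := fun p => ℓ p.2 * κ (p.1, H 0 p.2) with hw
  have hwi : Integrable w ((M.P.map M.X).prod volume) := integrable_limit_weight hκ hP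
  have hgm : ∀ y, AEStronglyMeasurable (M.dcondFInt y) ((M.P.map M.X).prod volume) := fun y =>
    (hM.measurable_dcondFInt y).aestronglyMeasurable
  have hgb : ∀ y p, |M.dcondFInt y p| ≤ L := abs_dcondFInt_le hL hL'
  -- The right-hand side is free of y, so L¹ convergence of the weights becomes convergence in the
  -- supremum norm.
  have hbound : ∀ y {u : (Fin k → ℝ) × ℝ → ℝ}, Integrable u ((M.P.map M.X).prod volume) →
      |∫ p, M.dcondFInt y p * u p ∂((M.P.map M.X).prod volume)| ≤
        L * ∫ p, |u p| ∂((M.P.map M.X).prod volume) := fun y u hu => by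
    rw [← integral_const_mul, ← Real.norm_eq_abs]
    refine norm_integral_le_of_norm_le (hu.abs.const_mul L) (Eventually.of_forall fun p => ?_)
    rw [norm_mul]
    exact mul_le_mul_of_nonneg_right (hgb y p) (norm_nonneg _)
  let h : LInf := ⟨fun y => ∫ p, M.dcondFInt y p * w p ∂((M.P.map M.X).prod volume),
    memℓp_infty ⟨L * ∫ p, |w p| ∂((M.P.map M.X).prod volume), by
      rintro _ ⟨y, rfl⟩
      exact hbound y hwi⟩⟩
  have hh : ∀ y, h y = ∫ p, M.dcondFInt y p * w p ∂((M.P.map M.X).prod volume) := fun _ => rfl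
  have hlim : Tendsto (fun t : ℝ => t⁻¹ • (cdfL M.P (M.Yof (M.policy H t)) - cdfL M.P M.Y))
      (𝓝[>] 0) (𝓝 h) := by
    rw [tendsto_iff_norm_sub_tendsto_zero]
    have h1 := (tendsto_integral_weight_sub hκ hP).const_mul L
    rw [mul_zero] at h1
    refine squeeze_zero' (Eventually.of_forall fun t => norm_nonneg _) ?_ h1
    filter_upwards [Ioc_mem_nhdsGT zero_lt_one] with t ht
    have hti := (integrable_weight hκ (hP.measurable t (Ioc_subset_Icc_self ht))
      (hP.measurable 0 (by simp)) (hP.lintegral_lt_top ht)).const_mul t⁻¹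
    refine LInf.norm_sub_le _ _ fun y => ?_
    have h2 : (t⁻¹ • (cdfL M.P (M.Yof (M.policy H t)) - cdfL M.P M.Y)) y =
        t⁻¹ * (cdfFun M.P (M.Yof (M.policy H t)) y - cdfFun M.P M.Y y) := rfl
    rw [h2, hh, hM.cdfFun_Yof_sub hP hκ hlaw ht, ← integral_const_mul]
    have h3 := hbound y (hti.sub hwi)
    rw [← integral_sub]
    · refine le_trans (le_of_eq ?_) h3
      congr 2 with p
      simp only [Pi.sub_apply]
      ring
    · have h4 := hti.bdd_mul (hgm y) (Eventually.of_forall (hgb y))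
      refine h4.congr (Eventually.of_forall fun p => ?_)
      simp only
      ring
    · exact hwi.bdd_mul (hgm y) (Eventually.of_forall (hgb y))
  refine ⟨h, ?_, fun y => ⟨(hM.integrable_rho_mul_dcondFInt hP hℓ y).congr (hci y), ?_⟩, hlim⟩
  -- Each difference quotient is a multiple of a difference of two continuous distribution
  -- functions.
  · refine isClosed_contLimits.mem_of_tendsto hlim ?_
    filter_upwards [Ioc_mem_nhdsGT zero_lt_one] with t ht
    have ht' := Ioc_subset_Icc_self ht
    refine contLimits.smul_mem _ (contLimits.sub_mem ?_ ?_)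
    · refine IsContinuousCDF.mem_contLimits ?_
      have : (cdfL M.P (M.Yof (M.policy H t)) : ℝ → ℝ) = fun y =>
          ∫ ω, M.condF y (quantileIoo (H t) (M.FD (M.D ω))) (M.X ω) ∂M.P :=
        funext fun y => hM.cdfFun_Yof_policy ht' y
      rw [this]
      exact hM.isContinuousCDF_Yof (hM.measurable_quantileIoo_FD ht') (hM.ae_quantileIoo_mem ht')
    · refine IsContinuousCDF.mem_contLimits ?_
      have : (cdfL M.P M.Y : ℝ → ℝ) = fun y => ∫ ω, M.condF y (M.D ω) (M.X ω) ∂M.P :=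
        funext fun y => hM.cdfFun_Y y
      rw [this]
      exact hM.isContinuousCDF_Yof (π := id) measurable_id ae_D_mem_suppD
  · rw [hh, ← integral_congr_ae (hci y), hM.integral_rho_mul_dcondFInt hP hκ hlaw hρ hℓ y]

end Intervention

/-- The functional delta method. -/
theorem isMPE_of_tendsto {B : Type*} [NormedAddCommGroup B] [NormedSpace ℝ B] {DΓ : Set LInf}
    {Γ : LInf → B} {D₀ : Submodule ℝ LInf} {Γ' : D₀ →L[ℝ] B}
    (hΓ : HasHadamardDerivAt DΓ Γ (cdfL M.P M.Y) D₀ Γ') {π : ℝ → ℝ → ℝ} (hdom : M.InDomain DΓ π)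
    (h : D₀) (hlim : Tendsto (fun t : ℝ => t⁻¹ • (cdfL M.P (M.Yof (π t)) - cdfL M.P M.Y))
      (𝓝[>] 0) (𝓝 (h : LInf))) : M.IsMPE Γ π (Γ' h) := by
  refine tendsto_of_seq_tendsto fun u hu => ?_
  have hu' : ∀ᶠ n in atTop, u n ∈ Ioc (0 : ℝ) 1 := hu.eventually (Ioc_mem_nhdsGT zero_lt_one)
  obtain ⟨N, hN⟩ := eventually_atTop.1 hu'
  rw [← tendsto_add_atTop_iff_nat N]
  have hv : ∀ n, u (n + N) ∈ Ioc (0 : ℝ) 1 := fun n => hN _ (by omega)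
  have hvlim : Tendsto (fun n => u (n + N)) atTop (𝓝[>] 0) := hu.comp (tendsto_add_atTop_nat N)
  -- Taking the difference quotients themselves as directions makes the perturbed point exactly
  -- F_{Y^t}, which lies in the domain.
  have heq : ∀ n, cdfL M.P M.Y + u (n + N) • ((u (n + N))⁻¹ •
      (cdfL M.P (M.Yof (π (u (n + N)))) - cdfL M.P M.Y)) = cdfL M.P (M.Yof (π (u (n + N)))) :=
    fun n => by rw [smul_inv_smul₀ (hv n).1.ne', add_sub_cancel]
  have := hΓ.2 h (fun n => u (n + N)) _ (fun n => (hv n).1)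
    (hvlim.mono_right nhdsWithin_le_nhds) (hlim.comp hvlim) fun n => by
      simp only [Function.comp_apply]
      rw [heq]
      exact hdom _ (Ioc_subset_Icc_self (hv n))
  simpa only [Function.comp_apply, heq] using this

end Model

end MPE

namespace MPE

/-! ### Distribution functions of signed measures -/

/-- Finite measures on `ℝᵏ` with the same distribution function at rational points are equal. -/
lemma Measure.ext_of_Iic_rat {k : ℕ} {μ ν : Measure (Fin k → ℝ)} [IsFiniteMeasure μ]
    (h : ∀ q : Fin k → ℚ, μ (Iic fun i => (q i : ℝ)) = ν (Iic fun i => (q i : ℝ))) : μ = ν := by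
  have hpi : ∀ q : Fin k → ℚ,
      (Iic fun i => (q i : ℝ)) = Set.univ.pi fun i => Iic (q i : ℝ) := fun q => by
    rw [pi_univ_Iic]
  refine Measure.ext_of_generateFrom_of_iUnion
    (Set.univ.pi '' Set.univ.pi fun _ : Fin k => ⋃ a : ℚ, {Iic (a : ℝ)})
    (fun n : ℕ => Iic fun _ => ((n : ℚ) : ℝ)) ?_ ?_ ?_ ?_ ?_ ?_
  · rw [← generateFrom_eq_pi (C := fun _ : Fin k => ⋃ a : ℚ, {Iic (a : ℝ)})
      (fun _ => (Real.borel_eq_generateFrom_Iic_rat.symm.trans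
        (BorelSpace.measurable_eq (α := ℝ)).symm)) fun _ => ?_]
    refine ⟨fun n : ℕ => Iic (((n : ℚ)) : ℝ), fun n => mem_iUnion.2 ⟨n, rfl⟩, ?_⟩
    refine eq_univ_of_forall fun x => ?_
    obtain ⟨n, hn⟩ := exists_nat_ge x
    exact mem_iUnion.2 ⟨n, by simpa using hn⟩
  · exact IsPiSystem.pi fun _ => Real.isPiSystem_Iic_rat
  · refine eq_univ_of_forall fun x => ?_
    obtain ⟨n, hn⟩ := exists_nat_ge (∑ i, |x i|)
    refine mem_iUnion.2 ⟨n, fun i => ?_⟩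
    have := Finset.single_le_sum (f := fun i => |x i|) (fun i _ => abs_nonneg _) (Finset.mem_univ i)
    simpa using (le_abs_self (x i)).trans (this.trans hn)
  · intro n
    refine ⟨fun _ => Iic ((n : ℚ) : ℝ), fun i _ => mem_iUnion.2 ⟨n, rfl⟩, ?_⟩
    rw [pi_univ_Iic]
  · exact fun n => measure_ne_top _ _
  · rintro _ ⟨s, hs, rfl⟩
    choose q hq using fun i => mem_iUnion.1 (hs i (mem_univ i))
    have : s = fun i => Iic (q i : ℝ) := funext fun i => hq i
    rw [this, pi_univ_Iic, h]

variable {k : ℕ}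

/-- For δ ≥ 0 the measures ν₁ and ν₂ + δ c agree at rational points, hence coincide; exchanging ν₁
and ν₂ settles the other sign. -/
lemma integral_sub_integral_eq_mul {ν₁ ν₂ c : Measure (Fin k → ℝ)} [IsFiniteMeasure ν₁]
    [IsFiniteMeasure ν₂] [IsFiniteMeasure c] {δ : ℝ}
    (h : ∀ q : Fin k → ℚ, ν₁.real (Iic fun i => (q i : ℝ)) - ν₂.real (Iic fun i => (q i : ℝ)) =
      c.real (Iic fun i => (q i : ℝ)) * δ)
    {u : (Fin k → ℝ) → ℝ} (hu : Measurable u) {R : ℝ} (hR : ∀ x, |u x| ≤ R) :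
    ∫ x, u x ∂ν₁ - ∫ x, u x ∂ν₂ = δ * ∫ x, u x ∂c := by
  wlog hδ : 0 ≤ δ generalizing ν₁ ν₂ δ
  · have := this (ν₁ := ν₂) (ν₂ := ν₁) (δ := -δ) (fun q => by linarith [h q]) (by linarith)
    linarith
  have hi : ∀ ν : Measure (Fin k → ℝ), IsFiniteMeasure ν → Integrable u ν := fun ν _ =>
    Integrable.mono' (integrable_const R) hu.aestronglyMeasurable (Eventually.of_forall hR)
  have hν : ν₁ = ν₂ + ENNReal.ofReal δ • c := by
    have := c.smul_finite (ENNReal.ofReal_ne_top (r := δ))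
    refine Measure.ext_of_Iic_rat fun q => ?_
    rw [← measureReal_eq_measureReal_iff (measure_ne_top _ _) (measure_ne_top _ _),
      measureReal_add_apply (measure_ne_top _ _) (measure_ne_top _ _),
      measureReal_ennreal_smul_apply,
      ENNReal.toReal_ofReal hδ]
    linarith [h q]
  rw [hν, integral_add_measure (hi _ inferInstance) ((hi c inferInstance).smul_measure
    ENNReal.ofReal_ne_top), integral_smul_measure, ENNReal.toReal_ofReal hδ, smul_eq_mul]
  ring

/-- Only countably many rational x matter, so a single null set of d serves every u. -/
lemma ae_setIntegral_sub_eq {μ₁ μ₂ : Measure (ℝ × (Fin k → ℝ))} [IsFiniteMeasure μ₁]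
    [IsFiniteMeasure μ₂] {c : ℝ → Measure (Fin k → ℝ)} (hc : ∀ d, IsFiniteMeasure (c d))
    {Δ : ℝ → ℝ}
    (h : ∀ x, ∀ᵐ d : ℝ, μ₁.real (Iic d ×ˢ Iic x) - μ₂.real (Iic d ×ˢ Iic x) =
      (c d).real (Iic x) * Δ d) :
    ∀ᵐ d : ℝ, ∀ u : (Fin k → ℝ) → ℝ, Measurable u → (∃ R, ∀ x, |u x| ≤ R) →
      ∫ p in Iic d ×ˢ univ, u p.2 ∂μ₁ - ∫ p in Iic d ×ˢ univ, u p.2 ∂μ₂ =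
        Δ d * ∫ x, u x ∂(c d) := by
  have h' : ∀ᵐ d : ℝ, ∀ q : Fin k → ℚ, μ₁.real (Iic d ×ˢ Iic fun i => (q i : ℝ)) -
      μ₂.real (Iic d ×ˢ Iic fun i => (q i : ℝ)) = (c d).real (Iic fun i => (q i : ℝ)) * Δ d :=
    ae_all_iff.2 fun q => h _
  filter_upwards [h'] with d hd u hu ⟨R, hR⟩
  have hap : ∀ (μ : Measure (ℝ × (Fin k → ℝ))) (q : Fin k → ℚ),
      ((μ.restrict (Iic d ×ˢ univ)).map Prod.snd).real (Iic fun i => (q i : ℝ)) =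
        μ.real (Iic d ×ˢ Iic fun i => (q i : ℝ)) := fun μ q => by
    rw [map_measureReal_apply measurable_snd measurableSet_Iic,
      measureReal_restrict_apply (measurable_snd measurableSet_Iic)]
    congr 1
    ext p
    simp only [mem_inter_iff, mem_preimage, mem_prod, mem_univ, and_true]
    exact and_comm
  have := integral_sub_integral_eq_mul (ν₁ := (μ₁.restrict (Iic d ×ˢ univ)).map Prod.snd)
    (ν₂ := (μ₂.restrict (Iic d ×ˢ univ)).map Prod.snd) (c := c d) (δ := Δ d)
    (fun q => by rw [hap, hap, hd]) hu hR
  rwa [integral_map measurable_snd.aemeasurable hu.aestronglyMeasurable,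
    integral_map measurable_snd.aemeasurable hu.aestronglyMeasurable] at this

lemma ae_real_Iic_prod_sub_eq {μ₁ μ₂ : Measure (ℝ × (Fin k → ℝ))} [IsFiniteMeasure μ₁]
    [IsFiniteMeasure μ₂] {c : ℝ → Measure (Fin k → ℝ)} (hc : ∀ d, IsFiniteMeasure (c d))
    {Δ : ℝ → ℝ}
    (h : ∀ x, ∀ᵐ d : ℝ, μ₁.real (Iic d ×ˢ Iic x) - μ₂.real (Iic d ×ˢ Iic x) =
      (c d).real (Iic x) * Δ d) :
    ∀ᵐ d : ℝ, ∀ A, MeasurableSet A →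
      μ₁.real (Iic d ×ˢ A) - μ₂.real (Iic d ×ˢ A) = Δ d * (c d).real A := by
  filter_upwards [ae_setIntegral_sub_eq hc h] with d hd A hA
  have hap : ∀ μ : Measure (ℝ × (Fin k → ℝ)),
      ∫ p in Iic d ×ˢ univ, A.indicator 1 p.2 ∂μ = μ.real (Iic d ×ˢ A) := fun μ => by
    have : ∀ p : ℝ × (Fin k → ℝ), A.indicator (1 : (Fin k → ℝ) → ℝ) p.2 =
        (Prod.snd ⁻¹' A).indicator 1 p := fun p => rfl
    simp only [this]
    rw [integral_indicator_one (measurable_snd hA),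
      measureReal_restrict_apply (measurable_snd hA)]
    congr 1
    ext p
    simp [and_comm]
  have := hd (A.indicator 1) (measurable_one.indicator hA) ⟨1, fun x => by
    by_cases hx : x ∈ A <;> simp [hx]⟩
  rwa [hap, hap, integral_indicator_one hA] at this

lemma tendsto_real_Iic_prod {μ : Measure (ℝ × (Fin k → ℝ))} [IsFiniteMeasure μ]
    {A : Set (Fin k → ℝ)} (hA : MeasurableSet A) (d : ℝ) :
    Tendsto (fun d' => μ.real (Iic d' ×ˢ A)) (𝓝[>] d) (𝓝 (μ.real (Iic d ×ˢ A))) := by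
  have h := tendsto_measure_biInter_gt (μ := μ) (s := fun d' => Iic d' ×ˢ A) (a := d)
    (fun r _ => (measurableSet_Iic.prod hA).nullMeasurableSet)
    (fun i j _ hij => prod_mono (Iic_subset_Iic.2 hij) subset_rfl)
    ⟨d + 1, by simp, measure_ne_top _ _⟩
  have h2 : (⋂ r > d, Iic r ×ˢ A) = Iic d ×ˢ A := by
    ext p
    simp only [mem_iInter, mem_prod, mem_Iic]
    refine ⟨fun hp => ⟨le_of_forall_gt_imp_ge_of_dense fun r hr => (hp r hr).1,
      (hp (d + 1) (by simp)).2⟩, fun hp r hr => ⟨hp.1.trans (le_of_lt hr), hp.2⟩⟩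
  rw [h2] at h
  exact (ENNReal.tendsto_toReal (measure_ne_top _ _)).comp h

/-- A set of full measure is dense, so d can be approached within it from the right, where
distribution functions are continuous. -/
lemma real_Iic_prod_eq_of_ae {μ₁ μ₂ : Measure (ℝ × (Fin k → ℝ))} [IsFiniteMeasure μ₁]
    [IsFiniteMeasure μ₂] {A : Set (Fin k → ℝ)} (hA : MeasurableSet A) {O : Set ℝ} (hO : IsOpen O)
    (h : ∀ᵐ d : ℝ, d ∈ O → μ₁.real (Iic d ×ˢ A) = μ₂.real (Iic d ×ˢ A)) {d : ℝ} (hd : d ∈ O) :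
    μ₁.real (Iic d ×ˢ A) = μ₂.real (Iic d ×ˢ A) := by
  set S := {d | d ∈ O → μ₁.real (Iic d ×ˢ A) = μ₂.real (Iic d ×ˢ A)}
  have hS : Dense S := Measure.dense_of_ae (μ := (volume : Measure ℝ)) h
  have hcl : d ∈ closure (Ioi d ∩ S) := by
    have := closure_mono (hS.open_subset_closure_inter (isOpen_Ioi (a := d)))
    rw [closure_closure, closure_Ioi] at this
    exact this self_mem_Ici
  have : (𝓝[Ioi d ∩ S] d).NeBot := mem_closure_iff_nhdsWithin_neBot.1 hcl
  have hle : 𝓝[Ioi d ∩ S] d ≤ 𝓝[>] d := nhdsWithin_mono _ inter_subset_left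
  refine tendsto_nhds_unique_of_eventuallyEq ((tendsto_real_Iic_prod hA d).mono_left hle)
    ((tendsto_real_Iic_prod hA d).mono_left hle) ?_
  filter_upwards [self_mem_nhdsWithin, nhdsWithin_le_nhds (hO.mem_nhds hd)] with e he heO
    using he.2 heO

/-- Where the distribution functions of two mutually singular measures agree, both vanish. -/
lemma measure_prod_eq_zero_of_mutuallySingular {μ₁ μ₂ : Measure (ℝ × (Fin k → ℝ))}
    [IsFiniteMeasure μ₁] [IsFiniteMeasure μ₂] (hs : μ₁ ⟂ₘ μ₂) {W : Set (Fin k → ℝ)}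
    (hW : MeasurableSet W) {O : Set ℝ} (hO : IsOpen O)
    (h : ∀ᵐ d : ℝ, d ∈ O → ∀ A ⊆ W, MeasurableSet A →
      μ₁.real (Iic d ×ˢ A) = μ₂.real (Iic d ×ˢ A)) :
    μ₁ (O ×ˢ W) = 0 ∧ μ₂ (O ×ˢ W) = 0 := by
  have key : ∀ p q : ℝ, Icc p q ⊆ O →
      μ₁ (Ioc p q ×ˢ W) = 0 ∧ μ₂ (Ioc p q ×ˢ W) = 0 := by
    intro p q hpq
    rcases lt_or_ge q p with hlt | hle
    · simp [Ioc_eq_empty_of_le hlt.le]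
    have hap : ∀ (μ : Measure (ℝ × (Fin k → ℝ))) [IsFiniteMeasure μ] (A : Set (Fin k → ℝ)),
        MeasurableSet A → ∀ a, p ≤ a → a ≤ q →
          μ.real (Ioc p a ×ˢ A) = μ.real (Iic a ×ˢ A) - μ.real (Iic p ×ˢ A) := by
      intro μ _ A hA a ha _
      rw [← measureReal_sdiff (prod_mono (Iic_subset_Iic.2 ha) subset_rfl)
        (measurableSet_Iic.prod hA)]
      congr 1
      ext r
      simp only [mem_prod, mem_Ioc, Set.mem_sdiff, mem_Iic, not_and]
      rw [← not_le]
      tauto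
    have heq : ∀ a, p ≤ a → a ≤ q → ∀ A ⊆ W, MeasurableSet A →
        μ₁.real (Ioc p a ×ˢ A) = μ₂.real (Ioc p a ×ˢ A) := by
      intro a h1 h2 A hAW hA
      have hae : ∀ᵐ d : ℝ, d ∈ O → μ₁.real (Iic d ×ˢ A) = μ₂.real (Iic d ×ˢ A) :=
        h.mono fun d hd hdO => hd hdO A hAW hA
      rw [hap μ₁ A hA a h1 h2, hap μ₂ A hA a h1 h2,
        real_Iic_prod_eq_of_ae hA hO hae (hpq ⟨h1, h2⟩),
        real_Iic_prod_eq_of_ae hA hO hae (hpq ⟨le_rfl, hle⟩)]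
    -- The restrictions agree on rectangles, hence are equal; being also mutually singular, they are
    -- zero.
    have hres : μ₁.restrict (Ioc p q ×ˢ W) = μ₂.restrict (Ioc p q ×ˢ W) := by
      refine Measure.ext_prod fun {s t} hs ht => ?_
      have hm : ∀ μ : Measure (ℝ × (Fin k → ℝ)), μ.restrict (Ioc p q ×ˢ W) (s ×ˢ t) =
          ((μ.restrict (Ioc p q ×ˢ (t ∩ W))).map Prod.fst) s := fun μ => by
        rw [Measure.map_apply measurable_fst hs, Measure.restrict_apply (hs.prod ht),
          Measure.restrict_apply (measurable_fst hs)]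
        congr 1
        ext r
        simp only [mem_prod, mem_inter_iff, mem_preimage]
        tauto
      rw [hm, hm]
      congr 1
      refine Measure.ext_of_Iic _ _ fun a => ?_
      have hm2 : ∀ μ : Measure (ℝ × (Fin k → ℝ)),
          ((μ.restrict (Ioc p q ×ˢ (t ∩ W))).map Prod.fst) (Iic a) =
            μ (Ioc p (min a q) ×ˢ (t ∩ W)) := fun μ => by
        rw [Measure.map_apply measurable_fst measurableSet_Iic,
          Measure.restrict_apply (measurable_fst measurableSet_Iic)]
        congr 1
        ext r
        simp only [mem_prod, mem_inter_iff, mem_preimage, mem_Iic, mem_Ioc, le_min_iff]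
        tauto
      rw [hm2, hm2]
      rcases lt_or_ge (min a q) p with hlt | hge
      · simp [Ioc_eq_empty_of_le hlt.le]
      · rw [← measureReal_eq_measureReal_iff]
        exact heq _ hge (min_le_right _ _) _ inter_subset_right (ht.inter hW)
    have h1 := hs.restrict (Ioc p q ×ˢ W)
    have h2 : μ₂.restrict (Ioc p q ×ˢ W) ⟂ₘ μ₁.restrict (Ioc p q ×ˢ W) :=
      (hs.symm.restrict (Ioc p q ×ˢ W)).mono_ac le_rfl.absolutelyContinuous
        Measure.restrict_le_self.absolutelyContinuous
    have h3 : μ₁.restrict (Ioc p q ×ˢ W) ⟂ₘ μ₁.restrict (Ioc p q ×ˢ W) := hres ▸ h2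
    have h4 := Measure.MutuallySingular.self_iff _ |>.1 h3
    have h5 : μ₂.restrict (Ioc p q ×ˢ W) = 0 := hres ▸ h4
    exact ⟨Measure.restrict_eq_zero.1 h4, Measure.restrict_eq_zero.1 h5⟩
  have hcov : O ×ˢ W ⊆ ⋃ r : {r : ℚ × ℚ // Icc (r.1 : ℝ) r.2 ⊆ O},
      Ioc (r.1.1 : ℝ) r.1.2 ×ˢ W := by
    rintro ⟨d, x⟩ ⟨hd, hx⟩
    obtain ⟨a, b, hab, hsub⟩ := mem_nhds_iff_exists_Ioo_subset.1 (hO.mem_nhds hd)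
    obtain ⟨p, hp1, hp2⟩ := exists_rat_btwn hab.1
    obtain ⟨q, hq1, hq2⟩ := exists_rat_btwn hab.2
    exact mem_iUnion.2 ⟨⟨(p, q), (Icc_subset_Ioo hp1 hq2).trans hsub⟩, ⟨hp2, hq1.le⟩, hx⟩
  exact ⟨measure_mono_null hcov (measure_iUnion_null fun r => (key _ _ r.2).1),
    measure_mono_null hcov (measure_iUnion_null fun r => (key _ _ r.2).2)⟩

lemma tendsto_real_Iic_prod_atTop {μ : Measure (ℝ × (Fin k → ℝ))} [IsFiniteMeasure μ]
    (A : Set (Fin k → ℝ)) :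
    Tendsto (fun d => μ.real (Iic d ×ˢ A)) atTop (𝓝 (μ.real (univ ×ˢ A))) := by
  have h := tendsto_measure_iUnion_atTop (μ := μ) (s := fun d : ℝ => Iic d ×ˢ A)
    fun a b hab => prod_mono (Iic_subset_Iic.2 hab) subset_rfl
  rw [← iUnion_prod_const, iUnion_Iic] at h
  exact (ENNReal.tendsto_toReal (measure_ne_top _ _)).comp h

/-- The difference on Iic d ×ˢ A is at most |Δ d|; let d tend to infinity through the set of full
measure. This cancels the boundary term in the integration by parts. -/
lemma map_snd_eq_of_ae {μ₁ μ₂ : Measure (ℝ × (Fin k → ℝ))} [IsFiniteMeasure μ₁]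
    [IsFiniteMeasure μ₂] {c : ℝ → Measure (Fin k → ℝ)} (hc : ∀ d, IsProbabilityMeasure (c d))
    {Δ : ℝ → ℝ} (hΔ : Tendsto Δ atTop (𝓝 0))
    (h : ∀ᵐ d : ℝ, ∀ A, MeasurableSet A →
      μ₁.real (Iic d ×ˢ A) - μ₂.real (Iic d ×ˢ A) = Δ d * (c d).real A) :
    μ₁.map Prod.snd = μ₂.map Prod.snd := by
  ext A hA
  rw [Measure.map_apply measurable_snd hA, Measure.map_apply measurable_snd hA,
    ← measureReal_eq_measureReal_iff, ← univ_prod, ← sub_eq_zero]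
  have h1 := (tendsto_real_Iic_prod_atTop (μ := μ₁) A).sub
    (tendsto_real_Iic_prod_atTop (μ := μ₂) A)
  have hfr : ∃ᶠ d : ℝ in atTop, |μ₁.real (Iic d ×ˢ A) - μ₂.real (Iic d ×ˢ A)| ≤ |Δ d| := by
    have hS := Measure.dense_of_ae (μ := (volume : Measure ℝ)) h
    refine frequently_atTop.2 fun a => ?_
    obtain ⟨d, hd, hdS⟩ := hS.exists_mem_open isOpen_Ioi (nonempty_Ioi (a := a))
    refine ⟨d, le_of_lt hdS, ?_⟩
    rw [hd A hA, abs_mul, abs_of_nonneg measureReal_nonneg]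
    exact mul_le_of_le_one_right (abs_nonneg _) measureReal_le_one
  have h2 := ge_of_tendsto_of_frequently (hΔ.abs.sub h1.abs)
    (hfr.mono fun d hd => sub_nonneg.2 hd)
  rw [abs_zero, zero_sub, neg_nonneg] at h2
  exact abs_nonpos_iff.1 h2

end MPE

/-! ### Integration by parts against the signed measure -/

namespace MPE

/-- The end points belong to S so that clamping to [a n, b n] never leaves supp D, where the
fundamental theorem of calculus is available. -/
lemma exists_exhausting_Icc {S : Set ℝ} (hS : IsClosed S) (hne : S.Nonempty) :
    ∃ a b : ℕ → ℝ, (∀ n, a n ∈ S ∧ b n ∈ S ∧ a n ≤ b n) ∧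
      ∀ d ∈ S, ∀ᶠ n in atTop, d ∈ Icc (a n) (b n) := by
  obtain ⟨d₀, hd₀⟩ := hne
  set K : ℕ → Set ℝ := fun n => S ∩ Icc (-(|d₀| + n)) (|d₀| + n) with hK
  have hKc : ∀ n, IsCompact (K n) := fun n => isCompact_Icc.inter_left hS
  have hmem : ∀ n : ℕ, ∀ d ∈ S, |d| ≤ |d₀| + n → d ∈ K n := fun n d hd h => ⟨hd, abs_le.1 h⟩
  have hKne : ∀ n, (K n).Nonempty := fun n => ⟨d₀, hmem n d₀ hd₀ (by simp)⟩
  have hIcc : ∀ n, ∀ d ∈ K n, d ∈ Icc (sInf (K n)) (sSup (K n)) := fun n d hd =>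
    ⟨csInf_le (hKc n).bddBelow hd, le_csSup (hKc n).bddAbove hd⟩
  refine ⟨fun n => sInf (K n), fun n => sSup (K n), fun n => ⟨((hKc n).sInf_mem (hKne n)).1,
    ((hKc n).sSup_mem (hKne n)).1, ?_⟩, fun d hd => ?_⟩
  · obtain ⟨d, hd⟩ := hKne n
    exact (hIcc n d hd).1.trans (hIcc n d hd).2
  · obtain ⟨N, hN⟩ := exists_nat_ge |d|
    filter_upwards [eventually_ge_atTop N] with n hn
    refine hIcc n d (hmem n d hd ?_)
    have : (N : ℝ) ≤ n := by exact_mod_cast hn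
    linarith [abs_nonneg d₀]

variable {k : ℕ}

open Classical in
lemma intervalIntegral_clamp_eq {a b : ℝ} (hab : a ≤ b) (d : ℝ) (g : ℝ → ℝ) :
    ∫ s in (max a (min b d))..b, g s = ∫ s in Ico a b, (if d ≤ s then 1 else 0) * g s := by
  rw [intervalIntegral.integral_of_le (max_le hab (min_le_left _ _)),
    ← integral_Ico_eq_integral_Ioc, ← integral_indicator measurableSet_Ico,
    ← integral_indicator measurableSet_Ico]
  congr with s
  have h : s ∈ Ico (max a (min b d)) b ↔ s ∈ Ico a b ∧ d ≤ s := by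
    simp only [mem_Ico, max_le_iff, min_le_iff]
    constructor
    · rintro ⟨⟨h1, h2⟩, h3⟩
      exact ⟨⟨h1, h3⟩, h2.resolve_left (not_le.2 h3)⟩
    · rintro ⟨⟨h1, h3⟩, h2⟩
      exact ⟨⟨h1, Or.inr h2⟩, h3⟩
  by_cases h1 : s ∈ Ico a b <;> by_cases h2 : d ≤ s <;>
    simp [indicator, -mem_Ico, h, h1, h2]

/-- Integration by parts for the increment of two measures with prescribed disintegration. -/
lemma integral_clamp_sub_integral_clamp {μ₁ μ₂ : Measure (ℝ × (Fin k → ℝ))} [IsFiniteMeasure μ₁]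
    [IsFiniteMeasure μ₂] {c : ℝ → Measure (Fin k → ℝ)} {Δ : ℝ → ℝ}
    (h : ∀ᵐ d : ℝ, ∀ u : (Fin k → ℝ) → ℝ, Measurable u → (∃ R, ∀ x, |u x| ≤ R) →
      ∫ p in Iic d ×ˢ univ, u p.2 ∂μ₁ - ∫ p in Iic d ×ˢ univ, u p.2 ∂μ₂ =
        Δ d * ∫ x, u x ∂(c d))
    (hμ : μ₁.map Prod.snd = μ₂.map Prod.snd) {v : (Fin k → ℝ) → ℝ} (hv : Measurable v)
    {R : ℝ} (hR : ∀ x, |v x| ≤ R) {g : (Fin k → ℝ) × ℝ → ℝ} (hg : Measurable g) {L : ℝ}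
    (hL : ∀ p, |g p| ≤ L) {a b : ℝ} (hab : a ≤ b) :
    ∫ p, (v p.2 - ∫ s in (max a (min b p.1))..b, g (p.2, s)) ∂μ₁ -
      ∫ p, (v p.2 - ∫ s in (max a (min b p.1))..b, g (p.2, s)) ∂μ₂ =
        -∫ s in Icc a b, Δ s * ∫ x, g (x, s) ∂(c s) := by
  classical
  simp only [intervalIntegral_clamp_eq hab]
  set G : (ℝ × (Fin k → ℝ)) × ℝ → ℝ := fun r => (if r.1.1 ≤ r.2 then 1 else 0) * g (r.1.2, r.2)
    with hG
  have hGm : Measurable G := (Measurable.ite (measurableSet_le (by fun_prop) (by fun_prop))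
    measurable_const measurable_const).mul (hg.comp (by fun_prop))
  have hGi : ∀ (μ : Measure (ℝ × (Fin k → ℝ))) [IsFiniteMeasure μ],
      Integrable G (μ.prod (volume.restrict (Ico a b))) := fun μ _ =>
    Integrable.mono' (integrable_const L) hGm.aestronglyMeasurable (Eventually.of_forall fun r => by
      by_cases hr : r.1.1 ≤ r.2
      · simpa [hG, hr] using hL _
      · simpa [hG, hr] using (abs_nonneg _).trans (hL (r.1.2, r.2)))
  have hone : ∀ (μ : Measure (ℝ × (Fin k → ℝ))) [IsFiniteMeasure μ],
      ∫ p, (v p.2 - ∫ s in Ico a b, G (p, s)) ∂μ =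
        ∫ x, v x ∂(μ.map Prod.snd) - ∫ s in Ico a b, ∫ p, G (p, s) ∂μ := fun μ _ => by
    have hvi : Integrable (fun p : ℝ × (Fin k → ℝ) => v p.2) μ :=
      Integrable.mono' (integrable_const R) (hv.comp measurable_snd).aestronglyMeasurable
        (Eventually.of_forall fun p => hR _)
    rw [integral_sub hvi (hGi μ).integral_prod_left,
      integral_map measurable_snd.aemeasurable hv.aestronglyMeasurable,
      integral_integral_swap (f := fun p s => G (p, s)) (hGi μ)]
  have hset : ∀ (μ : Measure (ℝ × (Fin k → ℝ))) (s : ℝ),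
      ∫ p, G (p, s) ∂μ = ∫ p in Iic s ×ˢ univ, g (p.2, s) ∂μ := fun μ s => by
    rw [← integral_indicator (measurableSet_Iic.prod MeasurableSet.univ)]
    congr with p
    by_cases hp : p.1 ≤ s <;> simp [hG, indicator, hp]
  change ∫ p, (v p.2 - ∫ s in Ico a b, G (p, s)) ∂μ₁ -
    ∫ p, (v p.2 - ∫ s in Ico a b, G (p, s)) ∂μ₂ = _
  -- The terms in v see only the second margins and cancel. For fixed s the remainder integrates
  -- g(·, s) over the points with d ≤ s, which is the case covered by `h`.
  rw [hone, hone, hμ, sub_sub_sub_cancel_left, integral_Icc_eq_integral_Ico, ← integral_sub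
    (hGi μ₂).integral_prod_right (hGi μ₁).integral_prod_right, ← integral_neg]
  refine integral_congr_ae (ae_restrict_of_ae ?_)
  filter_upwards [h] with s hs
  rw [hset, hset, ← hs (fun x => g (x, s)) (hg.comp (by fun_prop)) ⟨L, fun x => hL _⟩]
  ring

namespace Model

variable {Ω E : Type*} [MeasurableSpace Ω] [MeasurableSpace E] {M : Model Ω E k}
  {fD πdot : ℝ → ℝ} {H : ℝ → ℝ → ℝ} {C : ℝ → (Fin k → ℝ) → ℝ}

lemma compProd_condDistrib_eq (M : Model Ω E k) :
    (M.P.map M.D) ⊗ₘ condDistrib M.X M.D M.P = M.P.map fun ω => (M.D ω, M.X ω) :=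
  compProd_map_condDistrib M.measurable_X.aemeasurable

namespace Intervention

lemma ae_condDistrib_compl_suppX (hM : M.Intervention fD H πdot C) :
    ∀ᵐ d : ℝ, d ∈ M.suppD → condDistrib M.X M.D M.P d M.suppXᶜ = 0 := by
  refine hM.ae_of_ae_law ?_
  have h : ∀ᵐ p ∂((M.P.map M.D) ⊗ₘ condDistrib M.X M.D M.P), p.2 ∈ M.suppX := by
    rw [compProd_condDistrib_eq, ae_map_iff (p := fun p : ℝ × (Fin k → ℝ) => p.2 ∈ M.suppX)
      (M.measurable_D.prodMk M.measurable_X).aemeasurable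
      (measurable_snd isClosed_suppX.measurableSet)]
    exact ae_X_mem_suppX
  exact Measure.ae_ae_of_ae_compProd h

variable {μ₁ μ₂ : Measure (ℝ × (Fin k → ℝ))} [IsFiniteMeasure μ₁] [IsFiniteMeasure μ₂]
  {Δ ρ : ℝ → ℝ}

/-- Off supp D the factor Δ vanishes, and off supp X the conditional law of X given D does. There
the two distribution functions agree, and singularity kills both parts. Only on the supports is
F_{Y|D,X} known to be regular. -/
lemma ae_mem_supp_of_mutuallySingular (hM : M.Intervention fD H πdot C) (hs : μ₁ ⟂ₘ μ₂)
    (h : ∀ᵐ d : ℝ, ∀ A, MeasurableSet A → μ₁.real (Iic d ×ˢ A) - μ₂.real (Iic d ×ˢ A) =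
      Δ d * (condDistrib M.X M.D M.P d).real A)
    (hΔ : ∀ d ∉ M.suppD, Δ d = 0) :
    (∀ᵐ p ∂μ₁, p ∈ M.suppD ×ˢ M.suppX) ∧ ∀ᵐ p ∂μ₂, p ∈ M.suppD ×ˢ M.suppX := by
  have h1 := measure_prod_eq_zero_of_mutuallySingular hs MeasurableSet.univ
    (isClosed_suppD (M := M)).isOpen_compl (h.mono fun d hd hdO A _ hA => by
      rw [← sub_eq_zero, hd A hA, hΔ d hdO, zero_mul])
  have h2 := measure_prod_eq_zero_of_mutuallySingular hs
    (isClosed_suppX (M := M)).measurableSet.compl isOpen_univ (by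
      filter_upwards [h, hM.ae_condDistrib_compl_suppX] with d hd hX _ A hAX hA
      rw [← sub_eq_zero, hd A hA]
      by_cases hdD : d ∈ M.suppD
      · rw [measureReal_def, measure_mono_null hAX (hX hdD), ENNReal.toReal_zero, mul_zero]
      · rw [hΔ d hdD, zero_mul])
  have hsub : (M.suppD ×ˢ M.suppX)ᶜ ⊆ M.suppDᶜ ×ˢ univ ∪ univ ×ˢ M.suppXᶜ := fun p hp => by
    by_cases h : p.1 ∈ M.suppD
    · exact Or.inr ⟨mem_univ _, fun hx => hp ⟨h, hx⟩⟩
    · exact Or.inl ⟨h, mem_univ _⟩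
  exact ⟨measure_mono_null hsub (measure_union_null h1.1 h2.1),
    measure_mono_null hsub (measure_union_null h1.2 h2.2)⟩

/-- With d clamped to [a n, b n], F_{Y|D,X} is its value at b n minus an integral of its derivative,
and integration by parts applies; dominated convergence removes the clamp. Finally -Δ = ρ f_D
converts the Lebesgue integral into an expectation. -/
lemma integral_condF_sub_integral_condF (hM : M.Intervention fD H πdot C)
    (hμ : ∀ᵐ d : ℝ, ∀ u : (Fin k → ℝ) → ℝ, Measurable u → (∃ R, ∀ x, |u x| ≤ R) →
      ∫ p in Iic d ×ˢ univ, u p.2 ∂μ₁ - ∫ p in Iic d ×ˢ univ, u p.2 ∂μ₂ =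
        Δ d * ∫ x, u x ∂(condDistrib M.X M.D M.P d))
    (hsnd : μ₁.map Prod.snd = μ₂.map Prod.snd)
    (h₁ : ∀ᵐ p ∂μ₁, p ∈ M.suppD ×ˢ M.suppX) (h₂ : ∀ᵐ p ∂μ₂, p ∈ M.suppD ×ˢ M.suppX)
    (hΔi : Integrable Δ) (hΔ0 : ∀ d ∉ M.suppD, Δ d = 0)
    (hρm : Measurable ρ) (hρ : ∀ᵐ d : ℝ, -Δ d = ρ d * fD d) (y : ℝ)
    (hint : Integrable (fun ω => ρ (M.D ω) * M.dcondFInt y (M.X ω, M.D ω)) M.P) :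
    ∫ p, M.condF y p.1 p.2 ∂μ₁ - ∫ p, M.condF y p.1 p.2 ∂μ₂ =
      ∫ ω, ρ (M.D ω) * M.dcondFInt y (M.X ω, M.D ω) ∂M.P := by
  obtain ⟨L, hL, hL'⟩ := hM.exists_abs_dcondF_le
  have hgL := abs_dcondFInt_le (M := M) hL hL' y
  have hg := hM.measurable_dcondFInt y
  set Ψ : ℝ → ℝ := fun s => ∫ x, M.dcondFInt y (x, s) ∂(condDistrib M.X M.D M.P s) with hΨ
  have hΨm : StronglyMeasurable Ψ := StronglyMeasurable.integral_kernel_prod_right'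
    (κ := condDistrib M.X M.D M.P) (f := fun p => M.dcondFInt y (p.2, p.1))
    (hg.comp (by fun_prop)).stronglyMeasurable
  have hΨL : ∀ s, ‖Ψ s‖ ≤ L := fun s => by
    have := norm_integral_le_of_norm_le_const (μ := condDistrib M.X M.D M.P s)
      (f := fun x => M.dcondFInt y (x, s)) (Eventually.of_forall fun x => hgL (x, s))
    simpa using this
  have hΔΨ : Integrable (fun s => Δ s * Ψ s) :=
    hΔi.mul_bdd (c := L) hΨm.aestronglyMeasurable (Eventually.of_forall hΨL)
  obtain ⟨a, b, hab, hexh⟩ := exists_exhausting_Icc (isClosed_suppD (M := M)) hM.nonempty_suppD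
  have hFm : Measurable fun p : ℝ × (Fin k → ℝ) => M.condF y p.1 p.2 := measurable_condF y
  have hstep : ∀ n, ∫ p, M.condF y (max (a n) (min (b n) p.1)) p.2 ∂μ₁ -
      ∫ p, M.condF y (max (a n) (min (b n) p.1)) p.2 ∂μ₂ =
        -∫ s in Icc (a n) (b n), Δ s * Ψ s := fun n => by
    obtain ⟨ha, hb, hle⟩ := hab n
    have hcl : ∀ d, max (a n) (min (b n) d) ∈ M.suppD := fun d =>
      hM.ordConnected_suppD.out ha hb ⟨le_max_left _ _, max_le hle (min_le_left _ _)⟩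
    have key : ∀ p ∈ M.suppD ×ˢ M.suppX, M.condF y (max (a n) (min (b n) p.1)) p.2 =
        M.condF y (b n) p.2 - ∫ s in (max (a n) (min (b n) p.1))..(b n), M.dcondFInt y (p.2, s) :=
      fun p hp => by rw [← hM.condF_sub_condF y (hcl _) hb hp.2]; ring
    rw [integral_congr_ae (h₁.mono key), integral_congr_ae (h₂.mono key)]
    exact integral_clamp_sub_integral_clamp hμ hsnd
      (v := fun x => M.condF y (b n) x) (hFm.comp measurable_prodMk_left) (R := 1) (fun x => by
        rw [abs_of_nonneg (condF_nonneg _ _ _)]; exact condF_le_one _ _ _) hg hgL hle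
  have hlim : ∀ (μ : Measure (ℝ × (Fin k → ℝ))) [IsFiniteMeasure μ],
      (∀ᵐ p ∂μ, p ∈ M.suppD ×ˢ M.suppX) →
      Tendsto (fun n => ∫ p, M.condF y (max (a n) (min (b n) p.1)) p.2 ∂μ) atTop
        (𝓝 (∫ p, M.condF y p.1 p.2 ∂μ)) := fun μ _ hsupp => by
    refine tendsto_integral_of_dominated_convergence (fun _ => 1)
      (fun n => (hFm.comp (by fun_prop : Measurable fun p : ℝ × (Fin k → ℝ) =>
        (max (a n) (min (b n) p.1), p.2))).aestronglyMeasurable) (integrable_const 1)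
      (fun n => Eventually.of_forall fun p => ?_) ?_
    · rw [Real.norm_of_nonneg (condF_nonneg _ _ _)]; exact condF_le_one _ _ _
    · filter_upwards [hsupp] with p hp
      refine tendsto_const_nhds.congr' ?_
      filter_upwards [hexh p.1 hp.1] with n hn
      rw [min_eq_right hn.2, max_eq_right hn.1]
  have hlimR : Tendsto (fun n => -∫ s in Icc (a n) (b n), Δ s * Ψ s) atTop
      (𝓝 (-∫ s, Δ s * Ψ s)) := by
    simp only [← integral_indicator measurableSet_Icc]
    refine (tendsto_integral_of_dominated_convergence (fun s => ‖Δ s * Ψ s‖)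
      (fun n => hΔΨ.aestronglyMeasurable.indicator measurableSet_Icc) hΔΨ.norm
      (fun n => Eventually.of_forall fun s => norm_indicator_le_norm_self _ _)
      (Eventually.of_forall fun s => ?_)).neg
    by_cases hs : s ∈ M.suppD
    · refine tendsto_const_nhds.congr' ?_
      filter_upwards [hexh s hs] with n hn
      rw [indicator_of_mem hn]
    · simp [indicator, hΔ0 s hs]
  have h3 := tendsto_nhds_unique ((hlim μ₁ h₁).sub (hlim μ₂ h₂))
    (hlimR.congr fun n => (hstep n).symm)
  rw [h3, ← integral_neg]
  have hDX : Measurable fun ω => (M.D ω, M.X ω) := M.measurable_D.prodMk M.measurable_X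
  set F : ℝ × (Fin k → ℝ) → ℝ := fun p => ρ p.1 * M.dcondFInt y (p.2, p.1) with hF
  have hFm' : Measurable F := (hρm.comp measurable_fst).mul (hg.comp (by fun_prop))
  calc ∫ s, -(Δ s * Ψ s) = ∫ d, ρ d * Ψ d ∂(M.P.map M.D) := by
        rw [hM.density.law, integral_withDensity_eq_integral_toReal_smul
          hM.density.measurable.ennreal_ofReal (Eventually.of_forall fun _ => ENNReal.ofReal_lt_top)]
        refine integral_congr_ae ?_
        filter_upwards [hρ] with s hs
        rw [ENNReal.toReal_ofReal (hM.density.nonneg s), smul_eq_mul, ← neg_mul, hs]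
        ring
    _ = ∫ d, ∫ x, F (d, x) ∂(condDistrib M.X M.D M.P d) ∂(M.P.map M.D) := by
        simp only [hF, hΨ, integral_const_mul]
    _ = ∫ p, F p ∂((M.P.map M.D) ⊗ₘ condDistrib M.X M.D M.P) := by
        refine (Measure.integral_compProd ?_).symm
        rw [compProd_condDistrib_eq]
        exact (integrable_map_measure hFm'.aestronglyMeasurable hDX.aemeasurable).2 hint
    _ = ∫ ω, ρ (M.D ω) * M.dcondFInt y (M.X ω, M.D ω) ∂M.P := by
        rw [compProd_condDistrib_eq, integral_map hDX.aemeasurable hFm'.aestronglyMeasurable]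

/-- The derivative of the functional, applied to the mean response, is the integral of its value at
the conditional distribution functions against the signed measure generated by
`F_{X|D}(x|d) Δ(d)`. -/
theorem eqStieltjesIntegral (hM : M.Intervention fD H πdot C) {B : Type*} [NormedAddCommGroup B]
    [NormedSpace ℝ B] [CompleteSpace B] {D₀ : Submodule ℝ LInf} (hD₀ : ContainsContinuous D₀)
    (Γ' : D₀ →L[ℝ] B) (hΔi : Integrable Δ) (hΔ0 : ∀ d ∉ M.suppD, Δ d = 0)
    (hΔlim : Tendsto Δ atTop (𝓝 0)) (hρm : Measurable ρ) (hρ : ∀ᵐ d : ℝ, -Δ d = ρ d * fD d)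
    {h : LInf} (hh : h ∈ contLimits)
    (hval : ∀ y, Integrable (fun ω => ρ (M.D ω) * M.dcondF y (M.D ω) (M.X ω)) M.P ∧
      h y = ∫ ω, ρ (M.D ω) * M.dcondF y (M.D ω) (M.X ω) ∂M.P)
    {K : ℝ → (Fin k → ℝ) → ℝ} (hK : ∀ x, ∀ᵐ d : ℝ, K d x = M.FXgivenD x d * Δ d) :
    M.EqStieltjesIntegral Γ' K (Γ' ⟨h, hD₀.contLimits_le hh⟩) := by
  classical
  intro μ hμ
  set μ₁ := μ.toJordanDecomposition.posPart with hμ₁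
  set μ₂ := μ.toJordanDecomposition.negPart with hμ₂
  have hS : ∀ x, ∀ᵐ d : ℝ, μ₁.real (Iic d ×ˢ Iic x) - μ₂.real (Iic d ×ˢ Iic x) =
      (condDistrib M.X M.D M.P d).real (Iic x) * Δ d := fun x => by
    filter_upwards [hμ x, hK x] with d h1 h2
    rw [hμ₁, hμ₂, ← μ.apply_eq_posPart_real_sub_negPart_real
      (measurableSet_Iic.prod measurableSet_Iic), h1, h2]
    rfl
  have hu := ae_setIntegral_sub_eq (fun d => inferInstance) hS
  have hA := ae_real_Iic_prod_sub_eq (fun d => inferInstance) hS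
  have hsnd := map_snd_eq_of_ae (fun d => inferInstance) hΔlim hA
  obtain ⟨h₁, h₂⟩ := hM.ae_mem_supp_of_mutuallySingular
    μ.toJordanDecomposition.mutuallySingular hA hΔ0
  obtain ⟨d₀, hd₀⟩ := hM.nonempty_suppD
  have hX : M.suppX.Nonempty := by
    obtain ⟨ω, hω⟩ := (ae_X_mem_suppX (M := M)).exists
    exact ⟨_, hω⟩
  obtain ⟨x₀, hx₀⟩ := hX
  -- Off the supports, a null set for both Jordan parts, a fixed distribution function is
  -- substituted, so that Φ takes values in C([-∞, ∞]) everywhere.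
  set Φ : ℝ × (Fin k → ℝ) → LInf := fun p =>
    if p ∈ M.suppD ×ˢ M.suppX then M.condFL p.1 p.2 else M.condFL d₀ x₀ with hΦ
  have hΦc : ∀ p, IsContinuousCDF (Φ p) := fun p => by
    by_cases hp : p ∈ M.suppD ×ˢ M.suppX
    · simpa only [hΦ, if_pos hp] using hM.conditional.isContinuousCDF hp.1 hp.2
    · simpa only [hΦ, if_neg hp] using hM.conditional.isContinuousCDF hd₀ hx₀
  have hSm : MeasurableSet (M.suppD ×ˢ M.suppX) :=
    isClosed_suppD.measurableSet.prod isClosed_suppX.measurableSet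
  have hΦm : StronglyMeasurable Φ := by
    refine stronglyMeasurable_of_isContinuousCDF hΦc fun y => ?_
    have : (fun p => Φ p y) = fun p : ℝ × (Fin k → ℝ) =>
        if p ∈ M.suppD ×ˢ M.suppX then M.condF y p.1 p.2 else M.condF y d₀ x₀ := by
      ext p
      by_cases hp : p ∈ M.suppD ×ˢ M.suppX
      · simp only [hΦ, if_pos hp]; rfl
      · simp only [hΦ, if_neg hp]; rfl
    rw [this]
    exact Measurable.ite hSm (measurable_condF y) measurable_const
  -- D₀ need not be complete, so the Bochner integrals are taken in `contLimits`.
  set Φc : ℝ × (Fin k → ℝ) → contLimits := fun p => ⟨Φ p, (hΦc p).mem_contLimits⟩ with hΦc'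
  have hΦi : ∀ (ν : Measure (ℝ × (Fin k → ℝ))) [IsFiniteMeasure ν], Integrable Φc ν := fun ν _ => by
    refine Integrable.mono' (integrable_const 1)
      (IsEmbedding.subtypeVal.aestronglyMeasurable_comp_iff.1 hΦm.aestronglyMeasurable)
      (Eventually.of_forall fun p => ?_)
    have := LInf.norm_sub_le (Φ p) 0 (C := 1) fun y => by
      rw [show (0 : LInf) y = 0 from rfl, sub_zero, abs_of_nonneg ((hΦc p).nonneg y)]
      exact (hΦc p).le_one y
    rwa [sub_zero] at this
  set Γc : contLimits →L[ℝ] B :=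
    Γ'.comp ⟨Submodule.inclusion hD₀.contLimits_le, by
      exact continuous_inclusion hD₀.contLimits_le⟩ with hΓc
  have hap : ∀ p ∈ M.suppD ×ˢ M.suppX, applyOn Γ' (M.condFL p.1 p.2) = Γc (Φc p) := fun p hp => by
    have hmem : M.condFL p.1 p.2 ∈ D₀ :=
      hD₀.contLimits_le (hM.conditional.isContinuousCDF hp.1 hp.2).mem_contLimits
    have hval : Φ p = M.condFL p.1 p.2 := if_pos hp
    rw [applyOn, dif_pos hmem]
    refine congrArg Γ' (Subtype.ext ?_)
    exact hval.symm
  have hae₁ : (fun p => applyOn Γ' (M.condFL p.1 p.2)) =ᵐ[μ₁] fun p => Γc (Φc p) := h₁.mono hap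
  have hae₂ : (fun p => applyOn Γ' (M.condFL p.1 p.2)) =ᵐ[μ₂] fun p => Γc (Φc p) := h₂.mono hap
  have hi₁ : Integrable (fun p => applyOn Γ' (M.condFL p.1 p.2)) μ₁ :=
    (Γc.integrable_comp (hΦi μ₁)).congr hae₁.symm
  have hi₂ : Integrable (fun p => applyOn Γ' (M.condFL p.1 p.2)) μ₂ :=
    (Γc.integrable_comp (hΦi μ₂)).congr hae₂.symm
  -- Evaluation at y is a continuous linear functional, so the vector identity reduces to the scalar
  -- one for each y.
  have hmean : (⟨h, hh⟩ : contLimits) = ∫ p, Φc p ∂μ₁ - ∫ p, Φc p ∂μ₂ := by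
    refine Subtype.ext (lp.ext (funext fun y => ?_))
    set e : contLimits →L[ℝ] ℝ :=
      (lp.evalCLM ℝ (fun _ : ℝ => ℝ) ⊤ y).comp contLimits.subtypeL with he
    change e ⟨h, hh⟩ = e (∫ p, Φc p ∂μ₁ - ∫ p, Φc p ∂μ₂)
    rw [map_sub, ← e.integral_comp_comm (hΦi μ₁), ← e.integral_comp_comm (hΦi μ₂)]
    have hev : ∀ p ∈ M.suppD ×ˢ M.suppX, e (Φc p) = M.condF y p.1 p.2 := fun p hp => by
      have : Φ p = M.condFL p.1 p.2 := if_pos hp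
      change Φ p y = _
      rw [this]; rfl
    rw [integral_congr_ae (h₁.mono hev), integral_congr_ae (h₂.mono hev)]
    have hci : (fun ω => ρ (M.D ω) * M.dcondFInt y (M.X ω, M.D ω)) =ᵐ[M.P]
        fun ω => ρ (M.D ω) * M.dcondF y (M.D ω) (M.X ω) := by
      filter_upwards [hM.ae_dcondFInt_eq y] with ω hω
      rw [hω]
    rw [hM.integral_condF_sub_integral_condF hu hsnd h₁ h₂ hΔi hΔ0 hρm hρ y
      ((hval y).1.congr hci.symm), integral_congr_ae hci, ← (hval y).2]
    rfl
  have hμeq : μ = μ₁.toSignedMeasure - μ₂.toSignedMeasure :=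
    μ.toSignedMeasure_toJordanDecomposition.symm
  refine ⟨?_, ?_⟩
  · rw [VectorMeasure.Integrable, ← SignedMeasure.totalVariation_eq_variation]
    exact hi₁.add_measure hi₂
  · have hv₁ : μ₁.toSignedMeasure.Integrable fun p => applyOn Γ' (M.condFL p.1 p.2) := by
      rwa [VectorMeasure.Integrable, Measure.variation_toSignedMeasure]
    have hv₂ : μ₂.toSignedMeasure.Integrable fun p => applyOn Γ' (M.condFL p.1 p.2) := by
      rwa [VectorMeasure.Integrable, Measure.variation_toSignedMeasure]
    have hΓh : Γ' ⟨h, hD₀.contLimits_le hh⟩ = Γc ⟨h, hh⟩ := rfl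
    rw [hμeq, VectorMeasure.integral_sub_vectorMeasure hv₁ hv₂,
      VectorMeasure.integral_toSignedMeasure, VectorMeasure.integral_toSignedMeasure,
      integral_congr_ae hae₁, integral_congr_ae hae₂, Γc.integral_comp_comm (hΦi μ₁),
      Γc.integral_comp_comm (hΦi μ₂), ← map_sub, ← hmean, hΓh]

end Intervention

end Model

end MPE

/-! ### Derivatives of the policy function and the copula, and the two interventions -/

namespace MPE

lemma ae_hasDerivAt_integral_Iic {f : ℝ → ℝ} (hf : Integrable f) :
    ∀ᵐ d : ℝ, HasDerivAt (fun d => ∫ r in Iic d, f r) (f d) d := by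
  filter_upwards [LocallyIntegrable.ae_hasDerivAt_integral hf.locallyIntegrable] with d hd
  have h : (fun d => ∫ r in Iic d, f r) =
      fun d => (∫ r in (0 : ℝ)..d, f r) + ∫ r in Iic 0, f r := by
    ext d
    rw [intervalIntegral.integral_Iic_sub_Iic hf.integrableOn hf.integrableOn |>.symm]
    ring
  rw [h]
  exact (hd 0).add_const _

/-- The difference quotient of t φ(t) at 0 is φ(t) itself, so continuity of φ is enough; this spares
any differentiability of G. -/
lemma hasDerivWithinAt_self_mul {s : Set ℝ} {φ : ℝ → ℝ} (hφ : ContinuousWithinAt φ s 0) :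
    HasDerivWithinAt (fun t => t * φ t) (φ 0) s 0 := by
  rw [hasDerivWithinAt_iff_tendsto_slope]
  refine (hφ.mono sdiff_subset).congr' ?_
  filter_upwards [self_mem_nhdsWithin] with t ht
  have : t ≠ 0 := ht.2
  rw [slope_def_field]
  field_simp
  ring

namespace Model

variable {Ω E : Type*} [MeasurableSpace Ω] [MeasurableSpace E] {k : ℕ} {M : Model Ω E k}
  {fD πdot : ℝ → ℝ} {H : ℝ → ℝ → ℝ} {C : ℝ → (Fin k → ℝ) → ℝ}

lemma HasDensityD.FD_eq_integral (h : M.HasDensityD fD) (d : ℝ) :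
    M.FD d = ∫ r in Iic d, fD r := by
  rw [FD_eq, measureReal_def, h.law, withDensity_apply _ measurableSet_Iic,
    integral_eq_lintegral_of_nonneg_ae (Eventually.of_forall h.nonneg)
      h.measurable.aestronglyMeasurable]

lemma HasDensityD.ae_hasDerivAt_FD (h : M.HasDensityD fD) :
    ∀ᵐ d : ℝ, HasDerivAt M.FD (fD d) d := by
  rw [funext h.FD_eq_integral]
  exact ae_hasDerivAt_integral_Iic h.integrable

lemma FX_mem (M : Model Ω E k) (x : Fin k → ℝ) (i : Fin k) : M.FX x i ∈ Icc (0 : ℝ) 1 :=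
  ⟨measureReal_nonneg, measureReal_le_one⟩

namespace Intervention

/-! ### The policy function -/

lemma apply_policy (hM : M.Intervention fD H πdot C) {t d : ℝ} (ht : t ∈ Icc (0 : ℝ) 1)
    (hd : 0 < M.FD d) : H t (M.policy H t d) = M.FD d := by
  refine (hM.cdf t ht).apply_quantile_of_exists hd ?_
  rcases (hM.density.isContinuousCDF.le_one d).lt_or_eq with h | h
  · exact (hM.cdf t ht).exists_eq ⟨hd, h⟩
  · exact ⟨d, by rw [h, hM.apply_eq_one ht h]⟩

/-- F_D is differentiated only relative to its support, so the path t ↦ π_t(d) has to stay there. It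
cannot pass the right end, beyond which H_t is already 1. -/
lemma policy_mem (hM : M.Intervention fD H πdot C) {t d : ℝ} (ht : t ∈ Icc (0 : ℝ) 1)
    (hd : 0 < M.FD d) : M.policy H t d ∈ M.suppD := by
  by_contra h
  have hz := hM.apply_policy ht hd
  rcases hM.lt_or_lt_of_notMem h with h1 | h1
  · rw [hM.apply_eq_zero_of_lt ht h1] at hz
    exact hd.ne hz
  · have hbdd : BddAbove M.suppD := ⟨_, fun s hs => (h1 s hs).le⟩
    obtain ⟨z, hz1, hz2⟩ := exists_between
      (h1 _ (isClosed_suppD.csSup_mem hM.nonempty_suppD hbdd))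
    have hone := hM.apply_eq_one_of_lt ht fun s hs => (le_csSup hbdd hs).trans_lt hz1
    have : M.policy H t d ≤ z := (hM.cdf t ht).quantile_le hd
      (hone ▸ hM.density.isContinuousCDF.le_one d)
    exact absurd hz2 (not_lt.2 this)

/-- Where `F_D` is differentiable along its support, the derivative of the policy function is
determined by the implicit equation `H_t(π_t(d)) = F_D(d)`. -/
lemma mul_pidot_eq {G : ℝ → ℝ} (hM : M.Intervention fD (M.mixture G) πdot C)
    (hG : Continuous G) {d : ℝ} (hd : d ∈ M.suppD) (hd0 : 0 < M.FD d)
    (hder : HasDerivWithinAt M.FD (fD d) M.suppD d) :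
    fD d * πdot d = -(G d - M.FD d) := by
  have hF := hM.density.isContinuousCDF
  have hπ := hM.structural.policy_deriv d hd hd0
  have hπ0 := hM.structural.policy_zero d hd hd0
  have h0 : (0 : ℝ) ∈ Icc (0 : ℝ) 1 := by simp
  have h1 : HasDerivWithinAt (fun t => M.FD (M.policy (M.mixture G) t d)) (fD d * πdot d)
      (Icc 0 1) 0 := by
    refine HasDerivWithinAt.comp (h₂ := M.FD) (s' := M.suppD) 0 ?_ hπ
      fun t ht => hM.policy_mem ht hd0
    rwa [hπ0]
  -- The implicit equation becomes F_D(π_t(d)) = F_D(d) - t φ(t).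
  set φ : ℝ → ℝ := fun t => G (M.policy (M.mixture G) t d) - M.FD (M.policy (M.mixture G) t d)
  have hφ : ContinuousWithinAt φ (Icc 0 1) 0 :=
    ((hG.sub hF.cont).continuousAt.comp_continuousWithinAt hπ.continuousWithinAt)
  have h2 : HasDerivWithinAt (fun t => M.FD (M.policy (M.mixture G) t d)) (-φ 0) (Icc 0 1) 0 := by
    refine ((hasDerivWithinAt_self_mul hφ).const_sub (M.FD d)).congr_of_mem (fun t ht => ?_) h0
    have := hM.apply_policy ht hd0
    simp only [mixture] at this
    simp only [φ]
    linarith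
  have h3 := (uniqueDiffOn_Icc (zero_lt_one (α := ℝ)) 0 h0).eq_deriv _ h1 h2
  rw [h3]
  simp only [φ, hπ0]

/-! ### The copula -/

/-- The copula relation at t = 0, where D^0 = D almost surely, disintegrated along the law of D. -/
lemma copula_eq_integral (hM : M.Intervention fD H πdot C) (x : Fin k → ℝ) (d : ℝ) :
    C (M.FD d) (M.FX x) = ∫ r in Iic d, M.FXgivenD x r * fD r := by
  have h0 : (0 : ℝ) ∈ Icc (0 : ℝ) 1 := by simp
  have hae : ∀ᵐ ω ∂M.P, M.policy H 0 (M.D ω) = M.D ω := by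
    filter_upwards [ae_D_mem_suppD, hM.density.ae_FD_D_mem] with ω h1 h2
      using hM.structural.policy_zero _ h1 h2.1
  have hcop := (hM.rank.copula 0 h0).2 d x
  have e1 : cdfFun M.P (fun ω => M.policy H 0 (M.D ω)) d = M.FD d := by
    refine measureReal_congr ?_
    filter_upwards [hae] with ω hω
    exact congrArg (· ≤ d) hω
  have e2 : M.P.real {ω | M.policy H 0 (M.D ω) ≤ d ∧ M.X ω ≤ x} =
      (M.P.map fun ω => (M.D ω, M.X ω)).real (Iic d ×ˢ Iic x) := by
    rw [map_measureReal_apply (M.measurable_D.prodMk M.measurable_X)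
      (measurableSet_Iic.prod measurableSet_Iic)]
    refine measureReal_congr ?_
    filter_upwards [hae] with ω hω
    exact congrArg (fun z => z ≤ d ∧ M.X ω ≤ x) hω
  rw [e1, e2] at hcop
  change C (M.FD d) (fun i => cdfFun M.P (fun ω => M.X ω i) (x i)) = _
  have hc : Measurable fun r => M.FXgivenD x r :=
    ((condDistrib M.X M.D M.P).measurable_coe measurableSet_Iic).ennreal_toReal
  rw [← hcop, measureReal_def, ← compProd_condDistrib_eq, Measure.compProd_apply_prod
    measurableSet_Iic measurableSet_Iic]
  have e3 : ∫ r in Iic d, M.FXgivenD x r ∂(M.P.map M.D) =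
      (∫⁻ r in Iic d, condDistrib M.X M.D M.P r (Iic x) ∂(M.P.map M.D)).toReal := by
    have hc0 : 0 ≤ᵐ[(M.P.map M.D).restrict (Iic d)] fun r => M.FXgivenD x r :=
      Eventually.of_forall fun _ => measureReal_nonneg
    rw [integral_eq_lintegral_of_nonneg_ae hc0 hc.aestronglyMeasurable]
    exact congrArg _ (lintegral_congr fun r => ofReal_measureReal)
  rw [← e3, hM.density.law, setIntegral_withDensity_eq_setIntegral_toReal_smul
    hM.density.measurable.ennreal_ofReal (Eventually.of_forall fun _ => ENNReal.ofReal_lt_top) _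
    measurableSet_Iic]
  congr with r
  rw [ENNReal.toReal_ofReal (hM.density.nonneg r), smul_eq_mul, mul_comm]

lemma ae_hasDerivAt_copula (hM : M.Intervention fD H πdot C) (x : Fin k → ℝ) :
    ∀ᵐ d : ℝ, HasDerivAt (fun d => C (M.FD d) (M.FX x)) (M.FXgivenD x d * fD d) d := by
  simp only [hM.copula_eq_integral x]
  refine ae_hasDerivAt_integral_Iic (hM.density.integrable.bdd_mul (c := 1) ?_
    (Eventually.of_forall fun r => ?_))
  · exact ((condDistrib M.X M.D M.P).measurable_coe
      measurableSet_Iic).ennreal_toReal.aestronglyMeasurable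
  · rw [FXgivenD, Real.norm_of_nonneg measureReal_nonneg]
    exact measureReal_le_one

variable {G : ℝ → ℝ}

lemma hasDerivWithinAt_copula (hM : M.Intervention fD (M.mixture G) πdot C) {d : ℝ}
    (hd : M.FD d ∈ Ioo (0 : ℝ) 1) (x : Fin k → ℝ) :
    HasDerivWithinAt (fun t => C (M.mixture G t d) (M.FX x))
      (deriv (fun u => C u (M.FX x)) (M.FD d) * (G d - M.FD d)) (Icc 0 1) 0 := by
  have h1 : HasDerivAt (fun t => M.mixture G t d) (G d - M.FD d) 0 := by
    simpa [mixture] using ((hasDerivAt_id (0 : ℝ)).mul_const (G d - M.FD d)).const_add (M.FD d)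
  have h2 := (hM.rank.copula_diff _ hd (M.FX x) (M.FX_mem x)).hasDerivAt
  refine (HasDerivAt.comp (h₂ := fun u => C u (M.FX x)) 0 ?_ h1).hasDerivWithinAt
  simpa [mixture] using h2

/-- C is differentiable only at ranks in (0, 1), but where F_D(d) is 0 or 1 the value H_t(d) does
not depend on t. -/
lemma differentiableWithinAt_copula (hM : M.Intervention fD (M.mixture G) πdot C) (d : ℝ)
    (x : Fin k → ℝ) :
    DifferentiableWithinAt ℝ (fun t => C (M.mixture G t d) (M.FX x)) (Icc 0 1) 0 := by
  have hF := hM.density.isContinuousCDF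
  have hconst : ∀ c : ℝ, (∀ t ∈ Icc (0 : ℝ) 1, M.mixture G t d = c) →
      DifferentiableWithinAt ℝ (fun t => C (M.mixture G t d) (M.FX x)) (Icc 0 1) 0 := fun c hc =>
    DifferentiableWithinAt.congr (f := fun _ => C c (M.FX x)) (differentiableWithinAt_const _)
      (fun t ht => by rw [hc t ht]) (by rw [hc 0 (by simp)])
  rcases (hF.nonneg d).eq_or_lt with h | h
  · exact hconst 0 fun t ht => hM.apply_eq_zero ht h.symm
  rcases (hF.le_one d).eq_or_lt with h' | h'
  · exact hconst 1 fun t ht => hM.apply_eq_one ht h'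
  · exact (hM.hasDerivWithinAt_copula ⟨h, h'⟩ x).differentiableWithinAt

lemma G_eq_of_notMem (hM : M.Intervention fD (M.mixture G) πdot C) {d : ℝ} (hd : d ∉ M.suppD) :
    G d = M.FD d := by
  simpa [mixture] using hM.apply_eq_of_notMem (t := 1) (by simp) hd

/-- Differentiating C(F_D(d), F_X(x)) in d, by the chain rule and by the integral formula, gives ∂₁C
· f_D = F_{X|D} · f_D at almost every d in the support, and f_D > 0 cancels. Off the support G = F_D
and both sides are 0. -/
lemma ae_derivWithin_copula (hM : M.Intervention fD (M.mixture G) πdot C) (x : Fin k → ℝ) :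
    ∀ᵐ d : ℝ, derivWithin (fun t => C (M.mixture G t d) (M.FX x)) (Icc 0 1) 0 =
      M.FXgivenD x d * (G d - M.FD d) := by
  filter_upwards [hM.ae_hasDerivAt_copula x, hM.density.ae_hasDerivAt_FD,
    hM.ae_of_ae_law hM.density.ae_FD_mem] with d h1 h2 h3
  by_cases hd : d ∈ M.suppD
  · have hu := h3 hd
    have hpos := hM.rank.fD_pos d hd
    rw [(hM.hasDerivWithinAt_copula hu x).derivWithin (uniqueDiffOn_Icc zero_lt_one 0 (by simp))]
    have h4 : HasDerivAt (fun d => C (M.FD d) (M.FX x))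
        (deriv (fun u => C u (M.FX x)) (M.FD d) * fD d) d :=
      HasDerivAt.comp (h₂ := fun u => C u (M.FX x)) d
        (hM.rank.copula_diff _ hu (M.FX x) (M.FX_mem x)).hasDerivAt h2
    rw [mul_right_cancel₀ hpos.ne' (h4.unique h1)]
  · have h : (fun t => C (M.mixture G t d) (M.FX x)) = fun _ => C (M.FD d) (M.FX x) := by
      ext t
      rw [mixture, hM.G_eq_of_notMem hd]
      simp
    rw [h, hM.G_eq_of_notMem hd]
    simp

end Intervention

/-! ### Marginal perturbations -/

lemma Assumptions.intervention_mixture {G : ℝ → ℝ} (hA : M.Assumptions fD (M.mixture G) πdot C)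
    {γ : Measure ℝ} [IsProbabilityMeasure γ] (hG : ∀ d, G d = γ.real (Iic d)) :
    M.Intervention fD (M.mixture G) πdot C := by
  have hF := hA.density.isContinuousCDF
  have hGc : G = cdf γ := funext fun d => by rw [hG, cdf_eq_real]
  refine { hA with
    zero := by ext d; simp [mixture]
    cdf := fun t ht => ⟨fun y z hyz => ?_, hA.rank.continuous_H t ht, ?_, ?_⟩ }
  · have h1 : G y ≤ G z := hGc ▸ monotone_cdf γ hyz
    have h2 := hF.mono hyz
    simp only [mixture]
    nlinarith [mul_le_mul_of_nonneg_left h1 ht.1,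
      mul_le_mul_of_nonneg_left h2 (sub_nonneg.2 ht.2)]
  · have h1 : Tendsto G atBot (𝓝 0) := hGc ▸ tendsto_cdf_atBot γ
    have h2 := hF.bot.add ((h1.sub hF.bot).const_mul t)
    rwa [sub_zero, mul_zero, add_zero] at h2
  · have h1 : Tendsto G atTop (𝓝 1) := hGc ▸ tendsto_cdf_atTop γ
    have h2 := hF.top.add ((h1.sub hF.top).const_mul t)
    rwa [sub_self, mul_zero, add_zero] at h2

namespace Intervention

variable {G : ℝ → ℝ}

lemma isContinuousCDF_of_mixture (hM : M.Intervention fD (M.mixture G) πdot C) :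
    IsContinuousCDF G := by
  have : G = M.mixture G 1 := by ext d; simp [mixture]
  rw [this]
  exact hM.cdf 1 (by simp)

lemma pidot_eq (hM : M.Intervention fD (M.mixture G) πdot C) {d : ℝ} (hd : d ∈ M.suppD)
    (hd0 : 0 < M.FD d) (hder : HasDerivWithinAt M.FD (fD d) M.suppD d) :
    πdot d = -(G d - M.FD d) / fD d := by
  rw [eq_div_iff (hM.rank.fD_pos d hd).ne', mul_comm]
  exact hM.mul_pidot_eq hM.isContinuousCDF_of_mixture.cont hd hd0 hder

lemma ae_pidot_eq (hM : M.Intervention fD (M.mixture G) πdot C) :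
    ∀ᵐ d ∂(M.P.map M.D), πdot d = -(G d - M.FD d) / fD d := by
  filter_upwards [ae_mem_suppD, hM.density.ae_FD_mem,
    hM.density.law_absolutelyContinuous.ae_le hM.density.ae_hasDerivAt_FD] with d h1 h2 h3
    using hM.pidot_eq h1 h2.1 h3.hasDerivWithinAt

/-- On the support |G - F_D| is almost everywhere f_D times the modulus of the bounded policy
derivative; off it G = F_D. -/
lemma integrable_G_sub_FD (hM : M.Intervention fD (M.mixture G) πdot C) :
    Integrable fun d => G d - M.FD d := by
  obtain ⟨R, hR⟩ := hM.structural.policy_bdd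
  refine Integrable.mono' (hM.density.integrable.const_mul R)
    (hM.isContinuousCDF_of_mixture.cont.sub hM.density.isContinuousCDF.cont).aestronglyMeasurable ?_
  filter_upwards [hM.ae_of_ae_law hM.density.ae_FD_mem, hM.density.ae_hasDerivAt_FD,
    hM.ae_fD_eq_zero] with d h1 h2 h3
  by_cases hd : d ∈ M.suppD
  · have h4 := hM.mul_pidot_eq hM.isContinuousCDF_of_mixture.cont hd (h1 hd).1 h2.hasDerivWithinAt
    rw [← norm_neg, ← h4, norm_mul, Real.norm_of_nonneg (hM.density.nonneg d), mul_comm]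
    exact mul_le_mul_of_nonneg_right (hR d hd (h1 hd).1) (hM.density.nonneg d)
  · rw [hM.G_eq_of_notMem hd, h3 hd]
    simp

lemma isPerturbation_mixture (hM : M.Intervention fD (M.mixture G) πdot C) :
    IsPerturbation (M.mixture G) (fun s => -(G s - M.FD s)) M.suppD := by
  refine hM.isPerturbation ?_ hM.integrable_G_sub_FD.neg (fun s hs => ?_) (fun t ht => ?_)
    (Eventually.of_forall fun s => ?_)
  · exact (hM.isContinuousCDF_of_mixture.cont.sub
      hM.density.isContinuousCDF.cont).neg.measurable
  · rw [hM.G_eq_of_notMem hs, sub_self, neg_zero]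
  · rw [← lintegral_const_mul' _ _ ENNReal.ofReal_ne_top]
    congr with s
    rw [← Real.enorm_of_nonneg ht.1.le, ← enorm_mul]
    congr 1
    simp only [mixture]
    ring
  · rw [neg_neg]
    have := ((hasDerivAt_id (0 : ℝ)).mul_const (G s - M.FD s)).const_add (M.FD s)
    simpa [mixture] using this.hasDerivWithinAt

end Intervention

/-! ### Location shifts -/

lemma Assumptions.intervention_shift (hA : M.Assumptions fD M.shift πdot C) :
    M.Intervention fD M.shift πdot C := by
  have hF := hA.density.isContinuousCDF
  refine { hA with
    zero := by ext d; simp [shift]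
    cdf := fun t _ => ⟨fun y z hyz => hF.mono (by linarith), hF.cont.comp (by fun_prop),
      hF.bot.comp (tendsto_atBot_add_const_right _ (-t) tendsto_id),
      hF.top.comp (tendsto_atTop_add_const_right _ (-t) tendsto_id)⟩ }

/-- F_D(s) - F_D(s - t) is the mass of (s - t, s]; by Tonelli's theorem each point r contributes the
length t of [r, r + t). -/
lemma lintegral_FD_sub_shift (M : Model Ω E k) {t : ℝ} (ht : 0 ≤ t) :
    ∫⁻ s, ‖M.shift 0 s - M.shift t s‖ₑ = ENNReal.ofReal t := by
  have h1 : ∀ s, ‖M.shift 0 s - M.shift t s‖ₑ = (M.P.map M.D) (Prod.mk s ⁻¹'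
      {p : ℝ × ℝ | p.1 - t < p.2 ∧ p.2 ≤ p.1}) := fun s => by
    have hset : Prod.mk s ⁻¹' {p : ℝ × ℝ | p.1 - t < p.2 ∧ p.2 ≤ p.1} = Iic s \ Iic (s - t) := by
      ext r
      simp [and_comm]
    have hsub : Iic (s - t) ⊆ Iic s := Iic_subset_Iic.2 (by linarith)
    rw [hset, shift, shift, sub_zero, FD_eq, FD_eq, ← measureReal_sdiff hsub measurableSet_Iic,
      Real.enorm_of_nonneg measureReal_nonneg, ofReal_measureReal]
  have hS : MeasurableSet {p : ℝ × ℝ | p.1 - t < p.2 ∧ p.2 ≤ p.1} :=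
    MeasurableSet.inter
      (measurableSet_lt (by fun_prop) (by fun_prop) : MeasurableSet {p : ℝ × ℝ | p.1 - t < p.2})
      (measurableSet_le measurable_snd measurable_fst)
  simp only [h1]
  rw [← Measure.prod_apply hS, Measure.prod_apply_symm hS]
  have h2 : ∀ r, volume ((fun s : ℝ => (s, r)) ⁻¹' {p : ℝ × ℝ | p.1 - t < p.2 ∧ p.2 ≤ p.1}) =
      ENNReal.ofReal t := fun r => by
    have hset : (fun s : ℝ => (s, r)) ⁻¹' {p : ℝ × ℝ | p.1 - t < p.2 ∧ p.2 ≤ p.1} =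
        Ico r (r + t) := by
      ext s
      simp [sub_lt_iff_lt_add, and_comm]
    rw [hset, Real.volume_Ico, add_sub_cancel_left]
  simp only [h2]
  simp

/-- Here ℓ is f_D, of integral 1. The indicator is there because ℓ has to vanish at every point off
the support, while f_D does so only almost everywhere. -/
lemma Intervention.isPerturbation_shift (hM : M.Intervention fD M.shift πdot C) :
    IsPerturbation M.shift (M.suppD.indicator fD) M.suppD := by
  have hI := isClosed_suppD (M := M).measurableSet
  have hae : M.suppD.indicator fD =ᵐ[volume] fD := by
    filter_upwards [hM.ae_fD_eq_zero] with d hd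
    by_cases h : d ∈ M.suppD
    · rw [indicator_of_mem h]
    · rw [indicator_of_notMem h, hd h]
  have hone : ∫⁻ s, ‖M.suppD.indicator fD s‖ₑ = 1 := by
    have h1 : (M.P.map M.D) univ = 1 := measure_univ
    rw [hM.density.law, withDensity_apply _ MeasurableSet.univ, setLIntegral_univ] at h1
    rw [← h1]
    refine lintegral_congr_ae ?_
    filter_upwards [hae] with s hs
    rw [hs, Real.enorm_of_nonneg (hM.density.nonneg s)]
  refine hM.isPerturbation (hM.density.measurable.indicator hI)
    (hM.density.integrable.indicator hI) (fun s hs => indicator_of_notMem hs _) (fun t ht => ?_) ?_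
  · rw [hone, mul_one, M.lintegral_FD_sub_shift ht.1.le]
  · filter_upwards [hae, hM.density.ae_hasDerivAt_FD] with s h1 h2
    rw [h1]
    have h3 : HasDerivAt (fun t : ℝ => s - t) (-1) 0 := by
      simpa using (hasDerivAt_id (0 : ℝ)).const_sub s
    have h4 : HasDerivAt (fun t => M.FD (s - t)) (fD s * -1) 0 :=
      HasDerivAt.comp (h₂ := M.FD) 0 (by simpa using h2) h3
    simpa [shift] using h4.hasDerivWithinAt

end Model

end MPE

/-! ### Assembly of the two cases -/

open MPE
theorem corollary3 {Ω E : Type*} [MeasurableSpace Ω] [MeasurableSpace E] {k : ℕ}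
    (M : Model Ω E k) (fD : ℝ → ℝ) (πdot : ℝ → ℝ) (C : ℝ → (Fin k → ℝ) → ℝ)
    {B : Type*} [NormedAddCommGroup B] [NormedSpace ℝ B] [CompleteSpace B]
    (DΓ : Set LInf) (Γ : LInf → B) (D₀ : Submodule ℝ LInf) (hD₀ : ContainsContinuous D₀)
    (Γ' : D₀ →L[ℝ] B) (hΓ : HasHadamardDerivAt DΓ Γ (cdfL M.P M.Y) D₀ Γ') :
    -- (i) marginal perturbation in the direction of a distribution function `G`
    (∀ (γ : Measure ℝ) (G : ℝ → ℝ), IsProbabilityMeasure γ → (∀ d, G d = γ.real (Iic d)) →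
      M.Assumptions fD (M.mixture G) πdot C →
      M.InDomain DΓ (M.policy (M.mixture G)) →
      -- the formula for the derivative of the policy function
      (∀ d ∈ M.suppD, 0 < M.FD d → HasDerivWithinAt M.FD (fD d) M.suppD d →
        πdot d = -(G d - M.FD d) / fD d) ∧
      (∀ᵐ d ∂(M.P.map M.D), πdot d = -(G d - M.FD d) / fD d) ∧
      -- `∂_t C(H_t(d), F_X(x))` at `t = 0` exists and equals `F_{X|D}(x|d) (G(d) - F_D(d))`
      (∀ d x, DifferentiableWithinAt ℝ (fun t => C (M.mixture G t d) (M.FX x)) (Icc 0 1) 0) ∧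
      (∀ x, ∀ᵐ d : ℝ, derivWithin (fun t => C (M.mixture G t d) (M.FX x)) (Icc 0 1) 0 =
        M.FXgivenD x d * (G d - M.FD d)) ∧
      -- the marginal policy effect exists and has the stated representations
      ∃ θ : B, M.IsMPE Γ (M.policy (M.mixture G)) θ ∧
        (∃ h : D₀, (∀ y, Integrable (fun ω => πdot (M.D ω) * M.dcondF y (M.D ω) (M.X ω)) M.P ∧
            (h : LInf) y = ∫ ω, πdot (M.D ω) * M.dcondF y (M.D ω) (M.X ω) ∂M.P) ∧
          θ = Γ' h) ∧
        M.EqStieltjesIntegral Γ' (fun d x => M.FXgivenD x d * (G d - M.FD d)) θ ∧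
        M.EqStieltjesIntegral Γ'
          (fun d x => derivWithin (fun t => C (M.mixture G t d) (M.FX x)) (Icc 0 1) 0) θ) ∧
    -- (ii) location shift
    (M.Assumptions fD M.shift πdot C →
      M.InDomain DΓ (M.policy M.shift) →
      ∃ θ : B, M.IsMPE Γ (M.policy M.shift) θ ∧
        ∃ h : D₀, (∀ y, Integrable (fun ω => M.dcondF y (M.D ω) (M.X ω)) M.P ∧
            (h : LInf) y = ∫ ω, M.dcondF y (M.D ω) (M.X ω) ∂M.P) ∧
          θ = Γ' h) := by
  refine ⟨fun γ G _ hG hA hdom => ?_, fun hA hdom => ?_⟩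
  · have hM := hA.intervention_mixture hG
    have hGF := hM.isContinuousCDF_of_mixture
    have hF := hM.density.isContinuousCDF
    refine ⟨fun d hd hd0 => hM.pidot_eq hd hd0, hM.ae_pidot_eq, hM.differentiableWithinAt_copula,
      hM.ae_derivWithin_copula, ?_⟩
    -- This version of the policy derivative is measurable by construction and satisfies -(G - F_D)
    -- = ρ f_D at every point; it agrees with πdot P_D-almost everywhere.
    set ρ : ℝ → ℝ := fun s => -(G s - M.FD s) / fD s with hρdef
    have hρm : Measurable ρ :=
      (hGF.cont.measurable.sub hF.cont.measurable).neg.div hM.density.measurable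
    have hρ : ∀ s, -(G s - M.FD s) = ρ s * fD s := fun s => by
      by_cases hs : s ∈ M.suppD
      · rw [hρdef, div_mul_cancel₀ _ (hM.rank.fD_pos s hs).ne']
      · simp [hρdef, hM.G_eq_of_notMem hs]
    obtain ⟨h, hmem, hval, hlim⟩ := hM.exists_tendsto_cdfL hM.isPerturbation_mixture hρm
      (Eventually.of_forall hρ)
    have hlimΔ : Tendsto (fun d => G d - M.FD d) atTop (𝓝 0) := by
      simpa using hGF.top.sub hF.top
    have hSt : ∀ K : ℝ → (Fin k → ℝ) → ℝ,
        (∀ x, ∀ᵐ d : ℝ, K d x = M.FXgivenD x d * (G d - M.FD d)) →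
        M.EqStieltjesIntegral Γ' K (Γ' ⟨h, hD₀.contLimits_le hmem⟩) := fun K hK =>
      hM.eqStieltjesIntegral hD₀ Γ' hM.integrable_G_sub_FD
        (fun d hd => by rw [hM.G_eq_of_notMem hd, sub_self]) hlimΔ hρm
        (Eventually.of_forall hρ) hmem hval hK
    refine ⟨Γ' ⟨h, hD₀.contLimits_le hmem⟩, Model.isMPE_of_tendsto hΓ hdom _ hlim,
      ⟨⟨h, hD₀.contLimits_le hmem⟩, fun y => ?_, rfl⟩,
      hSt _ fun x => Eventually.of_forall fun d => rfl, hSt _ hM.ae_derivWithin_copula⟩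
    have hae : (fun ω => ρ (M.D ω) * M.dcondF y (M.D ω) (M.X ω)) =ᵐ[M.P]
        fun ω => πdot (M.D ω) * M.dcondF y (M.D ω) (M.X ω) := by
      filter_upwards [ae_of_ae_map M.measurable_D.aemeasurable hM.ae_pidot_eq] with ω hω
      rw [hω]
    exact ⟨(hval y).1.congr hae, (hval y).2.trans (integral_congr_ae hae)⟩
  · have hM := hA.intervention_shift
    -- For a shift ℓ = f_D almost everywhere, so ρ = 1.
    obtain ⟨h, hmem, hval, hlim⟩ := hM.exists_tendsto_cdfL (ρ := fun _ => 1)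
      hM.isPerturbation_shift measurable_const (by
        filter_upwards [hM.ae_fD_eq_zero] with d hd
        by_cases h : d ∈ M.suppD
        · rw [indicator_of_mem h, one_mul]
        · rw [indicator_of_notMem h, hd h, mul_zero])
    simp only [one_mul] at hval
    exact ⟨Γ' ⟨h, hD₀.contLimits_le hmem⟩, Model.isMPE_of_tendsto hΓ hdom _ hlim,
      ⟨h, hD₀.contLimits_le hmem⟩, hval, rfl⟩
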